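/- **Setting.** Let $d\in\{2,3\}$, let $\Omega\subset\mathbb R^d$ be bounded and open with $\operatorname{int}\overline\Omega=\Omega$, let $\mathcal B^\epsilon$ be a finite union of closed balls and $\Omega^\epsilon=\Omega\setminus\mathcal B^\epsilon$. Put $V=\{v\in H^1(\Omega^\epsilon): v=0 \text{ on }\partial\Omega^\epsilon\setminus\mathcal B^\epsilon\}$, $a(v,w)=\int_{\Omega^\epsilon}\nabla v\cdot\nabla w$, $\|v\|_a^2=a(v,v)$, $\|\cdot\|$ the norm of $L^2(\Omega^\epsilon)$. Let $\mathcal T^H$ be a conforming coarse partition of $\Omega^\epsilon$ into elements $K_i=\operatorname{int}(T_i)\setminus\mathcal B^\epsilon\neq\emptyset$, $1\le i\le N_c$, with convex polytopes $T_i\subset\overline\Omega$; let $H=\max_i\operatorname{diam}T_i$, and assume that each $T_i$ contains a ball of radius $\rho H$, where $\rho>0$ is fixed. Let $\{\chi_j\}$ be a Lipschitz partition of unity indexed by the vertices of the mesh, with $0\le\chi_j\le1$, $\chi_j=0$ on the cells that do not have the vertex $j$, such that $B=\prod_{j\text{ vertex of }T_i}\chi_j$ is positive in $\operatorname{int}T_i$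 and zero on $\partial T_i$ for each $i$, and such that $\tilde\kappa=\sum_j|\nabla\chi_j|^2$ is bounded below by a positive constant (for instance the Lagrange basis). Let $s_i(v,w)=\int_{K_i}\tilde\kappa vw$, $s=\sum_i s_i$, $\|v\|_s^2=s(v,v)$. On each $K_i$ let $0\le\lambda_1^i\le\lambda_2^i\le\dots\to\infty$ and $\phi_1^i,\phi_2^i,\dots$ be the eigenvalues and a complete $s_i$-orthonormal system of eigenfunctions of $\int_{K_i}\nabla\phi\cdot\nabla v=\lambda s_i(\phi,v)$ for all $v\in H^1(K_i)$. Fix $l_i\ge1$ with $\lambda^i_{l_i+1}>0$ and put $V_{\rm aux}^i=\operatorname{span}\{\phi^i_1,\dots,\phi^i_{l_i}\}$. For a union $\omega$ of elements let $\Lambda_\omega=\min_{K_i\subset\omega}\lambda^i_{l_i+1}$ (with $\Lambda_\emptyset^{-1}=0$) and $\Gamma_\omega=\max_{K_i\subset\omega}\lambda^i_{l_i}$. Let $K_{i,0}=K_i$, and let $K_{i,m}$ be $K_{i,m-1}$ together with all elements that share a vertex with it. Given $k_i\ge2$, let $V_0(K_{i,k_i})$ be the functions of $H^1(K_{i,k_i})$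 vanishing on $\partial K_{i,k_i}\setminus\mathcal B^\epsilon$, extended by zero. For $1\le j\le l_i$ let $\psi^i_{j,\rm ms}$ and $\psi^i_j$ be minimizers of $a(\psi,\psi)$ over $\psi\in V_0(K_{i,k_i})$, respectively over $\psi\in V$, subject to $s_{i'}(\psi,\phi^{i'}_{j'})=\delta_{ii'}\delta_{jj'}$ for all $i'$ and all $j'\le l_{i'}$. Let $V_{\rm ms}=\operatorname{span}\{\psi^i_{j,\rm ms}\}$ and $V_{\rm glo}=\operatorname{span}\{\psi^i_j\}$. For $f\in L^2(\Omega^\epsilon)$ let $u\in V$, $u_{\rm ms}\in V_{\rm ms}$, $u_{\rm glo}\in V_{\rm glo}$ be solutions of $a(\cdot,v)=\int_{\Omega^\epsilon}fv$ for all $v$ in $V$, $V_{\rm ms}$, $V_{\rm glo}$, respectively. Finally let $k=\max_ik_i$, let $C_{\mathcal T}$ be the square of the maximal number of vertices of a cell, $C_\pi=\sup_{i,\ \mu\in V_{\rm aux}^i}\int_{K_i}\tilde\kappa\mu^2/\int_{K_i}B\tilde\kappa\mu^2$, $D_\omega=C_\pi^2C_{\mathcal T}(1+\Gamma_\omega)$,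 and $$E=\max_iE_i,\qquad E_i=8D_{K_{i,k_i}}^2\bigl(1+\Lambda^{-1}_{\Omega^\epsilon\setminus K_{i,k_i-1}}\bigr)\Bigl(1+\frac{\Lambda_{K_{i,k_i-1}}^{1/2}}{2D_{K_{i,k_i-1}}^{1/2}}\Bigr)^{1-k_i}.$$ **Theorem.** (1) There is a constant $C$ depending only on $d$ and $\rho$ such that $$\|u-u_{\rm ms}\|_a\le C\Lambda_{\Omega^\epsilon}^{-1/2}\|\tilde\kappa^{-1/2}f\|+C(k+1)^{d/2}E^{1/2}\|u_{\rm glo}\|_s .$$ (2) For all $M,\gamma>0$ there is a constant $c>0$ depending only on $d,\rho,M,\gamma$, and, for every $\Omega^\epsilon$ which is connected and satisfies $\partial\Omega\not\subset\mathcal B^\epsilon$, a constant $C$ depending only on $d,\rho,M,\gamma$ and $\Omega^\epsilon$, such that the following holds for all meshes and all choices as above. If the $T_i$ are axis-parallel boxes, $\{\chi_j\}$ is the bilinear (trilinear if $d=3$) partition of unity, $C_\pi,\Gamma_{\Omega^\epsilon},\Lambda_{\Omega^\epsilon}\le M$, and the numbers of layers are sufficiently large in the sense that for all $i$ $$k_i\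 \ge\ c\,\frac{\log(H^{-1})}{\log\bigl(1+\Lambda_{K_{i,k_i-1}}^{1/2}\max\{\gamma,\Gamma_{K_{i,k_i-1}}\}^{-1/2}\bigr)},$$ then $$\|u-u_{\rm ms}\|_a\le CH\Lambda_{\Omega^\epsilon}^{-1/2}\|f\|.$$ -/

import Mathlib

open MeasureTheory Set
open scoped ContDiff

noncomputable section

namespace CEM

/-- Euclidean space `ℝ^d`. -/
abbrev E (d : ℕ) : Type := EuclideanSpace ℝ (Fin d)

variable {d : ℕ}

/-! ### First order Sobolev functions -/

/-- `g` is a weak gradient of `v` on `U`: integration by parts holds against all smooth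
functions with compact support inside `U`, in all directions `y`. -/
def HasWeakGrad (U : Set (E d)) (v : E d → ℝ) (g : E d → E d) : Prop :=
  ∀ η : E d → ℝ, ContDiff ℝ ∞ η → HasCompactSupport η → tsupport η ⊆ U → ∀ y : E d,
    ∫ x in U, v x * fderiv ℝ η x y = - ∫ x in U, inner ℝ (g x) y * η x

/-- `v ∈ H¹(U)`, for functions given by representatives; the values outside `U` are
irrelevant. -/
def MemH1 (U : Set (E d)) (v : E d → ℝ) : Prop :=
  MemLp v 2 (volume.restrict U) ∧
    ∃ g : E d → E d, MemLp g 2 (volume.restrict U) ∧ HasWeakGrad U v g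

open Classical in
/-- The weak gradient of `v ∈ H¹(U)` (unique up to null sets; `0` if `v` has none). -/
def weakGrad (U : Set (E d)) (v : E d → ℝ) : E d → E d :=
  if h : ∃ g : E d → E d, MemLp g 2 (volume.restrict U) ∧ HasWeakGrad U v g then h.choose else 0

/-- The Dirichlet form `∫_U ∇v · ∇w`. -/
def aForm (U : Set (E d)) (v w : E d → ℝ) : ℝ :=
  ∫ x in U, inner ℝ (weakGrad U v x) (weakGrad U w x)

/-- The weighted `L²` form `∫_U κ v w`. -/
def sForm (κ : E d → ℝ) (U : Set (E d)) (v w : E d → ℝ) : ℝ :=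
  ∫ x in U, κ x * v x * w x

/-- The `L²(U)` norm. -/
def l2norm (U : Set (E d)) (v : E d → ℝ) : ℝ := Real.sqrt (∫ x in U, v x ^ 2)

/-! ### Perforated domains -/

/-- A bounded open set `Ω` from which finitely many round closed balls (the perforations)
are removed. The balls may overlap and may reach `∂Ω`.
The condition `interior (closure Ω) = Ω` says that `Ω` has no slits, i.e. that it does not lie on
both sides of its boundary. -/
structure PerforatedDomain (d : ℕ) where
  Ω : Set (E d)
  isOpen : IsOpen Ω
  isBounded : Bornology.IsBounded Ω
  regular : interior (closure Ω) = Ω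
  numHoles : ℕ
  center : Fin numHoles → E d
  radius : Fin numHoles → ℝ
  radius_pos : ∀ m, 0 < radius m

namespace PerforatedDomain

variable (P : PerforatedDomain d)

/-- The union of the perforations. -/
def holes : Set (E d) := ⋃ m, Metric.closedBall (P.center m) (P.radius m)

/-- The perforated domain `Ω^ε`. -/
def fluid : Set (E d) := P.Ω \ P.holes

/-- For a set `A`, the functions of `H¹` of `A` without the perforations which vanish on the part
of `∂A` outside the perforations, identified with their extension by zero: the zero boundary
condition (in the sense of traces) on that part of the boundary says that the extension by zero
across it is still an `H¹` function off the perforations. Nothing is prescribed on the boundary of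
the perforations. -/
def V0 (A : Set (E d)) : Set (E d → ℝ) :=
  {v | MemH1 P.holesᶜ v ∧ ∀ᵐ x ∂(volume.restrict P.holesᶜ), x ∉ A → v x = 0}

/-- The space `V` of the functions of `H¹(Ω^ε)` which vanish on `∂Ω^ε ∩ ∂Ω`. -/
def V : Set (E d → ℝ) := P.V0 P.fluid

/-- The energy norm `‖v‖_a`. -/
def aNorm (v : E d → ℝ) : ℝ := Real.sqrt (aForm P.fluid v v)

/-- `u` is the Galerkin solution in the space `W` for the right-hand side `f`:
`u ∈ W` and `a(u, v) = (f, v)` for all `v ∈ W`. -/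
def IsGalerkin (W : Set (E d → ℝ)) (f u : E d → ℝ) : Prop :=
  u ∈ W ∧ ∀ v ∈ W, aForm P.fluid u v = ∫ x in P.fluid, f x * v x

end PerforatedDomain

/-! ### Coarse meshes and partitions of unity -/

/-- The convex polytope spanned by the nodes with index in `s`. -/
def polytope {n : ℕ} (node : Fin n → E d) (s : Finset (Fin n)) : Set (E d) :=
  convexHull ℝ (node '' (s : Set (Fin n)))

/-- A conforming partition of the perforated domain, cut out by convex polytopes
(simplices, boxes, …): two cells meet exactly in the polytope spanned by their common vertices,
and they have disjoint interiors. Cells that are swallowed by the perforations are not listed. -/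
structure CoarseMesh (P : PerforatedDomain d) where
  numCells : ℕ
  numNodes : ℕ
  node : Fin numNodes → E d
  node_injective : Function.Injective node
  /-- the vertices of each cell -/
  verts : Fin numCells → Finset (Fin numNodes)
  interior_nonempty : ∀ i, (interior (polytope node (verts i))).Nonempty
  vertex_extreme : ∀ i, ∀ j ∈ verts i, node j ∈ (polytope node (verts i)).extremePoints ℝ
  no_hanging : ∀ i j, node j ∈ polytope node (verts i) → j ∈ verts i
  conforming : ∀ i i',
    polytope node (verts i) ∩ polytope node (verts i') = polytope node (verts i ∩ verts i')
  disjoint_interior : ∀ i i', i ≠ i' →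
    Disjoint (interior (polytope node (verts i))) (interior (polytope node (verts i')))
  cell_subset : ∀ i, polytope node (verts i) ⊆ closure P.Ω
  cover : P.fluid ⊆ ⋃ i, polytope node (verts i)
  meets_fluid : ∀ i, (interior (polytope node (verts i)) \ P.holes).Nonempty

namespace CoarseMesh

variable {P : PerforatedDomain d} (T : CoarseMesh P)

/-- The closed background cell with index `i`. -/
def cell (i : Fin T.numCells) : Set (E d) := polytope T.node (T.verts i)

/-- The (open) coarse element `K_i` of the perforated domain. -/
def elem (i : Fin T.numCells) : Set (E d) := interior (T.cell i) \ P.holes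

/-- The coarse mesh size `H`, the largest diameter of a cell. -/
def meshSize : ℝ := ⨆ i, Metric.diam (T.cell i)

/-- Quasi-uniformity: every cell contains a ball of radius `ρ H`. -/
def IsQuasiUniform (ρ : ℝ) : Prop :=
  ∀ i, ∃ x, Metric.closedBall x (ρ * T.meshSize) ⊆ T.cell i

/-- The indices of the elements that make up `K_{i,m}`: enlarge `K_i` by `m` layers of elements,
where each layer consists of all elements that share a vertex with the previous ones. -/
def layer (T : CoarseMesh P) (i : Fin T.numCells) : ℕ → Set (Fin T.numCells)
  | 0 => {i}
  | m + 1 => {j | ∃ j' ∈ layer T i m, (T.verts j ∩ T.verts j').Nonempty}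

/-- The oversampling region `K_{i,m}` (as a union of closed cells, the perforations not yet
removed). -/
def region (i : Fin T.numCells) (m : ℕ) : Set (E d) := ⋃ j ∈ T.layer i m, T.cell j

/-- `C_𝒯`, the square of the maximal number of vertices of a coarse element. -/
def CT : ℝ := ((Finset.univ.sup fun i => (T.verts i).card : ℕ) : ℝ) ^ 2

end CoarseMesh

/-- The weight `κ̃ = ∑_j |∇χ_j|²`. -/
def weight {n : ℕ} (χ : Fin n → E d → ℝ) (x : E d) : ℝ := ∑ j, ‖fderiv ℝ (χ j) x‖ ^ 2

/-- A partition of unity `{χ_j}` subordinate to the vertex patches of the coarse mesh, with the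
basic properties of the Lagrange basis: `χ_j` is Lipschitz, `χ_j ≥ 0`, `∑_j χ_j = 1`, `χ_j` vanishes
on the cells which do not have the vertex `j`, the product of the `χ_j` over the vertices of a cell
is a bubble function of the cell (positive inside, zero on the boundary), and the
weight `κ̃ = ∑_j |∇χ_j|²` does not degenerate (so that `κ̃^{-1/2}` makes sense). -/
structure PartitionOfUnity {P : PerforatedDomain d} (T : CoarseMesh P) where
  χ : Fin T.numNodes → E d → ℝ
  lipschitz : ∀ j, ∃ L, LipschitzOnWith L (χ j) (⋃ i, T.cell i)
  nonneg : ∀ j, ∀ x ∈ ⋃ i, T.cell i, 0 ≤ χ j x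
  sum_eq_one : ∀ x ∈ ⋃ i, T.cell i, ∑ j, χ j x = 1
  support : ∀ i, ∀ j ∉ T.verts i, ∀ x ∈ T.cell i, χ j x = 0
  bubble_pos : ∀ i, ∀ x ∈ interior (T.cell i), 0 < ∏ j ∈ T.verts i, χ j x
  bubble_zero : ∀ i, ∀ x ∈ frontier (T.cell i), ∏ j ∈ T.verts i, χ j x = 0
  weight_pos : ∃ κ₀ > 0, ∀ᵐ x ∂(volume.restrict P.fluid), κ₀ ≤ weight χ x

namespace PartitionOfUnity

variable {P : PerforatedDomain d} {T : CoarseMesh P} (X : PartitionOfUnity T)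

/-- The weight `κ̃`. -/
def κ : E d → ℝ := weight X.χ

/-- The bubble function `B = ∏_j χ_j` of the element `K_i`. -/
def bubble (i : Fin T.numCells) (x : E d) : ℝ := ∏ j ∈ T.verts i, X.χ j x

/-- `{χ_j}` is the set of bilinear (in dimension three: trilinear) Lagrange basis functions of a
mesh of axis-parallel boxes. -/
def IsBilinear : Prop :=
  ∀ i, ∃ lo hi : Fin d → ℝ, (∀ t, lo t < hi t) ∧
    T.cell i = {x | ∀ t, lo t ≤ x t ∧ x t ≤ hi t} ∧
    ∀ j ∈ T.verts i, (∀ t, T.node j t = lo t ∨ T.node j t = hi t) ∧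
      ∀ x ∈ T.cell i, X.χ j x =
        ∏ t, (if T.node j t = lo t then (hi t - x t) / (hi t - lo t)
          else (x t - lo t) / (hi t - lo t))

end PartitionOfUnity

/-- The solution of the local spectral problem `a_i(φ, v) = λ s_i(φ, v)` for all `v ∈ H¹(K_i)`:
the eigenvalues listed in ascending order with multiplicity (they tend to infinity), and a
corresponding complete `s_i`-orthonormal system of eigenfunctions. Indices start at `0`. -/
structure LocalSpectrum {P : PerforatedDomain d} {T : CoarseMesh P} (X : PartitionOfUnity T)
    (i : Fin T.numCells) where
  eigenfun : ℕ → E d → ℝ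
  eigenval : ℕ → ℝ
  memH1 : ∀ j, MemH1 (T.elem i) (eigenfun j)
  eigen : ∀ j, ∀ v, MemH1 (T.elem i) v →
    aForm (T.elem i) (eigenfun j) v = eigenval j * sForm X.κ (T.elem i) (eigenfun j) v
  monotone : Monotone eigenval
  tendsto : Filter.Tendsto eigenval Filter.atTop Filter.atTop
  orthonormal : ∀ j j',
    sForm X.κ (T.elem i) (eigenfun j) (eigenfun j') = if j = j' then 1 else 0
  complete : ∀ w, MemLp w 2 (volume.restrict (T.elem i)) →
    (∀ j, sForm X.κ (T.elem i) w (eigenfun j) = 0) → ∀ᵐ x ∂(volume.restrict (T.elem i)), w x = 0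

/-! ### The constraint version of the multiscale method -/

/-- All the data of the method on a given perforated domain: a coarse mesh, a partition of unity, the local
spectra, the numbers `l_i ≥ 1` of eigenfunctions kept in the auxiliary spaces (with
`λ^i_{l_i+1} > 0`), and the numbers `k_i ≥ 2` of oversampling layers. -/
structure Discretization (P : PerforatedDomain d) where
  mesh : CoarseMesh P
  pou : PartitionOfUnity mesh
  spec : ∀ i, LocalSpectrum pou i
  l : Fin mesh.numCells → ℕ
  l_pos : ∀ i, 1 ≤ l i
  gap : ∀ i, 0 < (spec i).eigenval (l i)
  k : Fin mesh.numCells → ℕ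
  two_le_k : ∀ i, 2 ≤ k i

namespace Discretization

variable {P : PerforatedDomain d} (S : Discretization P)

/-- The `s`-norm `‖v‖_s`. -/
def sNorm (v : E d → ℝ) : ℝ := Real.sqrt (sForm S.pou.κ P.fluid v v)

/-- The function `κ̃^{-1/2} f`. -/
def scaled (f : E d → ℝ) (x : E d) : ℝ := S.pou.κ x ^ (-(1 / 2) : ℝ) * f x

/-- The local auxiliary space `V_aux^i`, the span of the first `l_i` eigenfunctions. -/
def Vaux (i : Fin S.mesh.numCells) : Submodule ℝ (E d → ℝ) :=
  Submodule.span ℝ {φ | ∃ j < S.l i, φ = (S.spec i).eigenfun j}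

/-- `Λ_A`, the minimum of `λ^i_{l_i+1}` over the elements of `A`; regions are given by the set of
indices of their elements. (For the empty region the minimum is `+∞`; it only occurs through its
inverse `0`, in agreement with `(sInf ∅)⁻¹ = 0⁻¹ = 0`.) -/
def Lam (A : Set (Fin S.mesh.numCells)) : ℝ := sInf ((fun i => (S.spec i).eigenval (S.l i)) '' A)

/-- `Γ_A`, the maximum of `λ^i_{l_i}` over the elements of `A`. -/
def Gam (A : Set (Fin S.mesh.numCells)) : ℝ :=
  sSup ((fun i => (S.spec i).eigenval (S.l i - 1)) '' A)

/-- `C_π`, the supremum of `∫_K κ̃ μ² / ∫_K B κ̃ μ²` over the elements `K` and `μ` in the auxiliary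
space of `K`. -/
def Cpi : ℝ :=
  sSup {r | ∃ i, ∃ μ ∈ S.Vaux i, r = sForm S.pou.κ (S.mesh.elem i) μ μ /
    sForm (fun x => S.pou.bubble i x * S.pou.κ x) (S.mesh.elem i) μ μ}

/-- `D_A = C_π² C_𝒯 (1 + Γ_A)`. -/
def D (A : Set (Fin S.mesh.numCells)) : ℝ := S.Cpi ^ 2 * S.mesh.CT * (1 + S.Gam A)

/-- The decay factor `E_i`. -/
def decay (i : Fin S.mesh.numCells) : ℝ :=
  8 * S.D (S.mesh.layer i (S.k i)) ^ 2 * (1 + (S.Lam (S.mesh.layer i (S.k i - 1))ᶜ)⁻¹) *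
    (1 + Real.sqrt (S.Lam (S.mesh.layer i (S.k i - 1))) /
      (2 * Real.sqrt (S.D (S.mesh.layer i (S.k i - 1))))) ^ (1 - (S.k i : ℤ))

/-- `E = max_i E_i`. -/
def maxDecay : ℝ := ⨆ i, S.decay i

/-- `k = max_i k_i`. -/
def maxK : ℕ := Finset.univ.sup S.k

/-- A family of functions indexed like the auxiliary basis `φ_j^i`, `j = 1, …, l_i`. -/
abbrev BasisFamily : Type := (i : Fin S.mesh.numCells) → Fin (S.l i) → E d → ℝ

/-- `ψ` is `φ_j^i`-orthogonal. -/
def IsOrthogonal (i : Fin S.mesh.numCells) (j : Fin (S.l i)) (ψ : E d → ℝ) : Prop :=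
  ∀ (i' : Fin S.mesh.numCells) (j' : Fin (S.l i')),
    sForm S.pou.κ (S.mesh.elem i') ψ ((S.spec i').eigenfun j') =
      if i' = i ∧ (j' : ℕ) = j then 1 else 0

/-- `ψ` minimizes `a(ψ, ψ)` among the `φ_j^i`-orthogonal functions of the space `W`. -/
def IsEnergyMin (W : Set (E d → ℝ)) (i : Fin S.mesh.numCells) (j : Fin (S.l i))
    (ψ : E d → ℝ) : Prop :=
  (ψ ∈ W ∧ S.IsOrthogonal i j ψ) ∧
    ∀ ψ' ∈ W, S.IsOrthogonal i j ψ' → aForm P.fluid ψ ψ ≤ aForm P.fluid ψ' ψ'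

/-- The multiscale basis functions `ψ_{j,ms}^i`: energy minimizers in `V_0(K_{i,k_i})`. -/
def IsMsBasis (ψ : S.BasisFamily) : Prop :=
  ∀ i j, S.IsEnergyMin (P.V0 (S.mesh.region i (S.k i))) i j (ψ i j)

/-- The global basis functions `ψ_j^i`: energy minimizers in `V`. -/
def IsGloBasis (ψ : S.BasisFamily) : Prop :=
  ∀ i j, S.IsEnergyMin P.V i j (ψ i j)

/-- The span of a family of basis functions (this is `V_ms`, respectively `V_glo`). -/
def spanOf (ψ : S.BasisFamily) : Submodule ℝ (E d → ℝ) :=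
  Submodule.span ℝ {v | ∃ i j, v = ψ i j}

end Discretization

end CEM

end

noncomputable section

/-! Let π collect the coefficients of a function of V with respect to all auxiliary eigenfunctions,
and let W be the kernel of π in V. On W the spectral gap gives ‖w‖_s ≤ Λ^{-1/2}‖w‖_a, and the
Euler–Lagrange equations of the minimizers say that V_glo is a-orthogonal to W. If z in V_glo has
the same coefficients as u − u_glo, then z is orthogonal both to u − u_glo (Galerkin) and to u −
u_glo − z (an element of W), so ∇z = 0. The energy of u − u_glo is therefore that of an element of
W, and it equals a load tested with that element; this yields the term Λ^{-1/2}‖κ̃^{-1/2}f‖.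

For the localization error the bases are never compared function by function. Let v be the
combination of multiscale functions with the coefficients of u_glo, and e = u_glo − v, an element of
W. Then ‖e‖_a² = −a(v,e) = −∑ a(v_i,e), where v_i is the part of v that belongs to the cell i. Each
v_i is orthogonal to the functions of W supported in K_{i,k_i}, so e may be replaced by a version
that vanishes on K_{i,k_i−1}, and only the outermost layer contributes. There v_i is exponentially
small (`IsLocalized.decay`, `IsLocalized.inner_le`). Cauchy–Schwarz and the finite overlap of the
oversampling regions (`card_layer_le`) sum up the cells.

The tool behind the decay is a cutoff that respects W (`exists_quasi_projection`): multiply by a sum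
of χ_j, then repair the lost coefficients cell by cell with bubble times eigenfunction combinations
(`exists_bubble_lift`). Bubbles are confined to one cell, so the repair does not spread; its cost is
measured by D.

For boxes, κ̃ is comparable to H^{-2}. Hence ‖κ̃^{-1/2}f‖ ≲ H‖f‖, and a Friedrichs inequality gives
‖u‖_s ≲ H^{-1}‖f‖. The condition on k_i makes E of order H^{4+d}Λ^{-1}; its root H²H^{d/2}Λ^{-1/2}
pays for H^{-1} and for the square root of the number of cells, and one power of H remains. This
part uses the coefficients of u itself, so u_glo does not occur (`error_le`). The Friedrichs
inequality needs no Rellich theorem: the spectral gaps of a single discretization reduce it to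
compactness in a finite-dimensional space. -/

namespace CEM

variable {d : ℕ}

/-! ### Mollification -/

/-- A sequence of smooth mollifier kernels whose supports shrink to the origin. -/
def mollifier (d : ℕ) (δ : ℝ) (hδ : 0 < δ) (n : ℕ) : ContDiffBump (0 : E d) where
  -- The shift by 2 keeps the outer radius below δ already for n = 0. The fixed ratio of the radii
  -- is what almost everywhere convergence of the convolutions requires.
  rIn := δ / (2 * (n + 2))
  rOut := δ / (n + 2)
  rIn_pos := by positivity
  rIn_lt_rOut := by
    apply div_lt_div_of_pos_left hδ <;> nlinarith [Nat.cast_nonneg (α := ℝ) n]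

lemma mollifier_rOut_lt {δ : ℝ} (hδ : 0 < δ) (n : ℕ) : (mollifier d δ hδ n).rOut < δ := by
  show δ / (n + 2) < δ
  rw [div_lt_iff₀ (by positivity)]
  nlinarith [Nat.cast_nonneg (α := ℝ) n]

lemma mollifier_tendsto {δ : ℝ} (hδ : 0 < δ) :
    Filter.Tendsto (fun n => (mollifier d δ hδ n).rOut) Filter.atTop (nhds 0) := by
  show Filter.Tendsto (fun n : ℕ => δ / ((n : ℝ) + 2)) Filter.atTop (nhds 0)
  exact Filter.Tendsto.div_atTop tendsto_const_nhds
    (Filter.tendsto_atTop_add_const_right _ _ tendsto_natCast_atTop_atTop)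

lemma mollifier_ratio {δ : ℝ} (hδ : 0 < δ) (n : ℕ) :
    (mollifier d δ hδ n).rOut ≤ 2 * (mollifier d δ hδ n).rIn := by
  show δ / (n + 2) ≤ 2 * (δ / (2 * (n + 2)))
  apply le_of_eq
  field_simp

/-- The mollification of a function. -/
def mollify {δ : ℝ} (hδ : 0 < δ) (n : ℕ) (φ : E d → ℝ) : E d → ℝ :=
  convolution ((mollifier d δ hδ n).normed volume) φ (ContinuousLinearMap.lsmul ℝ ℝ) volume

lemma contDiff_mollify {δ : ℝ} (hδ : 0 < δ) (n : ℕ) {φ : E d → ℝ} (h : LocallyIntegrable φ) :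
    ContDiff ℝ ∞ (mollify hδ n φ) :=
  HasCompactSupport.contDiff_convolution_left (n := (⊤ : ℕ∞)) _
    (mollifier d δ hδ n).hasCompactSupport_normed
    ((mollifier d δ hδ n).contDiff_normed) h

lemma ae_tendsto_mollify {δ : ℝ} (hδ : 0 < δ) {φ : E d → ℝ} (h : LocallyIntegrable φ) :
    ∀ᵐ x, Filter.Tendsto (fun n => mollify hδ n φ x) Filter.atTop (nhds (φ x)) :=
  ContDiffBump.ae_convolution_tendsto_right_of_locallyIntegrable (K := 2)
    (mollifier_tendsto hδ) (Filter.Eventually.of_forall (mollifier_ratio hδ)) h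

lemma mollify_eq_zero {δ : ℝ} (hδ : 0 < δ) (n : ℕ) {φ : E d → ℝ} {x : E d}
    (hx : x ∉ Metric.thickening δ (Function.support φ)) : mollify hδ n φ x = 0 := by
  by_contra hne
  obtain ⟨a, ha, b, hb, rfl⟩ := support_convolution_subset _ (Function.mem_support.2 hne)
  rw [ContDiffBump.support_normed_eq, mem_ball_zero_iff] at ha
  apply hx
  rw [Metric.mem_thickening_iff]
  exact ⟨b, hb, by simpa using ha.trans (mollifier_rOut_lt hδ n)⟩

/-- The averages differ from φ x by at most 2M. The sharp bound would be M, but any bound uniform in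
n serves for dominated convergence. -/
lemma abs_mollify_le {δ : ℝ} (hδ : 0 < δ) (n : ℕ) {φ : E d → ℝ} (hm : AEStronglyMeasurable φ volume)
    {M : ℝ} (hM : ∀ x, |φ x| ≤ M) (x : E d) : |mollify hδ n φ x| ≤ 3 * M := by
  have h := ContDiffBump.dist_normed_convolution_le (φ := mollifier d δ hδ n) (x₀ := x) (ε := 2 * M)
    hm (fun y _ => by
      rw [Real.dist_eq]
      have := abs_sub (φ y) (φ x)
      linarith [hM x, hM y])
  rw [Real.dist_eq] at h
  change |mollify hδ n φ x - φ x| ≤ 2 * M at h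
  have h1 := abs_add_le (mollify hδ n φ x - φ x) (φ x)
  rw [sub_add_cancel] at h1
  linarith [hM x]

/-- The derivative is put on φ and not on the kernel, so that derivatives of mollifications converge
almost everywhere and stay bounded by the Lipschitz constant. -/
lemma fderiv_mollify {δ : ℝ} (hδ : 0 < δ) (n : ℕ) {φ : E d → ℝ} {L : NNReal}
    (hφ : LipschitzWith L φ) (x y : E d) :
    fderiv ℝ (mollify hδ n φ) x y = mollify hδ n (fun z => fderiv ℝ φ z y) x := by
  set b := (mollifier d δ hδ n).normed (volume : Measure (E d)) with hb
  have hbc : Continuous b := (mollifier d δ hδ n).continuous_normed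
  have hbs : HasCompactSupport b := (mollifier d δ hδ n).hasCompactSupport_normed
  have hbi : Integrable b := (mollifier d δ hδ n).integrable_normed
  have hmeas : Measurable fun t : E d => fderiv ℝ φ (x - t) :=
    (measurable_fderiv ℝ φ).comp (measurable_const.sub measurable_id)
  have key := hasFDerivAt_integral_of_dominated_loc_of_lip (𝕜 := ℝ) (μ := (volume : Measure (E d)))
    (F := fun x t => b t * φ (x - t)) (F' := fun t => b t • fderiv ℝ φ (x - t)) (x₀ := x)
    (bound := fun t => |b t| * L) (s := univ) Filter.univ_mem
    (Filter.Eventually.of_forall fun z => by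
      have := hφ.continuous
      exact Continuous.aestronglyMeasurable (by fun_prop))
    (by
      have := hφ.continuous
      exact Continuous.integrable_of_hasCompactSupport (by fun_prop) hbs.mul_right)
    (hbc.aestronglyMeasurable.smul hmeas.aestronglyMeasurable)
    (Filter.Eventually.of_forall fun t => by
      rw [lipschitzOnWith_univ]
      refine LipschitzWith.of_dist_le_mul fun z w => ?_
      rw [Real.dist_eq, ← mul_sub, abs_mul, Real.coe_nnabs, abs_mul, abs_abs, NNReal.abs_eq, mul_assoc]
      refine mul_le_mul_of_nonneg_left ?_ (abs_nonneg _)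
      have := hφ.dist_le_mul (z - t) (w - t)
      rwa [Real.dist_eq, dist_sub_right] at this)
    (hbi.abs.mul_const _)
    (by
      -- Rademacher's theorem for φ, carried over by the measure preserving map t ↦ x − t.
      have h1 : ∀ᵐ t : E d, DifferentiableAt ℝ φ (x - t) :=
        (Measure.measurePreserving_sub_left (volume : Measure (E d)) x).quasiMeasurePreserving.ae
          (hφ.ae_differentiableAt)
      filter_upwards [h1] with t ht
      have h2 : HasFDerivAt (fun z => φ (z - t)) (fderiv ℝ φ (x - t)) x := by
        exact (hasFDerivAt_comp_sub t).2 ht.hasFDerivAt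
      simpa [smul_eq_mul] using h2.const_mul (b t))
  have h3 : mollify hδ n φ = fun x => ∫ t, b t * φ (x - t) := by
    ext z; simp [mollify, convolution, hb]
  rw [h3, key.2.fderiv, ContinuousLinearMap.integral_apply key.1]
  simp [mollify, convolution, hb]

/-! ### Weak gradients -/

/-- `v ∈ H¹(U)` with weak gradient `g`. -/
structure IsGrad (U : Set (E d)) (v : E d → ℝ) (g : E d → E d) : Prop where
  memLp : MemLp v 2 (volume.restrict U)
  memLp_grad : MemLp g 2 (volume.restrict U)
  weak : HasWeakGrad U v g

lemma IsGrad.memH1 {U : Set (E d)} {v : E d → ℝ} {g : E d → E d} (h : IsGrad U v g) : MemH1 U v :=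
  ⟨h.memLp, g, h.memLp_grad, h.weak⟩

lemma MemH1.isGrad {U : Set (E d)} {v : E d → ℝ} (h : MemH1 U v) : IsGrad U v (weakGrad U v) := by
  have h2 := h.2
  refine ⟨h.1, ?_, ?_⟩ <;> rw [weakGrad, dif_pos h2]
  exacts [h2.choose_spec.1, h2.choose_spec.2]

lemma memLp_of_bounded_of_compact {U : Set (E d)} {F : E d → ℝ} (hm : AEStronglyMeasurable F volume)
    {M : ℝ} (hM : ∀ x, |F x| ≤ M) {K : Set (E d)} (hK : IsCompact K) (hs : ∀ x ∉ K, F x = 0) :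
    MemLp F 2 (volume.restrict U) := by
  have h1 : MemLp (K.indicator fun _ => M) 2 (volume : Measure (E d)) :=
    memLp_indicator_const 2 hK.measurableSet M (Or.inr hK.measure_lt_top.ne)
  refine (MemLp.mono h1 hm (Filter.Eventually.of_forall fun x => ?_)).restrict U
  by_cases hx : x ∈ K
  · rw [indicator_of_mem hx, Real.norm_eq_abs, Real.norm_eq_abs]; exact (hM x).trans (le_abs_self M)
  · simp [hs x hx]

lemma memLp_fderiv_apply {U : Set (E d)} {φ : E d → ℝ} {L : NNReal} (hφ : LipschitzWith L φ)
    (hc : HasCompactSupport φ) (y : E d) : MemLp (fun x => fderiv ℝ φ x y) 2 (volume.restrict U) := by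
  refine memLp_of_bounded_of_compact (M := L * ‖y‖)
    ((measurable_fderiv_apply_const ℝ φ y).aestronglyMeasurable) (fun x => ?_) hc (fun x hx => ?_)
  · exact (ContinuousLinearMap.le_opNorm _ _).trans
      (mul_le_mul_of_nonneg_right (norm_fderiv_le_of_lipschitz ℝ hφ) (norm_nonneg _))
  · rw [fderiv_of_notMem_tsupport ℝ hx]; rfl

lemma memLp_of_lipschitz {U : Set (E d)} {φ : E d → ℝ} {L : NNReal} (hφ : LipschitzWith L φ)
    (hc : HasCompactSupport φ) : MemLp φ 2 (volume.restrict U) :=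
  (hφ.continuous.memLp_of_hasCompactSupport hc).restrict U

lemma exists_lipschitz_of_contDiff {η : E d → ℝ} (h : ContDiff ℝ ∞ η) (hc : HasCompactSupport η) :
    ∃ L : NNReal, LipschitzWith L η :=
  ContDiff.lipschitzWith_of_hasCompactSupport hc h (by simp)

lemma integrable_inner_mul {U : Set (E d)} {g : E d → E d} (hg : MemLp g 2 (volume.restrict U))
    {φ : E d → ℝ} (hφ : MemLp φ 2 (volume.restrict U)) (y : E d) :
    Integrable (fun x => inner ℝ (g x) y * φ x) (volume.restrict U) := by
  have h1 : MemLp (fun x => inner ℝ (g x) y) 2 (volume.restrict U) := hg.inner_const y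
  exact h1.integrable_mul hφ

/-- Weak gradients may be tested with Lipschitz functions of compact support. -/
lemma IsGrad.integral_lipschitz {U : Set (E d)} {v : E d → ℝ} {g : E d → E d}
    (hU : IsOpen U) (h : IsGrad U v g) {φ : E d → ℝ} {L : NNReal} (hφ : LipschitzWith L φ)
    (hc : HasCompactSupport φ) (hsub : tsupport φ ⊆ U) (y : E d) :
    ∫ x in U, v x * fderiv ℝ φ x y = - ∫ x in U, inner ℝ (g x) y * φ x := by
  -- The margin δ keeps the supports of all mollifications in one compact subset of U, so they are
  -- admissible test functions with a common dominating function.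
  obtain ⟨δ, hδ, hδU⟩ := IsCompact.exists_cthickening_subset_open hc hU hsub
  set K := Metric.cthickening δ (tsupport φ) with hKdef
  have hK : IsCompact K := IsCompact.cthickening hc
  obtain ⟨M, hM⟩ : ∃ M, ∀ x, |φ x| ≤ M := by
    obtain ⟨M, hM⟩ := hc.exists_bound_of_continuous hφ.continuous
    exact ⟨M, hM⟩
  have hL : ∀ x, |fderiv ℝ φ x y| ≤ L * ‖y‖ := fun x =>
    (ContinuousLinearMap.le_opNorm _ _).trans
      (mul_le_mul_of_nonneg_right (norm_fderiv_le_of_lipschitz ℝ hφ) (norm_nonneg _))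
  have hmeas : AEStronglyMeasurable (fun x => fderiv ℝ φ x y) (volume : Measure (E d)) :=
    (measurable_fderiv_apply_const ℝ φ y).aestronglyMeasurable
  have hint : LocallyIntegrable φ := hφ.continuous.locallyIntegrable
  have hint' : LocallyIntegrable (fun x => fderiv ℝ φ x y) := by
    have h1 := memLp_fderiv_apply (U := univ) hφ hc y
    rw [Measure.restrict_univ] at h1
    exact h1.locallyIntegrable (by norm_num)
  have hz : ∀ n, ∀ x ∉ K, mollify hδ n φ x = 0 := fun n x hx => by
    refine mollify_eq_zero hδ n fun h => hx ?_
    exact Metric.thickening_subset_cthickening _ _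
      (Metric.thickening_subset_of_subset δ (subset_tsupport φ) h)
  have hts : ∀ n, tsupport (mollify hδ n φ) ⊆ K := fun n =>
    closure_minimal (fun x hx => by_contra fun h => hx (hz n x h)) Metric.isClosed_cthickening
  have hcs : ∀ n, HasCompactSupport (mollify hδ n φ) := fun n =>
    hK.of_isClosed_subset (isClosed_tsupport _) (hts n)
  have hz' : ∀ n, ∀ x ∉ K, fderiv ℝ (mollify hδ n φ) x y = 0 := fun n x hx => by
    rw [fderiv_of_notMem_tsupport ℝ (fun hh => hx (hts n hh))]; rfl
  have e : ∀ n, ∫ x in U, v x * fderiv ℝ (mollify hδ n φ) x y =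
      - ∫ x in U, inner ℝ (g x) y * mollify hδ n φ x := fun n =>
    h.weak _ (contDiff_mollify hδ n hint) (hcs n) ((hts n).trans hδU) y
  have hind : ∀ c : ℝ, MemLp (K.indicator fun _ => c) 2 (volume.restrict U) := fun c =>
    (memLp_indicator_const 2 hK.measurableSet c (Or.inr hK.measure_lt_top.ne)).restrict U
  have t1 : Filter.Tendsto (fun n => ∫ x in U, v x * fderiv ℝ (mollify hδ n φ) x y) Filter.atTop
      (nhds (∫ x in U, v x * fderiv ℝ φ x y)) := by
    refine tendsto_integral_of_dominated_convergence
      (fun x => ‖v x‖ * K.indicator (fun _ => 3 * (L * ‖y‖)) x) (fun n => ?_) ?_ (fun n => ?_) ?_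
    · exact h.memLp.1.mul (measurable_fderiv_apply_const ℝ _ y).aestronglyMeasurable
    · exact h.memLp.norm.integrable_mul (hind _)
    · refine Filter.Eventually.of_forall fun x => ?_
      rw [norm_mul]
      refine mul_le_mul_of_nonneg_left ?_ (norm_nonneg _)
      by_cases hx : x ∈ K
      · rw [indicator_of_mem hx, fderiv_mollify hδ n hφ, Real.norm_eq_abs]
        exact abs_mollify_le hδ n hmeas hL x
      · rw [indicator_of_notMem hx, hz' n x hx, norm_zero]
    · filter_upwards [ae_restrict_of_ae (ae_tendsto_mollify hδ hint')] with x hx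
      simp_rw [fderiv_mollify hδ _ hφ]
      exact hx.const_mul _
  have t2 : Filter.Tendsto (fun n => - ∫ x in U, inner ℝ (g x) y * mollify hδ n φ x) Filter.atTop
      (nhds (- ∫ x in U, inner ℝ (g x) y * φ x)) := by
    refine (tendsto_integral_of_dominated_convergence
      (fun x => ‖inner ℝ (g x) y‖ * K.indicator (fun _ => 3 * M) x) (fun n => ?_) ?_
      (fun n => ?_) ?_).neg
    · exact (h.memLp_grad.inner_const y).1.mul
        (contDiff_mollify hδ n hint).continuous.aestronglyMeasurable
    · exact (h.memLp_grad.inner_const (𝕜 := ℝ) y).norm.integrable_mul (hind _)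
    · refine Filter.Eventually.of_forall fun x => ?_
      rw [norm_mul]
      refine mul_le_mul_of_nonneg_left ?_ (norm_nonneg _)
      by_cases hx : x ∈ K
      · rw [indicator_of_mem hx, Real.norm_eq_abs]
        exact abs_mollify_le hδ n hφ.continuous.aestronglyMeasurable hM x
      · rw [indicator_of_notMem hx, hz n x hx, norm_zero]
    · filter_upwards [ae_restrict_of_ae (ae_tendsto_mollify hδ hint)] with x hx
      exact hx.const_mul _
  exact tendsto_nhds_unique (t1.congr e) t2 |>.symm ▸ rfl

lemma memLp_test {U : Set (E d)} {η : E d → ℝ} (h : ContDiff ℝ ∞ η) (hc : HasCompactSupport η) :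
    MemLp η 2 (volume.restrict U) := by
  obtain ⟨L, hL⟩ := exists_lipschitz_of_contDiff h hc
  exact memLp_of_lipschitz hL hc

lemma memLp_test_fderiv {U : Set (E d)} {η : E d → ℝ} (h : ContDiff ℝ ∞ η)
    (hc : HasCompactSupport η) (y : E d) :
    MemLp (fun x => fderiv ℝ η x y) 2 (volume.restrict U) := by
  obtain ⟨L, hL⟩ := exists_lipschitz_of_contDiff h hc
  exact memLp_fderiv_apply hL hc y

lemma integrable_mul_of_memLp {μ : Measure (E d)} {f g : E d → ℝ} (hf : MemLp f 2 μ)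
    (hg : MemLp g 2 μ) : Integrable (fun x => f x * g x) μ :=
  hf.integrable_mul hg

lemma IsGrad.zero (U : Set (E d)) : IsGrad U 0 0 :=
  ⟨MemLp.zero, MemLp.zero, fun η _ _ _ y => by simp⟩

lemma IsGrad.add {U : Set (E d)} {v w : E d → ℝ} {g h : E d → E d} (hv : IsGrad U v g)
    (hw : IsGrad U w h) : IsGrad U (v + w) (g + h) := by
  refine ⟨hv.memLp.add hw.memLp, hv.memLp_grad.add hw.memLp_grad, fun η h1 h2 h3 y => ?_⟩
  have e1 := hv.weak η h1 h2 h3 y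
  have e2 := hw.weak η h1 h2 h3 y
  simp only [Pi.add_apply, add_mul, inner_add_left]
  rw [integral_add (integrable_mul_of_memLp hv.memLp (memLp_test_fderiv h1 h2 y))
    (integrable_mul_of_memLp hw.memLp (memLp_test_fderiv h1 h2 y)),
    integral_add (integrable_inner_mul hv.memLp_grad (memLp_test h1 h2) y)
    (integrable_inner_mul hw.memLp_grad (memLp_test h1 h2) y), e1, e2]
  ring

lemma IsGrad.smul {U : Set (E d)} {v : E d → ℝ} {g : E d → E d} (c : ℝ) (hv : IsGrad U v g) :
    IsGrad U (c • v) (c • g) := by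
  refine ⟨hv.memLp.const_smul c, hv.memLp_grad.const_smul c, fun η h1 h2 h3 y => ?_⟩
  have e1 := hv.weak η h1 h2 h3 y
  simp only [Pi.smul_apply, smul_eq_mul, mul_assoc, inner_smul_left, integral_const_mul]
  rw [e1]
  simp

lemma setIntegral_eq_of_zero_off {F : Type*} [NormedAddCommGroup F] [NormedSpace ℝ F]
    {U U' : Set (E d)} (hU : MeasurableSet U) (h : U ⊆ U')
    {f : E d → F} (hf : ∀ x ∉ U, f x = 0) : ∫ x in U', f x = ∫ x in U, f x := by
  have h1 : f = U.indicator f := by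
    ext x
    by_cases hx : x ∈ U <;> simp [hx, hf]
  conv_lhs => rw [h1]
  rw [integral_indicator hU, Measure.restrict_restrict hU, inter_eq_self_of_subset_left h]

lemma IsGrad.mono {U U' : Set (E d)} (hU : MeasurableSet U) (h : U ⊆ U') {v : E d → ℝ}
    {g : E d → E d} (hv : IsGrad U' v g) : IsGrad U v g := by
  refine ⟨hv.memLp.mono_measure (Measure.restrict_mono h le_rfl),
    hv.memLp_grad.mono_measure (Measure.restrict_mono h le_rfl), fun η h1 h2 h3 y => ?_⟩
  have e1 := hv.weak η h1 h2 (h3.trans h) y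
  rwa [setIntegral_eq_of_zero_off hU h (fun x hx => by
      rw [fderiv_of_notMem_tsupport ℝ (fun hh => hx (h3 hh))]; simp),
    setIntegral_eq_of_zero_off hU h (fun x hx => by
      rw [image_eq_zero_of_notMem_tsupport (fun hh => hx (h3 hh))]; simp)] at e1

lemma IsGrad.congr {U : Set (E d)} {v w : E d → ℝ} {g h : E d → E d} (hv : IsGrad U v g)
    (h1 : v =ᵐ[volume.restrict U] w) (h2 : g =ᵐ[volume.restrict U] h) : IsGrad U w h := by
  refine ⟨hv.memLp.ae_eq h1, hv.memLp_grad.ae_eq h2, fun η a b c y => ?_⟩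
  have e1 := hv.weak η a b c y
  have e2 : ∫ x in U, v x * fderiv ℝ η x y = ∫ x in U, w x * fderiv ℝ η x y := by
    refine integral_congr_ae ?_
    filter_upwards [h1] with x hx
    rw [hx]
  refine (e2.symm.trans e1).trans (congrArg Neg.neg (integral_congr_ae ?_))
  filter_upwards [h2] with x hx
  rw [hx]

/-- The fundamental lemma of the calculus of variations for the difference of the two fields, tested
direction by direction. -/
lemma IsGrad.unique {U : Set (E d)} (hU : IsOpen U) {v : E d → ℝ} {g h : E d → E d}
    (hg : IsGrad U v g) (hh : IsGrad U v h) : g =ᵐ[volume.restrict U] h := by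
  have hk : MemLp (g - h) 2 (volume.restrict U) := hg.memLp_grad.sub hh.memLp_grad
  have hloc : LocallyIntegrableOn (g - h) U volume :=
    locallyIntegrableOn_of_locallyIntegrable_restrict (hk.locallyIntegrable (by norm_num))
  have key := hU.ae_eq_zero_of_integral_contDiff_smul_eq_zero hloc (fun η h1 h2 h3 => by
    have hη : MemLp η 2 (volume.restrict U) := memLp_test h1 h2
    have hi : Integrable (fun x => η x • (g - h) x) (volume.restrict U) := by
      have : MemLp (η • (g - h)) 1 (volume.restrict U) := hk.smul hη
      exact memLp_one_iff_integrable.1 this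
    have e0 : ∫ x, η x • (g - h) x = ∫ x in U, η x • (g - h) x := by
      rw [← setIntegral_univ]
      exact setIntegral_eq_of_zero_off hU.measurableSet (subset_univ _) fun x hx => by
        rw [image_eq_zero_of_notMem_tsupport (fun hh => hx (h3 hh)), zero_smul]
    rw [e0]
    refine ext_inner_right ℝ fun y => ?_
    rw [inner_zero_left, real_inner_comm, ← integral_inner hi]
    have e1 := hg.weak η h1 h2 h3 y
    have e2 := hh.weak η h1 h2 h3 y
    have e3 : ∀ x, inner ℝ y (η x • (g - h) x) = inner ℝ (g x) y * η x - inner ℝ (h x) y * η x := by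
      intro x
      rw [real_inner_comm, inner_smul_left, Pi.sub_apply, inner_sub_left]
      simp; ring
    simp_rw [e3]
    rw [integral_sub (integrable_inner_mul hg.memLp_grad hη y)
      (integrable_inner_mul hh.memLp_grad hη y)]
    linarith)
  rw [Filter.EventuallyEq, ae_restrict_iff' hU.measurableSet]
  filter_upwards [key] with x hx hxU
  exact sub_eq_zero.1 (hx hxU)

/-- `H¹(U)` as a vector space. -/
def H1 (U : Set (E d)) : Submodule ℝ (E d → ℝ) where
  carrier := {v | MemH1 U v}
  zero_mem' := (IsGrad.zero U).memH1
  add_mem' := fun ha hb => (ha.isGrad.add hb.isGrad).memH1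
  smul_mem' := fun c _ ha => (ha.isGrad.smul c).memH1

/-- The gradient as a linear map from `H¹(U)` into `L²(U)`. -/
def gradL (U : Set (E d)) (hU : IsOpen U) : H1 U →ₗ[ℝ] Lp (E d) 2 (volume.restrict U) where
  toFun v := (MemH1.isGrad v.2).memLp_grad.toLp
  map_add' v w := by
    rw [← MemLp.toLp_add, MemLp.toLp_eq_toLp_iff]
    exact IsGrad.unique hU (MemH1.isGrad (v + w).2) ((MemH1.isGrad v.2).add (MemH1.isGrad w.2))
  map_smul' c v := by
    rw [← MemLp.toLp_const_smul, MemLp.toLp_eq_toLp_iff]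
    exact IsGrad.unique hU (MemH1.isGrad (c • v).2) ((MemH1.isGrad v.2).smul c)

lemma inner_toLp {F : Type*} [NormedAddCommGroup F] [InnerProductSpace ℝ F] {μ : Measure (E d)}
    {f g : E d → F} (hf : MemLp f 2 μ) (hg : MemLp g 2 μ) :
    inner ℝ (hf.toLp f) (hg.toLp g) = ∫ x, inner ℝ (f x) (g x) ∂μ := by
  rw [L2.inner_def]
  refine integral_congr_ae ?_
  filter_upwards [hf.coeFn_toLp, hg.coeFn_toLp] with x h1 h2
  rw [h1, h2]

lemma inner_gradL {U : Set (E d)} (hU : IsOpen U) (v w : H1 U) :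
    inner ℝ (gradL U hU v) (gradL U hU w) = aForm U v w :=
  inner_toLp (MemH1.isGrad v.2).memLp_grad (MemH1.isGrad w.2).memLp_grad

lemma gradL_eq_zero {U : Set (E d)} (hU : IsOpen U) (v : H1 U)
    (h : (v : E d → ℝ) =ᵐ[volume.restrict U] 0) : gradL U hU v = 0 := by
  have h1 := IsGrad.unique hU (MemH1.isGrad v.2) ((IsGrad.zero U).congr h.symm (ae_eq_refl _))
  have h2 := (MemLp.toLp_eq_toLp_iff (MemH1.isGrad v.2).memLp_grad MemLp.zero).2 h1
  exact h2.trans (MemLp.toLp_zero _)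

lemma norm_gradL_sq {U : Set (E d)} (hU : IsOpen U) {v : E d → ℝ} {g : E d → E d}
    (h : IsGrad U v g) : ‖gradL U hU ⟨v, h.memH1⟩‖ ^ 2 = ∫ x in U, ‖g x‖ ^ 2 := by
  rw [← real_inner_self_eq_norm_sq, inner_gradL]
  refine integral_congr_ae ?_
  filter_upwards [IsGrad.unique hU h.memH1.isGrad h] with x hx
  rw [hx, real_inner_self_eq_norm_sq]

lemma gradL_eq_toLp {U : Set (E d)} (hU : IsOpen U) {v : E d → ℝ} {g : E d → E d}
    (h : IsGrad U v g) : gradL U hU ⟨v, h.memH1⟩ = h.memLp_grad.toLp :=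
  (MemLp.toLp_eq_toLp_iff h.memH1.isGrad.memLp_grad h.memLp_grad).2 (IsGrad.unique hU h.memH1.isGrad h)

/-! ### Multiplication by Lipschitz functions -/

lemma inner_gradient_left (B : E d → ℝ) (x y : E d) :
    inner ℝ (gradient B x) y = fderiv ℝ B x y := by
  simp [gradient]

lemma norm_gradient (B : E d → ℝ) (x : E d) : ‖gradient B x‖ = ‖fderiv ℝ B x‖ := by
  simp [gradient]

lemma measurable_gradient (B : E d → ℝ) : Measurable (gradient B) := by
  have h : gradient B = fun x => (InnerProductSpace.toDual ℝ (E d)).symm (fderiv ℝ B x) := rfl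
  rw [h]
  exact (InnerProductSpace.toDual ℝ (E d)).symm.continuous.measurable.comp (measurable_fderiv ℝ B)

lemma LipschitzWith.mul_bounded {f g : E d → ℝ} {Lf Lg : NNReal} {Mf Mg : NNReal}
    (hf : LipschitzWith Lf f) (hg : LipschitzWith Lg g) (bf : ∀ x, |f x| ≤ Mf)
    (bg : ∀ x, |g x| ≤ Mg) : LipschitzWith (Lf * Mg + Mf * Lg) (fun x => f x * g x) := by
  refine LipschitzWith.of_dist_le_mul fun x y => ?_
  have h1 := hf.dist_le_mul x y
  have h2 := hg.dist_le_mul x y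
  rw [Real.dist_eq] at h1 h2 ⊢
  have e : f x * g x - f y * g y = (f x - f y) * g x + f y * (g x - g y) := by ring
  rw [e]
  refine (abs_add_le _ _).trans ?_
  rw [abs_mul, abs_mul]
  have h3 := mul_le_mul h1 (bg x) (abs_nonneg _) (by positivity)
  have h4 := mul_le_mul (bf y) h2 (abs_nonneg _) (by positivity)
  push_cast
  nlinarith

/-- Integration by parts against the product of a test function and a nonnegative Lipschitz
function that vanishes off an open set. -/
lemma IsGrad.integral_mul_lipschitz {U O : Set (E d)} (hU : IsOpen U) (hO : IsOpen O)
    {B : E d → ℝ} {L : NNReal} (hB : LipschitzWith L B) (h0 : ∀ x, 0 ≤ B x) (h1 : ∀ x, B x ≤ 1)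
    (hBO : ∀ x ∉ O, B x = 0) {v : E d → ℝ} {g : E d → E d} (h : IsGrad (O ∩ U) v g)
    {η : E d → ℝ} (hη : ContDiff ℝ ∞ η) (hc : HasCompactSupport η) (hs : tsupport η ⊆ U) (y : E d) :
    ∫ x in O ∩ U, v x * (B x * fderiv ℝ η x y + η x * fderiv ℝ B x y) =
      - ∫ x in O ∩ U, inner ℝ (g x) y * (B x * η x) := by
  obtain ⟨Lη, hLη⟩ := exists_lipschitz_of_contDiff hη hc
  obtain ⟨M', hM'⟩ := hc.exists_bound_of_continuous hη.continuous
  obtain ⟨M, hM⟩ : ∃ M : NNReal, ∀ x, |η x| ≤ M :=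
    ⟨M'.toNNReal, fun x => (hM' x).trans (Real.le_coe_toNNReal M')⟩
  let δ : ℕ → ℝ := fun n => 1 / ((n : ℝ) + 1)
  have hδ : ∀ n, 0 < δ n := fun n => by positivity
  have hδt : Filter.Tendsto δ Filter.atTop (nhds 0) := tendsto_one_div_add_atTop_nhds_zero_nat
  -- The support of B η may touch the boundary of O. The truncation (B − δ)₊ is supported in the
  -- closed set where B ≥ δ, which lies inside O, and δ → 0 afterwards.
  let C : ℕ → E d → ℝ := fun n x => max (B x - δ n) 0
  have hCL : ∀ n, LipschitzWith L (C n) := fun n => by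
    have : LipschitzWith L fun x => B x - δ n := by
      refine LipschitzWith.of_dist_le_mul fun x y => ?_
      rw [dist_sub_right]
      exact hB.dist_le_mul x y
    exact this.max_const 0
  have hC0 : ∀ n x, 0 ≤ C n x := fun n x => le_max_right _ _
  have hC1 : ∀ n x, |C n x| ≤ (1 : NNReal) := fun n x => by
    rw [abs_of_nonneg (hC0 n x)]
    exact max_le (by have := h1 x; have := hδ n; push_cast; linarith) (by simp)
  have hCm := fun n => LipschitzWith.mul_bounded (hCL n) hLη (hC1 n) hM
  have hts : ∀ n, tsupport (fun x => C n x * η x) ⊆ {x | δ n ≤ B x} ∩ tsupport η := fun n => by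
    refine closure_minimal (fun x hx => ⟨?_, ?_⟩)
      ((isClosed_le continuous_const hB.continuous).inter (isClosed_tsupport _))
    · have h2 : C n x ≠ 0 := left_ne_zero_of_mul hx
      by_contra h3
      exact h2 (max_eq_right (by simp only [mem_ofPred_eq, not_le] at h3; linarith))
    · exact subset_tsupport _ (right_ne_zero_of_mul hx)
  have hcs : ∀ n, HasCompactSupport fun x => C n x * η x := fun n => hc.mul_left
  have e : ∀ n, ∫ x in O ∩ U, v x * fderiv ℝ (fun x => C n x * η x) x y =
      - ∫ x in O ∩ U, inner ℝ (g x) y * (C n x * η x) := fun n =>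
    h.integral_lipschitz (hO.inter hU) (hCm n) (hcs n) (fun x hx => by
      have := hts n hx
      refine ⟨?_, hs this.2⟩
      by_contra h3
      have h4 : δ n ≤ B x := this.1
      rw [hBO x h3] at h4
      exact absurd (hδ n) (not_lt.2 h4)) y
  have hCt : ∀ x, Filter.Tendsto (fun n => C n x) Filter.atTop (nhds (B x)) := fun x => by
    have : Filter.Tendsto (fun n => max (B x - δ n) 0) Filter.atTop (nhds (max (B x - 0) 0)) :=
      (tendsto_const_nhds.sub hδt).max tendsto_const_nhds
    rwa [sub_zero, max_eq_left (h0 x)] at this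
  have hdη : MemLp (fun x => fderiv ℝ η x y) 2 (volume.restrict (O ∩ U)) := memLp_test_fderiv hη hc y
  have hηL : MemLp η 2 (volume.restrict (O ∩ U)) := memLp_test hη hc
  -- the derivative of the truncated product
  have hder : ∀ n, ∀ᵐ x : E d, fderiv ℝ (fun x => C n x * η x) x y =
      C n x * fderiv ℝ η x y + η x * fderiv ℝ (C n) x y := fun n => by
    filter_upwards [(hCL n).ae_differentiableAt] with x hx
    rw [fderiv_fun_mul hx (hη.differentiable (by simp) x)]
    simp
  have hderlim : ∀ x, DifferentiableAt ℝ B x → Filter.Tendsto (fun n => fderiv ℝ (C n) x y)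
      Filter.atTop (nhds (fderiv ℝ B x y)) := fun x hx => by
    -- At a zero of B both B and its truncations have a minimum, so all derivatives vanish. Where B
    -- > 0, the truncation eventually differs from B by a constant near x.
    rcases (h0 x).eq_or_lt with hx0 | hx0
    · have hb : fderiv ℝ B x = 0 := IsLocalMin.fderiv_eq_zero
        (Filter.Eventually.of_forall fun z => by rw [← hx0]; exact h0 z)
      have hcn : ∀ n, fderiv ℝ (C n) x = 0 := fun n => IsLocalMin.fderiv_eq_zero
        (Filter.Eventually.of_forall fun z => by
          have : C n x = 0 := max_eq_right (by rw [← hx0]; have := hδ n; linarith)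
          rw [this]; exact hC0 n z)
      simp [hb, hcn]
    · refine tendsto_const_nhds.congr' ?_
      filter_upwards [hδt.eventually (gt_mem_nhds hx0)] with n hn
      have h2 : C n =ᶠ[nhds x] fun z => B z - δ n := by
        filter_upwards [hB.continuous.continuousAt.eventually (lt_mem_nhds hn)] with z hz
        exact max_eq_left (by linarith)
      rw [h2.fderiv_eq, fderiv_sub_const]
  have t1 : Filter.Tendsto (fun n => ∫ x in O ∩ U, v x * fderiv ℝ (fun x => C n x * η x) x y)
      Filter.atTop (nhds (∫ x in O ∩ U, v x * (B x * fderiv ℝ η x y + η x * fderiv ℝ B x y))) := by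
    refine tendsto_integral_of_dominated_convergence
      (fun x => ‖v x‖ * (‖fderiv ℝ η x y‖ + ‖η x‖ * (L * ‖y‖))) (fun n => ?_) ?_ (fun n => ?_) ?_
    · exact h.memLp.1.mul (measurable_fderiv_apply_const ℝ _ y).aestronglyMeasurable
    · exact h.memLp.norm.integrable_mul (hdη.norm.add (hηL.norm.mul_const (L * ‖y‖)))
    · filter_upwards [ae_restrict_of_ae (hder n)] with x hx
      rw [hx, norm_mul]
      refine mul_le_mul_of_nonneg_left ((norm_add_le _ _).trans (add_le_add ?_ ?_)) (norm_nonneg _)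
      · rw [norm_mul]
        exact mul_le_of_le_one_left (norm_nonneg _) (by simpa using hC1 n x)
      · rw [norm_mul]
        refine mul_le_mul_of_nonneg_left ?_ (norm_nonneg _)
        exact (ContinuousLinearMap.le_opNorm _ _).trans
          (mul_le_mul_of_nonneg_right (norm_fderiv_le_of_lipschitz ℝ (hCL n)) (norm_nonneg _))
    · filter_upwards [ae_restrict_of_ae (ae_all_iff.2 hder),
        ae_restrict_of_ae hB.ae_differentiableAt] with x hx hd
      simp_rw [hx]
      exact (((hCt x).mul_const _).add ((hderlim x hd).const_mul _)).const_mul _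
  have t2 : Filter.Tendsto (fun n => - ∫ x in O ∩ U, inner ℝ (g x) y * (C n x * η x)) Filter.atTop
      (nhds (- ∫ x in O ∩ U, inner ℝ (g x) y * (B x * η x))) := by
    refine (tendsto_integral_of_dominated_convergence
      (fun x => ‖inner ℝ (g x) y‖ * ‖η x‖) (fun n => ?_) ?_ (fun n => ?_) ?_).neg
    · exact (h.memLp_grad.inner_const y).1.mul (hCm n).continuous.aestronglyMeasurable
    · exact (h.memLp_grad.inner_const (𝕜 := ℝ) y).norm.integrable_mul hηL.norm
    · refine Filter.Eventually.of_forall fun x => ?_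
      rw [norm_mul, norm_mul]
      refine mul_le_mul_of_nonneg_left ?_ (norm_nonneg _)
      exact mul_le_of_le_one_left (norm_nonneg _) (by simpa using hC1 n x)
    · exact Filter.Eventually.of_forall fun x => ((hCt x).mul_const _).const_mul _
  exact tendsto_nhds_unique t1 (t2.congr fun n => (e n).symm)

lemma integrable_lipschitz_product {U : Set (E d)} {B η : E d → ℝ} {v : E d → ℝ}
    (hv : MemLp v 2 (volume.restrict U)) (hB : Continuous B) (hB1 : ∀ x, |B x| ≤ 1)
    (hη : MemLp η 2 (volume.restrict U)) :
    Integrable (fun x => v x * (B x * η x)) (volume.restrict U) := by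
  refine integrable_mul_of_memLp hv (hη.mono (hB.aestronglyMeasurable.mul hη.1)
    (Filter.Eventually.of_forall fun x => ?_))
  rw [norm_mul]
  exact mul_le_of_le_one_left (norm_nonneg _) (hB1 x)

/-- The product of an `H¹` function on `O ∩ U` with a nonnegative Lipschitz function that vanishes
off `O` belongs, extended by zero, to `H¹(U)`. -/
lemma IsGrad.mul_lipschitz {U O : Set (E d)} (hU : IsOpen U) (hO : IsOpen O)
    {B : E d → ℝ} {L : NNReal} (hB : LipschitzWith L B) (h0 : ∀ x, 0 ≤ B x) (h1 : ∀ x, B x ≤ 1)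
    (hBO : ∀ x ∉ O, B x = 0) {v : E d → ℝ} {g : E d → E d} (h : IsGrad (O ∩ U) v g) :
    IsGrad U (fun x => B x * v x) (O.indicator fun x => B x • g x + v x • gradient B x) := by
  have hB1 : ∀ x, |B x| ≤ 1 := fun x => by rw [abs_of_nonneg (h0 x)]; exact h1 x
  have hBc := hB.continuous
  have hind : (fun x => B x * v x) = O.indicator fun x => B x * v x := by
    ext x
    by_cases hx : x ∈ O <;> simp [hx, hBO]
  have hr : (volume.restrict U).restrict O = volume.restrict (O ∩ U) :=
    Measure.restrict_restrict hO.measurableSet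
  refine ⟨?_, ?_, fun η a b c y => ?_⟩
  · rw [hind, memLp_indicator_iff_restrict hO.measurableSet, hr]
    refine h.memLp.mono (hBc.aestronglyMeasurable.mul h.memLp.1)
      (Filter.Eventually.of_forall fun x => ?_)
    rw [norm_mul]
    exact mul_le_of_le_one_left (norm_nonneg _) (hB1 x)
  · rw [memLp_indicator_iff_restrict hO.measurableSet, hr]
    refine MemLp.add (h.memLp_grad.mono (hBc.aestronglyMeasurable.smul h.memLp_grad.1)
      (Filter.Eventually.of_forall fun x => ?_)) (h.memLp.of_le_mul (c := L)
      (h.memLp.1.smul (measurable_gradient B).aestronglyMeasurable)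
      (Filter.Eventually.of_forall fun x => ?_))
    · rw [norm_smul]
      exact mul_le_of_le_one_left (norm_nonneg _) (hB1 x)
    · rw [norm_smul, norm_gradient, mul_comm]
      exact mul_le_mul_of_nonneg_right (norm_fderiv_le_of_lipschitz ℝ hB) (norm_nonneg _)
  · have key := h.integral_mul_lipschitz hU hO hB h0 h1 hBO a b c y
    have hη : MemLp η 2 (volume.restrict (O ∩ U)) := memLp_test a b
    have hdη : MemLp (fun x => fderiv ℝ η x y) 2 (volume.restrict (O ∩ U)) := memLp_test_fderiv a b y
    have hηB : MemLp (fun x => η x * fderiv ℝ B x y) 2 (volume.restrict (O ∩ U)) :=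
      hη.of_le_mul (c := L * ‖y‖)
        (hη.1.mul (measurable_fderiv_apply_const ℝ B y).aestronglyMeasurable)
        (Filter.Eventually.of_forall fun x => by
          rw [norm_mul, mul_comm]
          exact mul_le_mul_of_nonneg_right ((ContinuousLinearMap.le_opNorm _ _).trans
            (mul_le_mul_of_nonneg_right (norm_fderiv_le_of_lipschitz ℝ hB) (norm_nonneg _)))
            (norm_nonneg _))
    have i1 := integrable_lipschitz_product h.memLp hBc hB1 hdη
    have i2 := integrable_mul_of_memLp h.memLp hηB
    have i3 := integrable_lipschitz_product (h.memLp_grad.inner_const (𝕜 := ℝ) y) hBc hB1 hη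
    simp_rw [mul_add] at key
    rw [integral_add i1 i2] at key
    have e1 : ∫ x in U, B x * v x * fderiv ℝ η x y =
        ∫ x in O ∩ U, v x * (B x * fderiv ℝ η x y) := by
      rw [← hr, ← integral_indicator hO.measurableSet]
      congr 1; ext x
      by_cases hx : x ∈ O
      · simp [hx]; ring
      · simp [hx, hBO]
    have e2 : ∫ x in U, inner ℝ (O.indicator (fun x => B x • g x + v x • gradient B x) x) y * η x =
        ∫ x in O ∩ U, (inner ℝ (g x) y * (B x * η x) + v x * (η x * fderiv ℝ B x y)) := by
      rw [← hr, ← integral_indicator hO.measurableSet]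
      congr 1; ext x
      by_cases hx : x ∈ O
      · simp only [hx, indicator_of_mem, inner_add_left, inner_smul_left, inner_gradient_left]
        simp; ring
      · simp [hx]
    rw [e1, e2, integral_add i3 i2]
    linarith

/-! ### Functions with vanishing weak gradient -/

/-- The derivative of a mollification of v is an integral of v against the derivative of a
translated kernel. That kernel is a test function in the doubled ball, so the derivative is zero on
the smaller ball; the constant mollifications converge almost everywhere to v. -/
lemma IsGrad.ae_const_ball {U : Set (E d)} {v : E d → ℝ} (h : IsGrad U v 0) {x₀ : E d}
    {r : ℝ} (hr : 0 < r) (hball : Metric.ball x₀ (2 * r) ⊆ U) :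
    ∃ c, v =ᵐ[volume.restrict (Metric.ball x₀ r)] fun _ => c := by
  set w := (Metric.ball x₀ (2 * r)).indicator v with hw
  have hb : IsGrad (Metric.ball x₀ (2 * r)) v 0 := h.mono measurableSet_ball hball
  have hfin : IsFiniteMeasure (volume.restrict (Metric.ball x₀ (2 * r))) :=
    ⟨by rw [Measure.restrict_apply_univ]; exact Metric.isBounded_ball.measure_lt_top⟩
  have hwi : Integrable w := by
    rw [hw, integrable_indicator_iff measurableSet_ball]
    exact hb.memLp.integrable (by norm_num)
  have hder : ∀ n, ∀ x ∈ Metric.ball x₀ r, HasFDerivAt (mollify hr n w) 0 x := fun n x hx => by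
    set b := (mollifier d r hr n).normed (volume : Measure (E d)) with hbdef
    have hbs : HasCompactSupport b := (mollifier d r hr n).hasCompactSupport_normed
    have hbd : ContDiff ℝ ∞ b := (mollifier d r hr n).contDiff_normed
    have h1 := hbs.hasFDerivAt_convolution_left (ContinuousLinearMap.lsmul ℝ ℝ)
      (hbd.of_le (by exact_mod_cast le_top)) hwi.locallyIntegrable x
    refine h1.congr_fderiv ?_
    have hconv : ConvolutionExistsAt (fderiv ℝ b) w x
        (ContinuousLinearMap.precompL (E d) (ContinuousLinearMap.lsmul ℝ ℝ)) volume :=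
      (HasCompactSupport.convolutionExists_left _ (hbs.fderiv ℝ)
        (hbd.continuous_fderiv (by simp)) hwi.locallyIntegrable) x
    ext y
    have hη : ContDiff ℝ ∞ fun t => b (x - t) := hbd.comp (contDiff_const.sub contDiff_id)
    have hsupp : Function.support (fun t => b (x - t)) ⊆
        Metric.closedBall x (mollifier d r hr n).rOut := fun t ht => by
      have h2 : x - t ∈ Function.support b := ht
      rw [hbdef, ContDiffBump.support_normed_eq, mem_ball_zero_iff] at h2
      rw [Metric.mem_closedBall, dist_comm, dist_eq_norm]
      exact h2.le
    have hts : tsupport (fun t => b (x - t)) ⊆ Metric.closedBall x (mollifier d r hr n).rOut :=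
      closure_minimal hsupp Metric.isClosed_closedBall
    have hsub : tsupport (fun t => b (x - t)) ⊆ Metric.ball x₀ (2 * r) := fun t ht => by
      have h2 := Metric.mem_closedBall.1 (hts ht)
      have h3 := mollifier_rOut_lt (d := d) hr n
      have h4 := Metric.mem_ball.1 hx
      have h5 := dist_triangle t x x₀
      rw [Metric.mem_ball]; linarith
    have key := hb.weak _ hη
      ((isCompact_closedBall _ _).of_isClosed_subset (isClosed_tsupport _) hts) hsub y
    have hf : ∀ t, fderiv ℝ (fun t => b (x - t)) t y = - fderiv ℝ b (x - t) y := fun t => by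
      have h2 : HasFDerivAt (fun t => b (x - t)) (-(fderiv ℝ b (x - t))) t := by
        have h3 := ((hbd.differentiable (by simp)) (x - t)).hasFDerivAt.comp t
          ((hasFDerivAt_id t).const_sub x)
        exact h3.congr_fderiv (by ext z; simp)
      rw [h2.fderiv]; rfl
    simp_rw [hf] at key
    rw [convolution_def, ContinuousLinearMap.integral_apply hconv]
    have e1 : ∀ t, ((ContinuousLinearMap.precompL (E d) (ContinuousLinearMap.lsmul ℝ ℝ))
        (fderiv ℝ b t) (w (x - t))) y = fderiv ℝ b t y * w (x - t) := fun t => by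
      simp [ContinuousLinearMap.precompL_apply]
    simp_rw [e1]
    rw [← integral_sub_left_eq_self (fun t => fderiv ℝ b t y * w (x - t)) volume x]
    simp only [sub_sub_cancel]
    have e2 : ∀ t, fderiv ℝ b (x - t) y * w t = (Metric.ball x₀ (2 * r)).indicator
        (fun t => fderiv ℝ b (x - t) y * v t) t := fun t => by
      by_cases ht : t ∈ Metric.ball x₀ (2 * r)
      · rw [hw, indicator_of_mem ht, indicator_of_mem ht]
      · rw [hw, indicator_of_notMem ht, indicator_of_notMem ht, mul_zero]
    simp_rw [e2]
    rw [integral_indicator measurableSet_ball]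
    simp only [mul_neg, Pi.zero_apply, inner_zero_left, zero_mul, integral_zero, neg_zero,
      integral_neg, neg_eq_zero] at key
    simpa [mul_comm] using key
  have hconst : ∀ n, ∀ x ∈ Metric.ball x₀ r, mollify hr n w x = mollify hr n w x₀ := fun n x hx =>
    Metric.isOpen_ball.is_const_of_fderiv_eq_zero (𝕜 := ℝ) (convex_ball x₀ r).isPreconnected
      (fun z hz => (hder n z hz).differentiableAt.differentiableWithinAt)
      (fun z hz => (hder n z hz).fderiv) hx (Metric.mem_ball_self hr)
  have hlim := ae_tendsto_mollify hr hwi.locallyIntegrable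
  have hlim' : ∀ᵐ x ∂(volume.restrict (Metric.ball x₀ r)),
      Filter.Tendsto (fun n => mollify hr n w x₀) Filter.atTop (nhds (v x)) := by
    filter_upwards [ae_restrict_of_ae hlim, ae_restrict_mem measurableSet_ball] with x hx hxb
    have h2 : w x = v x := indicator_of_mem (Metric.ball_subset_ball (by linarith) hxb) v
    rw [h2] at hx
    exact hx.congr fun n => hconst n x hxb
  have hne : (volume.restrict (Metric.ball x₀ r)) ≠ 0 := by
    rw [Ne, Measure.restrict_eq_zero]
    exact (Metric.measure_ball_pos volume x₀ hr).ne'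
  have : (ae (volume.restrict (Metric.ball x₀ r))).NeBot := ae_neBot.2 hne
  obtain ⟨z, hz⟩ := hlim'.exists
  refine ⟨v z, ?_⟩
  filter_upwards [hlim'] with x hx
  exact tendsto_nhds_unique hx hz

/-- The local constants agree on overlaps, because nonempty open sets have positive measure, and
connectedness carries the constant through U. -/
lemma IsGrad.ae_const {U : Set (E d)} (hU : IsOpen U) (hc : IsPreconnected U) {v : E d → ℝ}
    (h : IsGrad U v 0) : ∃ c, v =ᵐ[volume.restrict U] fun _ => c := by
  rcases U.eq_empty_or_nonempty with rfl | ⟨x₀, hx₀⟩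
  · exact ⟨0, by simp [Filter.EventuallyEq]⟩
  have hcb : ∀ x ∈ U, ∃ r > 0, ∃ c, v =ᵐ[volume.restrict (Metric.ball x r)] fun _ => c := by
    intro x hx
    obtain ⟨ε, hε, hεU⟩ := Metric.isOpen_iff.1 hU x hx
    exact ⟨ε / 2, by positivity, h.ae_const_ball (by positivity)
      (by rwa [mul_div_cancel₀ _ (two_ne_zero)])⟩
  have hsub : ∀ {A B : Set (E d)} {c : ℝ}, A ⊆ B → v =ᵐ[volume.restrict B] (fun _ => c) →
      v =ᵐ[volume.restrict A] fun _ => c := fun hAB hB => ae_restrict_of_ae_restrict_of_subset hAB hB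
  have huniq : ∀ {A : Set (E d)} {c c' : ℝ}, IsOpen A → A.Nonempty →
      v =ᵐ[volume.restrict A] (fun _ => c) → v =ᵐ[volume.restrict A] (fun _ => c') → c = c' := by
    intro A c c' hA hne h1 h2
    have : (ae (volume.restrict A)).NeBot := by
      rw [ae_neBot, Ne, Measure.restrict_eq_zero]
      exact (hA.measure_pos volume hne).ne'
    obtain ⟨z, hz1, hz2⟩ := (h1.and h2).exists
    exact hz1.symm.trans hz2
  -- the relation "equal to the same constant near both points"
  let R : E d → E d → Prop := fun x y => ∃ c, ∃ r > 0,
    v =ᵐ[volume.restrict (Metric.ball x r)] (fun _ => c) ∧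
    v =ᵐ[volume.restrict (Metric.ball y r)] fun _ => c
  have hR : ∀ y ∈ U, R x₀ y := fun y hy => by
    refine hc.induction₂ R (fun x hx => ?_) ?_ ?_ hx₀ hy
    · obtain ⟨r, hr, c, hc⟩ := hcb x hx
      refine Filter.Eventually.filter_mono nhdsWithin_le_nhds ?_
      filter_upwards [Metric.ball_mem_nhds x (half_pos hr)] with z hz
      refine ⟨c, r / 2, half_pos hr, hsub (Metric.ball_subset_ball (by linarith)) hc,
        hsub (Metric.ball_subset_ball' ?_) hc⟩
      have := Metric.mem_ball.1 hz
      linarith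
    · rintro x y z - - - ⟨c, r, hr, h1, h2⟩ ⟨c', r', hr', h3, h4⟩
      have hcc : c = c' := huniq (A := Metric.ball y (min r r')) Metric.isOpen_ball
        ⟨y, Metric.mem_ball_self (lt_min hr hr')⟩
        (hsub (Metric.ball_subset_ball (min_le_left _ _)) h2)
        (hsub (Metric.ball_subset_ball (min_le_right _ _)) h3)
      subst hcc
      exact ⟨c, min r r', lt_min hr hr', hsub (Metric.ball_subset_ball (min_le_left _ _)) h1,
        hsub (Metric.ball_subset_ball (min_le_right _ _)) h4⟩
    · rintro x y - - ⟨c, r, hr, h1, h2⟩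
      exact ⟨c, r, hr, h2, h1⟩
  obtain ⟨r₀, hr₀, c, hc₀⟩ := hcb x₀ hx₀
  refine ⟨c, ?_⟩
  rw [Filter.EventuallyEq, ae_restrict_iff' hU.measurableSet, ae_iff]
  refine measure_null_of_locally_null _ fun y hy => ?_
  have hyU : y ∈ U := by
    by_contra h3
    exact hy fun h4 => absurd h4 h3
  obtain ⟨c', r, hr, h1, h2⟩ := hR y hyU
  have hcc : c = c' := huniq (A := Metric.ball x₀ (min r r₀)) Metric.isOpen_ball
    ⟨x₀, Metric.mem_ball_self (lt_min hr hr₀)⟩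
    (hsub (Metric.ball_subset_ball (min_le_right _ _)) hc₀)
    (hsub (Metric.ball_subset_ball (min_le_left _ _)) h1)
  subst hcc
  refine ⟨Metric.ball y r ∩ {x | ¬(x ∈ U → v x = c)}, ?_, ?_⟩
  · rw [inter_comm]
    exact inter_mem_nhdsWithin _ (Metric.ball_mem_nhds y hr)
  · rw [Filter.EventuallyEq, ae_restrict_iff' measurableSet_ball, ae_iff] at h2
    refine measure_mono_null (fun x hx => ?_) h2
    exact fun h3 => hx.2 fun _ => h3 hx.1

/-! ### Perforated domains, function spaces and the geometry of coarse meshes -/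

namespace PerforatedDomain
variable (P : PerforatedDomain d)

lemma isClosed_holes : IsClosed P.holes :=
  isClosed_iUnion_of_finite fun _ => Metric.isClosed_closedBall

lemma isOpen_compl_holes : IsOpen P.holesᶜ := P.isClosed_holes.isOpen_compl

lemma isOpen_fluid : IsOpen P.fluid := P.isOpen.sdiff P.isClosed_holes

lemma fluid_subset_compl_holes : P.fluid ⊆ P.holesᶜ := fun _ hx => hx.2

/-- The space `V₀(A)` as a vector space. -/
def V0Sub (A : Set (E d)) : Submodule ℝ (E d → ℝ) where
  carrier := P.V0 A
  zero_mem' := ⟨(H1 P.holesᶜ).zero_mem, Filter.Eventually.of_forall fun _ _ => rfl⟩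
  add_mem' := fun {v w} hv hw => ⟨(H1 P.holesᶜ).add_mem hv.1 hw.1, by
    filter_upwards [hv.2, hw.2] with x h1 h2 hx
    rw [Pi.add_apply, h1 hx, h2 hx, add_zero]⟩
  smul_mem' := fun c v hv => ⟨(H1 P.holesᶜ).smul_mem c hv.1, by
    filter_upwards [hv.2] with x h1 hx
    rw [Pi.smul_apply, h1 hx, smul_zero]⟩

/-- The space `V` as a vector space. -/
def VSub : Submodule ℝ (E d → ℝ) := P.V0Sub P.fluid

lemma V0Sub_le_H1 {A U : Set (E d)} (hU : IsOpen U) (h : U ⊆ P.holesᶜ) : P.V0Sub A ≤ H1 U :=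
  fun _ hv => (hv.1.isGrad.mono hU.measurableSet h).memH1

lemma VSub_le_H1 : P.VSub ≤ H1 P.fluid :=
  P.V0Sub_le_H1 P.isOpen_fluid P.fluid_subset_compl_holes

end PerforatedDomain

namespace CoarseMesh
variable {P : PerforatedDomain d} (T : CoarseMesh P)

lemma convex_cell (i : Fin T.numCells) : Convex ℝ (T.cell i) := convex_convexHull ℝ _

lemma isCompact_cell (i : Fin T.numCells) : IsCompact (T.cell i) :=
  ((T.verts i).finite_toSet.image _).isCompact_convexHull ℝ

lemma isClosed_cell (i : Fin T.numCells) : IsClosed (T.cell i) := (T.isCompact_cell i).isClosed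

lemma node_mem_cell {i : Fin T.numCells} {j : Fin T.numNodes} (h : j ∈ T.verts i) :
    T.node j ∈ T.cell i := subset_convexHull _ _ (mem_image_of_mem _ h)

lemma isOpen_elem (i : Fin T.numCells) : IsOpen (T.elem i) := isOpen_interior.sdiff P.isClosed_holes

lemma elem_subset_cell (i : Fin T.numCells) : T.elem i ⊆ T.cell i :=
  fun _ hx => interior_subset hx.1

/-- Cells are only assumed to lie in the closure of Ω; the absence of slits puts their interiors
into Ω. -/
lemma interior_cell_subset (i : Fin T.numCells) : interior (T.cell i) ⊆ P.Ω := by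
  rw [← P.regular]
  exact interior_mono (T.cell_subset i)

lemma elem_subset_fluid (i : Fin T.numCells) : T.elem i ⊆ P.fluid :=
  sdiff_subset_sdiff_left (T.interior_cell_subset i)

lemma elem_subset_compl_holes (i : Fin T.numCells) : T.elem i ⊆ P.holesᶜ := fun _ hx => hx.2

lemma disjoint_elem : Pairwise (Function.onFun Disjoint T.elem) := fun i j hij =>
  (T.disjoint_interior i j hij).mono sdiff_subset sdiff_subset

lemma volume_frontier_cell (i : Fin T.numCells) : volume (frontier (T.cell i)) = 0 :=
  (T.convex_cell i).addHaar_frontier volume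

lemma ae_notMem_frontier : ∀ᵐ x : E d, ∀ i, x ∉ frontier (T.cell i) :=
  ae_all_iff.2 fun i => measure_eq_zero_iff_ae_notMem.1 (T.volume_frontier_cell i)

/-- Boundaries of convex sets are null sets, so every integral over the domain splits into integrals
over the elements. -/
lemma fluid_ae_eq : (P.fluid : Set (E d)) =ᵐ[volume] ⋃ i, T.elem i := by
  filter_upwards [T.ae_notMem_frontier] with x hx
  refine propext ⟨fun h => ?_, fun h => ?_⟩
  · obtain ⟨i, hi⟩ := mem_iUnion.1 (T.cover h)
    refine mem_iUnion.2 ⟨i, ?_, h.2⟩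
    by_contra h2
    exact hx i ⟨subset_closure hi, h2⟩
  · obtain ⟨i, hi⟩ := mem_iUnion.1 h
    exact T.elem_subset_fluid i hi

lemma ae_fluid_iff {p : E d → Prop} : (∀ᵐ x ∂(volume.restrict P.fluid), p x) ↔
    ∀ i, ∀ᵐ x ∂(volume.restrict (T.elem i)), p x := by
  rw [Measure.restrict_congr_set T.fluid_ae_eq]
  exact ae_restrict_iUnion_iff _ _

lemma integral_fluid {F : E d → ℝ} (hF : Integrable F (volume.restrict P.fluid)) :
    ∫ x in P.fluid, F x = ∑ i, ∫ x in T.elem i, F x := by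
  rw [Measure.restrict_congr_set T.fluid_ae_eq]
  exact integral_iUnion_fintype (fun i => (T.isOpen_elem i).measurableSet) T.disjoint_elem
    fun i => hF.mono_measure (Measure.restrict_mono (T.elem_subset_fluid i) le_rfl)

lemma diam_le_meshSize (i : Fin T.numCells) : Metric.diam (T.cell i) ≤ T.meshSize :=
  le_ciSup (f := fun i => Metric.diam (T.cell i)) (Finite.bddAbove_range _) i

lemma dist_le_meshSize {i : Fin T.numCells} {x y : E d} (hx : x ∈ T.cell i) (hy : y ∈ T.cell i) :
    dist x y ≤ T.meshSize :=
  (Metric.dist_le_diam_of_mem (T.isCompact_cell i).isBounded hx hy).trans (T.diam_le_meshSize i)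

/-- A hull of at most one point has empty interior in positive dimension. Two vertices give H > 0,
and n ≥ 2 gives 1 + n ≤ n², by which C_𝒯 absorbs lower order terms. -/
lemma one_lt_card_verts (hd : 0 < d) (i : Fin T.numCells) : 2 ≤ (T.verts i).card := by
  by_contra h
  have h1 : (T.verts i).card ≤ 1 := by omega
  have hs : (T.cell i).Subsingleton := by
    show (convexHull ℝ (T.node '' (T.verts i : Set _))).Subsingleton
    rcases (T.node '' (T.verts i : Set _)).eq_empty_or_nonempty with he | ⟨p, hp⟩
    · rw [he, convexHull_empty]; exact subsingleton_empty
    · have h2 : (T.node '' (T.verts i : Set _)).Subsingleton := by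
        rintro _ ⟨a, ha, rfl⟩ _ ⟨b, hb, rfl⟩
        rw [Finset.card_le_one.1 h1 a ha b hb]
      rw [h2.eq_singleton_of_mem hp, convexHull_singleton]
      exact subsingleton_singleton
  have : Nonempty (Fin d) := ⟨⟨0, hd⟩⟩
  have hne : Nontrivial (E d) := inferInstance
  obtain ⟨x, hx⟩ := T.interior_nonempty i
  have hx2 : x ∈ interior {x} :=
    interior_mono (fun y hy => hs hy (interior_subset hx)) hx
  have := Module.punctured_nhds_neBot ℝ (E d) x
  rw [interior_singleton] at hx2
  exact hx2

lemma verts_nonempty (i : Fin T.numCells) : (T.verts i).Nonempty := by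
  by_contra h
  rw [Finset.not_nonempty_iff_eq_empty] at h
  have := T.interior_nonempty i
  rw [h] at this
  simp [polytope] at this

/-! ### Layers -/

lemma self_mem_layer (i : Fin T.numCells) : ∀ m, i ∈ T.layer i m
  | 0 => rfl
  | m + 1 => ⟨i, self_mem_layer i m, by rw [Finset.inter_self]; exact T.verts_nonempty i⟩

lemma layer_subset_succ (i : Fin T.numCells) (m : ℕ) : T.layer i m ⊆ T.layer i (m + 1) :=
  fun j hj => ⟨j, hj, by rw [Finset.inter_self]; exact T.verts_nonempty j⟩

lemma layer_mono (i : Fin T.numCells) : Monotone (T.layer i) :=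
  monotone_nat_of_le_succ (T.layer_subset_succ i)

lemma dist_le_of_mem_layer {i : Fin T.numCells} {x : E d} (hx : x ∈ T.cell i) :
    ∀ {m : ℕ} {j : Fin T.numCells}, j ∈ T.layer i m → ∀ z ∈ T.cell j,
      dist z x ≤ (m + 1) * T.meshSize
  | 0, j, hj, z, hz => by
    rw [show j = i from hj] at hz
    simpa using T.dist_le_meshSize hz hx
  | m + 1, j, ⟨j', hj', p, hp⟩, z, hz => by
    rw [Finset.mem_inter] at hp
    have h1 := dist_le_of_mem_layer hx hj' _ (T.node_mem_cell hp.2)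
    have h2 := T.dist_le_meshSize hz (T.node_mem_cell hp.1)
    have h3 := dist_triangle z (T.node p) x
    push_cast
    linarith

lemma meshSize_pos (hd : 0 < d) (i : Fin T.numCells) : 0 < T.meshSize := by
  have h2 := T.one_lt_card_verts hd i
  obtain ⟨a, ha, b, hb, hab⟩ := Finset.one_lt_card.1 h2
  exact (dist_pos.2 (T.node_injective.ne hab)).trans_le
    (T.dist_le_meshSize (T.node_mem_cell ha) (T.node_mem_cell hb))

/-- A packing bound: the cells inside a set of finite volume are not too many. -/
lemma card_mul_le_volume {ρ : ℝ} (hT : T.IsQuasiUniform ρ)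
    (s : Finset (Fin T.numCells)) (W : Set (E d)) (hW : ∀ i ∈ s, T.cell i ⊆ W) (x₀ : E d) :
    (s.card : ENNReal) * volume (Metric.ball x₀ (ρ * T.meshSize)) ≤ volume W := by
  choose c hc using hT
  have hsub : ∀ i, Metric.ball (c i) (ρ * T.meshSize) ⊆ interior (T.cell i) := fun i =>
    interior_maximal (Metric.ball_subset_closedBall.trans (hc i)) Metric.isOpen_ball
  calc (s.card : ENNReal) * volume (Metric.ball x₀ (ρ * T.meshSize))
      = ∑ i ∈ s, volume (Metric.ball (c i) (ρ * T.meshSize)) := by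
        rw [Finset.sum_congr rfl fun i _ => (Measure.addHaar_ball_center volume (c i) _).trans
          (Measure.addHaar_ball_center volume x₀ _).symm, Finset.sum_const, nsmul_eq_mul]
    _ = volume (⋃ i ∈ s, Metric.ball (c i) (ρ * T.meshSize)) :=
        (measure_biUnion_finset (fun i _ j _ hij =>
          (T.disjoint_interior i j hij).mono (hsub i) (hsub j)) fun i _ => measurableSet_ball).symm
    _ ≤ volume W := measure_mono (iUnion₂_subset fun i hi =>
        (hsub i).trans (interior_subset.trans (hW i hi)))

/-- Finite overlap: every cell whose oversampling region contains the cell j lies within distance (K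
+ 1)H of a point of j, and the disjoint inscribed balls of radius ρH can be packed there only ((K +
1)/ρ)^d times. -/
lemma card_layer_le (hd : 0 < d) {ρ : ℝ} (hρ : 0 < ρ) (hT : T.IsQuasiUniform ρ)
    (k : Fin T.numCells → ℕ) {K : ℕ} (hK : ∀ i, k i ≤ K) (j : Fin T.numCells)
    (s : Finset (Fin T.numCells)) (hs : ∀ i ∈ s, j ∈ T.layer i (k i)) :
    (s.card : ℝ) ≤ ((K + 1) / ρ) ^ d := by
  have hH := T.meshSize_pos hd j
  obtain ⟨z, hz⟩ := T.interior_nonempty j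
  have hz' : z ∈ T.cell j := interior_subset hz
  have hR : 0 ≤ (K + 1) * T.meshSize := by positivity
  have key := T.card_mul_le_volume hT s (Metric.closedBall z ((K + 1) * T.meshSize))
    (fun i hi x hx => by
      have h1 := T.dist_le_of_mem_layer hx (hs i hi) z hz'
      rw [Metric.mem_closedBall, dist_comm]
      refine h1.trans ?_
      have : (k i : ℝ) ≤ K := by exact_mod_cast hK i
      gcongr) z
  rw [Measure.addHaar_closedBall volume z hR, Measure.addHaar_ball_of_pos volume z (by positivity),
    finrank_euclideanSpace_fin, ← mul_assoc] at key
  have hb : volume (Metric.ball (0 : E d) 1) ≠ 0 := (Metric.measure_ball_pos _ _ one_pos).ne'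
  have hb' : volume (Metric.ball (0 : E d) 1) ≠ ⊤ := Metric.isBounded_ball.measure_lt_top.ne
  rw [ENNReal.mul_le_mul_iff_left hb hb', ← ENNReal.ofReal_natCast,
    ← ENNReal.ofReal_mul (by positivity), ENNReal.ofReal_le_ofReal_iff (by positivity),
    mul_pow, mul_pow, ← mul_assoc] at key
  have h2 := le_of_mul_le_mul_right key (by positivity)
  rw [div_pow, le_div_iff₀ (by positivity)]
  exact h2

/-- The members of `V₀(K_{i,m})` are the members of `V` that vanish on the other elements. -/
lemma mem_V0_region_iff {i : Fin T.numCells} {m : ℕ} {v : E d → ℝ} :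
    v ∈ P.V0 (T.region i m) ↔
      v ∈ P.V ∧ ∀ j ∉ T.layer i m, v =ᵐ[volume.restrict (T.elem j)] 0 := by
  -- Since the cell boundaries are null, vanishing off a union of closed cells can be checked
  -- element by element. Outside the domain both sides ask for zero.
  constructor
  · rintro ⟨h1, h2⟩
    rw [ae_restrict_iff' P.isOpen_compl_holes.measurableSet] at h2
    refine ⟨⟨h1, ?_⟩, fun j hj => ?_⟩
    · rw [ae_restrict_iff' P.isOpen_compl_holes.measurableSet]
      filter_upwards [h2, T.ae_notMem_frontier] with x hx hf hxh hxf
      refine hx hxh fun hr => ?_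
      obtain ⟨j, -, hj⟩ := mem_iUnion₂.1 hr
      refine hxf (T.elem_subset_fluid j ⟨?_, hxh⟩)
      by_contra h3
      exact hf j ⟨subset_closure hj, h3⟩
    · rw [Filter.EventuallyEq, ae_restrict_iff' (T.isOpen_elem j).measurableSet]
      filter_upwards [h2, T.ae_notMem_frontier] with x hx hf hxj
      refine hx hxj.2 fun hr => ?_
      obtain ⟨j', hj', hx'⟩ := mem_iUnion₂.1 hr
      have h3 : x ∈ interior (T.cell j') := by
        by_contra h3
        exact hf j' ⟨subset_closure hx', h3⟩
      have h4 : j ≠ j' := fun h => hj (h ▸ hj')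
      exact disjoint_left.1 (T.disjoint_interior j j' h4) hxj.1 h3
  · rintro ⟨⟨h1, h2⟩, h3⟩
    refine ⟨h1, ?_⟩
    rw [ae_restrict_iff' P.isOpen_compl_holes.measurableSet] at h2 ⊢
    have h4 : ∀ᵐ x : E d, ∀ j, j ∉ T.layer i m → x ∈ T.elem j → v x = 0 := by
      refine ae_all_iff.2 fun j => ?_
      by_cases hj : j ∈ T.layer i m
      · simp [hj]
      · have := h3 j hj
        rw [Filter.EventuallyEq, ae_restrict_iff' (T.isOpen_elem j).measurableSet] at this
        simpa [hj] using this
    filter_upwards [h2, h4, T.ae_notMem_frontier] with x a b c hxh hxr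
    by_cases hxf : x ∈ P.fluid
    · obtain ⟨j, hj⟩ := mem_iUnion.1 (T.cover hxf)
      have h5 : x ∈ T.elem j := by
        refine ⟨?_, hxh⟩
        by_contra h3
        exact c j ⟨subset_closure hj, h3⟩
      by_cases hjl : j ∈ T.layer i m
      · exact absurd (mem_iUnion₂.2 ⟨j, hjl, hj⟩) hxr
      · exact b j hjl h5
    · exact a hxh hxf

end CoarseMesh

/-! ### The weight, Lipschitz cutoffs and bubble functions -/

lemma measurable_weight {n : ℕ} (χ : Fin n → E d → ℝ) : Measurable (weight χ) :=
  Finset.measurable_sum _ fun j _ => (measurable_fderiv ℝ (χ j)).norm.pow_const 2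

lemma weight_nonneg {n : ℕ} (χ : Fin n → E d → ℝ) (x : E d) : 0 ≤ weight χ x :=
  Finset.sum_nonneg fun _ _ => sq_nonneg _

/-- The source of the vertex numbers in the constants: by Cauchy–Schwarz, a gradient bounded by the
sum of n of the |∇χ_j| satisfies |∇B|² ≤ n κ̃. -/
lemma sq_sum_norm_fderiv_le {n : ℕ} (χ : Fin n → E d → ℝ) (s : Finset (Fin n)) (x : E d) {a : ℝ}
    (h0 : 0 ≤ a) (ha : a ≤ ∑ j ∈ s, ‖fderiv ℝ (χ j) x‖) : a ^ 2 ≤ s.card * weight χ x := by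
  calc a ^ 2 ≤ (∑ j ∈ s, ‖fderiv ℝ (χ j) x‖) ^ 2 := pow_le_pow_left₀ h0 ha 2
    _ ≤ s.card * ∑ j ∈ s, ‖fderiv ℝ (χ j) x‖ ^ 2 := sq_sum_le_card_mul_sum_sq
    _ ≤ s.card * weight χ x := by
        refine mul_le_mul_of_nonneg_left ?_ (Nat.cast_nonneg _)
        exact Finset.sum_le_sum_of_subset_of_nonneg (Finset.subset_univ s) fun _ _ _ => sq_nonneg _

/-- The functions χ_j are controlled only on the union of the cells, whereas the product rule wants
a Lipschitz function on the whole space with values in [0, 1]. -/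
lemma exists_lipschitz_clip {f : E d → ℝ} {A : Set (E d)} {L : NNReal} (hf : LipschitzOnWith L f A)
    (h0 : ∀ x ∈ A, 0 ≤ f x) (h1 : ∀ x ∈ A, f x ≤ 1) :
    ∃ B, LipschitzWith L B ∧ (∀ x, 0 ≤ B x) ∧ (∀ x, B x ≤ 1) ∧ ∀ x ∈ A, B x = f x := by
  obtain ⟨g, hg, hgf⟩ := hf.extend_real
  refine ⟨fun x => max (min (g x) 1) 0, (hg.min_const 1).max_const 0, fun x => le_max_right _ _,
    fun x => max_le (min_le_right _ _) zero_le_one, fun x hx => ?_⟩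
  show max (min (g x) 1) 0 = f x
  rw [← hgf hx, min_eq_left (h1 x hx), max_eq_left (h0 x hx)]

lemma exists_lipschitz_prod {ι : Type*} (s : Finset ι) (f : ι → E d → ℝ)
    (hf : ∀ j, ∃ L, LipschitzWith L (f j)) (h0 : ∀ j x, 0 ≤ f j x) (h1 : ∀ j x, f j x ≤ 1) :
    ∃ L, LipschitzWith L fun x => ∏ j ∈ s, f j x := by
  classical
  induction s using Finset.induction_on with
  | empty => exact ⟨0, by simp⟩
  | insert a s ha ih =>
    obtain ⟨L, hL⟩ := ih
    obtain ⟨L', hL'⟩ := hf a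
    simp_rw [Finset.prod_insert ha]
    refine ⟨_, LipschitzWith.mul_bounded (Mf := 1) (Mg := 1) hL' hL (fun x => ?_) fun x => ?_⟩
    · rw [abs_of_nonneg (h0 a x)]; exact h1 a x
    · rw [abs_of_nonneg (Finset.prod_nonneg fun j _ => h0 j x)]
      exact Finset.prod_le_one (fun j _ => h0 j x) fun j _ => h1 j x

lemma exists_lipschitz_sum {ι : Type*} (s : Finset ι) (f : ι → E d → ℝ)
    (hf : ∀ j, ∃ L, LipschitzWith L (f j)) : ∃ L, LipschitzWith L fun x => ∑ j ∈ s, f j x := by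
  classical
  induction s using Finset.induction_on with
  | empty => exact ⟨0, by simp⟩
  | insert a s ha ih =>
    obtain ⟨L, hL⟩ := ih
    obtain ⟨L', hL'⟩ := hf a
    simp_rw [Finset.sum_insert ha]
    exact ⟨_, hL'.add hL⟩

/-- A Lipschitz function that vanishes on the frontier of a set is Lipschitz after truncation to
this set. -/
lemma lipschitz_indicator {F : E d → ℝ} {L : NNReal} (hF : LipschitzWith L F) {A : Set (E d)}
    (h0 : ∀ x ∈ frontier A, F x = 0) : LipschitzWith L (A.indicator F) := by
  have key : ∀ x ∈ A, ∀ y ∉ A, dist (A.indicator F x) (A.indicator F y) ≤ L * dist x y := by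
    intro x hx y hy
    -- A segment that leaves A meets the boundary of A, where F vanishes; the distance from x to
    -- that point is at most the distance from x to y.
    obtain ⟨z, hz, hzf⟩ : ∃ z ∈ segment ℝ x y, z ∈ frontier A := by
      by_contra! hcon
      have h1 : ∀ z ∈ segment ℝ x y, z ∈ closure A → z ∈ interior A := fun z hz hc => by
        by_contra h
        exact hcon z hz ⟨hc, h⟩
      obtain ⟨z, -, hz, hz'⟩ := (convex_segment (𝕜 := ℝ) x y).isPreconnected (interior A)
        (closure A)ᶜ isOpen_interior isClosed_closure.isOpen_compl
        (fun z hz => or_iff_not_imp_right.2 fun h => h1 z hz (not_not.1 h))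
        ⟨x, left_mem_segment ℝ x y, h1 x (left_mem_segment ℝ x y) (subset_closure hx)⟩
        ⟨y, right_mem_segment ℝ x y, fun hc =>
          hy (interior_subset (h1 y (right_mem_segment ℝ x y) hc))⟩
      exact hz' (interior_subset_closure hz)
    rw [indicator_of_mem hx, indicator_of_notMem hy, ← h0 z hzf]
    refine (hF.dist_le_mul x z).trans (mul_le_mul_of_nonneg_left ?_ L.coe_nonneg)
    have := dist_add_dist_of_mem_segment hz
    linarith [dist_nonneg (x := z) (y := y)]
  refine LipschitzWith.of_dist_le_mul fun x y => ?_
  by_cases hx : x ∈ A <;> by_cases hy : y ∈ A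
  · rw [indicator_of_mem hx, indicator_of_mem hy]; exact hF.dist_le_mul x y
  · exact key x hx y hy
  · rw [dist_comm, dist_comm x y]; exact key y hy x hx
  · rw [indicator_of_notMem hx, indicator_of_notMem hy, dist_self]; positivity

namespace PartitionOfUnity
variable {P : PerforatedDomain d} {T : CoarseMesh P} (X : PartitionOfUnity T)

lemma mem_iUnion_cell {i : Fin T.numCells} {x : E d} (hx : x ∈ T.cell i) : x ∈ ⋃ i, T.cell i :=
  mem_iUnion.2 ⟨i, hx⟩

lemma sum_verts_eq_one {i : Fin T.numCells} {x : E d} (hx : x ∈ T.cell i) :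
    ∑ j ∈ T.verts i, X.χ j x = 1 := by
  rw [← X.sum_eq_one x (mem_iUnion_cell hx)]
  exact Finset.sum_subset (Finset.subset_univ _) fun j _ hj => X.support i j hj x hx

lemma sum_le_one (s : Finset (Fin T.numNodes)) {x : E d} (hx : x ∈ ⋃ i, T.cell i) :
    ∑ j ∈ s, X.χ j x ≤ 1 := by
  rw [← X.sum_eq_one x hx]
  exact Finset.sum_le_sum_of_subset_of_nonneg (Finset.subset_univ s) fun j _ _ => X.nonneg j x hx

lemma le_one (j : Fin T.numNodes) {x : E d} (hx : x ∈ ⋃ i, T.cell i) : X.χ j x ≤ 1 := by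
  simpa using X.sum_le_one {j} hx

lemma exists_extension (j : Fin T.numNodes) : ∃ B, (∃ L, LipschitzWith L B) ∧ (∀ x, 0 ≤ B x) ∧
    (∀ x, B x ≤ 1) ∧ ∀ x ∈ ⋃ i, T.cell i, B x = X.χ j x := by
  obtain ⟨L, hL⟩ := X.lipschitz j
  obtain ⟨B, h1, h2⟩ := exists_lipschitz_clip hL (X.nonneg j) fun x hx => X.le_one j hx
  exact ⟨B, ⟨L, h1⟩, h2⟩

lemma eventually_mem_cell {i : Fin T.numCells} {x : E d} (hx : x ∈ T.elem i) :
    ∀ᶠ z in nhds x, z ∈ T.cell i := by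
  filter_upwards [(T.isOpen_elem i).mem_nhds hx] with z hz using T.elem_subset_cell i hz

lemma ae_differentiableAt (i : Fin T.numCells) :
    ∀ᵐ x ∂(volume.restrict (T.elem i)), ∀ j, DifferentiableAt ℝ (X.χ j) x := by
  refine ae_all_iff.2 fun j => ?_
  obtain ⟨B, ⟨L, hL⟩, -, -, hB⟩ := X.exists_extension j
  filter_upwards [ae_restrict_of_ae hL.ae_differentiableAt,
    ae_restrict_mem (T.isOpen_elem i).measurableSet] with x hx hxi
  refine hx.congr_of_eventuallyEq ?_
  filter_upwards [eventually_mem_cell hxi] with z hz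
  exact (hB z (mem_iUnion_cell hz)).symm

lemma exists_weight_le : ∃ C, 0 < C ∧ ∀ i, ∀ x ∈ T.elem i, X.κ x ≤ C := by
  choose L hL using X.lipschitz
  refine ⟨∑ j, (L j : ℝ) ^ 2 + 1, by positivity, fun i x hx => ?_⟩
  unfold κ weight
  refine (Finset.sum_le_sum (g := fun j => (L j : ℝ) ^ 2) fun j _ => ?_).trans
    (le_add_of_nonneg_right zero_le_one)
  refine pow_le_pow_left₀ (norm_nonneg _) ?_ 2
  refine norm_fderiv_le_of_lipschitzOn ℝ (s := ⋃ i, T.cell i) ?_ (hL j)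
  filter_upwards [eventually_mem_cell hx] with z hz using mem_iUnion_cell hz

/-- The cutoff function `∑_{j ∈ J} χ_j`. -/
lemma exists_cutoff (J : Finset (Fin T.numNodes)) : ∃ B : E d → ℝ, (∃ L, LipschitzWith L B) ∧
    (∀ x, 0 ≤ B x) ∧ (∀ x, B x ≤ 1) ∧ (∀ x ∈ ⋃ i, T.cell i, B x = ∑ j ∈ J, X.χ j x) ∧
    ∀ i, ∀ᵐ x ∂(volume.restrict (T.elem i)),
      ‖gradient B x‖ ^ 2 ≤ (T.verts i).card * X.κ x := by
  choose f hf h0 h1 hfe using X.exists_extension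
  obtain ⟨L, hL⟩ := exists_lipschitz_sum J f hf
  have hLA : LipschitzOnWith L (fun x => ∑ j ∈ J, X.χ j x) (⋃ i, T.cell i) := by
    intro x hx y hy
    have := hL x y
    simpa only [hfe _ x hx, hfe _ y hy] using this
  obtain ⟨B, hB, b0, b1, hBe⟩ := exists_lipschitz_clip hLA
    (fun x hx => Finset.sum_nonneg fun j _ => X.nonneg j x hx) fun x hx => X.sum_le_one J hx
  refine ⟨B, ⟨L, hB⟩, b0, b1, hBe, fun i => ?_⟩
  filter_upwards [X.ae_differentiableAt i, ae_restrict_mem (T.isOpen_elem i).measurableSet]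
    with x hx hxi
  rw [norm_gradient]
  refine sq_sum_norm_fderiv_le X.χ (T.verts i) x (norm_nonneg _) ?_
  -- Near a point of the element only the vertices of its own cell contribute, so the constant is
  -- their number and not the size of J.
  have h2 : B =ᶠ[nhds x] fun z => ∑ j ∈ J ∩ T.verts i, X.χ j z := by
    filter_upwards [eventually_mem_cell hxi] with z hz
    rw [hBe z (mem_iUnion_cell hz)]
    refine (Finset.sum_subset Finset.inter_subset_left fun j hj hj' => ?_).symm
    exact X.support i j (fun h => hj' (Finset.mem_inter.2 ⟨hj, h⟩)) z hz
  rw [h2.fderiv_eq, fderiv_fun_sum fun j _ => hx j]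
  exact (norm_sum_le _ _).trans (Finset.sum_le_sum_of_subset_of_nonneg Finset.inter_subset_right
    fun _ _ _ => norm_nonneg _)

/-- The bubble function, extended by zero. -/
lemma exists_bubble (i : Fin T.numCells) : ∃ B : E d → ℝ, (∃ L, LipschitzWith L B) ∧
    (∀ x, 0 ≤ B x) ∧ (∀ x, B x ≤ 1) ∧ (∀ x ∉ interior (T.cell i), B x = 0) ∧
    (∀ x ∈ T.cell i, B x = X.bubble i x) ∧
    ∀ᵐ x ∂(volume.restrict (T.elem i)), ‖gradient B x‖ ^ 2 ≤ (T.verts i).card * X.κ x := by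
  choose f hf h0 h1 hfe using X.exists_extension
  obtain ⟨L, hL⟩ := exists_lipschitz_prod (T.verts i) f hf h0 h1
  have hcell : ∀ x ∈ T.cell i, ∏ j ∈ T.verts i, f j x = X.bubble i x := fun x hx =>
    Finset.prod_congr rfl fun j _ => hfe j x (mem_iUnion_cell hx)
  have hfr : ∀ x ∈ frontier (T.cell i), ∏ j ∈ T.verts i, f j x = 0 := fun x hx => by
    rw [hcell x ((T.isClosed_cell i).frontier_subset hx)]
    exact X.bubble_zero i x hx
  refine ⟨(T.cell i).indicator fun x => ∏ j ∈ T.verts i, f j x, ⟨L, lipschitz_indicator hL hfr⟩,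
    fun x => indicator_nonneg (fun x _ => Finset.prod_nonneg fun j _ => h0 j x) x,
    fun x => ?_, fun x hx => ?_, fun x hx => ?_, ?_⟩
  · refine indicator_apply_le' (fun _ => ?_) fun _ => zero_le_one
    exact Finset.prod_le_one (fun j _ => h0 j x) fun j _ => h1 j x
  · by_cases hxc : x ∈ T.cell i
    · rw [indicator_of_mem hxc]
      exact hfr x ⟨subset_closure hxc, hx⟩
    · rw [indicator_of_notMem hxc]
  · rw [indicator_of_mem hx]; exact hcell x hx
  · filter_upwards [X.ae_differentiableAt i, ae_restrict_mem (T.isOpen_elem i).measurableSet]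
      with x hx hxi
    rw [norm_gradient]
    refine sq_sum_norm_fderiv_le X.χ (T.verts i) x (norm_nonneg _) ?_
    have h2 : ((T.cell i).indicator fun x => ∏ j ∈ T.verts i, f j x) =ᶠ[nhds x]
        fun z => ∏ j ∈ T.verts i, X.χ j z := by
      filter_upwards [eventually_mem_cell hxi] with z hz
      rw [indicator_of_mem hz, hcell z hz]; rfl
    have hxc : x ∈ ⋃ i, T.cell i := mem_iUnion_cell (T.elem_subset_cell i hxi)
    classical
    -- In the product rule each gradient is multiplied by factors in [0, 1], so |∇B| is at most the
    -- sum of the |∇χ_j| over the vertices.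
    rw [h2.fderiv_eq, (HasFDerivAt.finsetProd fun j _ => (hx j).hasFDerivAt).fderiv]
    refine (norm_sum_le _ _).trans (Finset.sum_le_sum fun j _ => ?_)
    rw [norm_smul]
    refine mul_le_of_le_one_left (norm_nonneg _) ?_
    rw [Real.norm_of_nonneg (Finset.prod_nonneg fun k _ => X.nonneg k x hxc)]
    exact Finset.prod_le_one (fun k _ => X.nonneg k x hxc) fun k _ => X.le_one k hxc

lemma measurable_κ : Measurable X.κ := measurable_weight _

lemma κ_nonneg (x : E d) : 0 ≤ X.κ x := weight_nonneg _ x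

lemma exists_le_weight : ∃ κ₀ > 0, ∀ i, ∀ᵐ x ∂(volume.restrict (T.elem i)), κ₀ ≤ X.κ x := by
  obtain ⟨κ₀, h0, h⟩ := X.weight_pos
  exact ⟨κ₀, h0, T.ae_fluid_iff.1 h⟩

end PartitionOfUnity

/-! ### Weighted `L²` spaces -/

/-- `L²(U)` as a space of functions. -/
def L2Sub (U : Set (E d)) : Submodule ℝ (E d → ℝ) where
  carrier := {v | MemLp v 2 (volume.restrict U)}
  zero_mem' := MemLp.zero
  add_mem' := fun ha hb => MemLp.add ha hb
  smul_mem' := fun c _ ha => MemLp.const_smul ha c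

lemma H1_le_L2Sub (U : Set (E d)) : H1 U ≤ L2Sub U := fun _ hv => hv.1

/-- A measurable, nonnegative and essentially bounded weight on `U`. -/
structure IsWeight (U : Set (E d)) (q : E d → ℝ) : Prop where
  measurable : Measurable q
  nonneg : ∀ x, 0 ≤ q x
  bdd : ∃ C, ∀ᵐ x ∂(volume.restrict U), q x ≤ C

lemma IsWeight.memLp {U : Set (E d)} {q : E d → ℝ} (h : IsWeight U q) {v : E d → ℝ}
    (hv : MemLp v 2 (volume.restrict U)) :
    MemLp (fun x => Real.sqrt (q x) * v x) 2 (volume.restrict U) := by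
  obtain ⟨C, hC⟩ := h.bdd
  refine hv.of_le_mul (c := Real.sqrt C) (h.measurable.sqrt.aestronglyMeasurable.mul hv.1) ?_
  filter_upwards [hC] with x hx
  rw [norm_mul, Real.norm_of_nonneg (Real.sqrt_nonneg _)]
  exact mul_le_mul_of_nonneg_right (Real.sqrt_le_sqrt hx) (norm_nonneg _)

/-- Multiplication by the square root of a weight. -/
def weightL {U : Set (E d)} {q : E d → ℝ} (h : IsWeight U q) :
    L2Sub U →ₗ[ℝ] Lp ℝ 2 (volume.restrict U) where
  toFun v := (h.memLp v.2).toLp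
  map_add' v w := by
    rw [← MemLp.toLp_add, MemLp.toLp_eq_toLp_iff]
    exact Filter.Eventually.of_forall fun x => mul_add _ _ _
  map_smul' c v := by
    rw [← MemLp.toLp_const_smul, MemLp.toLp_eq_toLp_iff]
    exact Filter.Eventually.of_forall fun x => mul_left_comm _ _ _

lemma inner_weightL {U : Set (E d)} {q : E d → ℝ} (h : IsWeight U q) (v w : L2Sub U) :
    inner ℝ (weightL h v) (weightL h w) = sForm q U v w := by
  refine (inner_toLp (h.memLp v.2) (h.memLp w.2)).trans
    (integral_congr_ae (Filter.Eventually.of_forall fun x => ?_))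
  have := Real.mul_self_sqrt (h.nonneg x)
  simp only [RCLike.inner_apply, conj_trivial]
  linear_combination (v : E d → ℝ) x * (w : E d → ℝ) x * this

lemma weightL_eq_iff {U : Set (E d)} {q : E d → ℝ} (h : IsWeight U q) (v w : L2Sub U) :
    weightL h v = weightL h w ↔
      (fun x => Real.sqrt (q x) * (v : E d → ℝ) x) =ᵐ[volume.restrict U]
        fun x => Real.sqrt (q x) * (w : E d → ℝ) x :=
  MemLp.toLp_eq_toLp_iff (h.memLp v.2) (h.memLp w.2)

lemma weightL_eq_zero_iff {U : Set (E d)} {q : E d → ℝ} (h : IsWeight U q)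
    (hpos : ∀ᵐ x ∂(volume.restrict U), 0 < q x) (v : L2Sub U) :
    weightL h v = 0 ↔ (v : E d → ℝ) =ᵐ[volume.restrict U] 0 := by
  rw [← map_zero (weightL h), weightL_eq_iff]
  constructor
  · intro h1
    filter_upwards [h1, hpos] with x hx hp
    simpa [(Real.sqrt_pos.2 hp).ne'] using hx
  · intro h1
    filter_upwards [h1] with x hx
    rw [hx]; rfl

namespace PartitionOfUnity
variable {P : PerforatedDomain d} {T : CoarseMesh P} (X : PartitionOfUnity T)

lemma isWeight (i : Fin T.numCells) : IsWeight (T.elem i) X.κ := by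
  obtain ⟨C, -, hC⟩ := X.exists_weight_le
  exact ⟨X.measurable_κ, X.κ_nonneg, C,
    ae_restrict_of_forall_mem (T.isOpen_elem i).measurableSet (hC i)⟩

lemma weight_pos_ae (i : Fin T.numCells) : ∀ᵐ x ∂(volume.restrict (T.elem i)), 0 < X.κ x := by
  obtain ⟨κ₀, h0, h⟩ := X.exists_le_weight
  filter_upwards [h i] with x hx using h0.trans_le hx

end PartitionOfUnity

/-! ### The local spectral problem -/

namespace LocalSpectrum
variable {P : PerforatedDomain d} {T : CoarseMesh P} {X : PartitionOfUnity T}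
  {i : Fin T.numCells} (sp : LocalSpectrum X i)

/-- The eigenfunctions as elements of `H¹`. -/
def phi (j : ℕ) : H1 (T.elem i) := ⟨sp.eigenfun j, sp.memH1 j⟩

/-- The weighted eigenfunctions. -/
def e (j : ℕ) : Lp ℝ 2 (volume.restrict (T.elem i)) :=
  weightL (X.isWeight i) ⟨sp.eigenfun j, (sp.memH1 j).1⟩

lemma orthonormal_e : Orthonormal ℝ sp.e := by
  rw [orthonormal_iff_ite]
  intro j j'
  exact (inner_weightL _ _ _).trans (sp.orthonormal j j')

/-- Completeness is assumed in the weighted form. An h orthogonal to all √κ̃ φ_j equals √κ̃ w with w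
= κ̃^{-1/2} h, which is square integrable because κ̃ is bounded below. -/
lemma span_e_orthogonal : (Submodule.span ℝ (range sp.e))ᗮ = ⊥ := by
  rw [eq_bot_iff]
  intro h hh
  rw [Submodule.mem_bot]
  have h1 : ∀ j, inner ℝ h (sp.e j) = 0 := fun j => by
    rw [real_inner_comm]
    exact (Submodule.mem_orthogonal _ _).1 hh _ (Submodule.subset_span ⟨j, rfl⟩)
  obtain ⟨κ₀, hκ₀, hκ⟩ := X.exists_le_weight
  have hw : MemLp (fun x => (Real.sqrt (X.κ x))⁻¹ * h x) 2 (volume.restrict (T.elem i)) := by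
    refine (Lp.memLp h).of_le_mul (c := (Real.sqrt κ₀)⁻¹)
      (X.measurable_κ.sqrt.inv.aestronglyMeasurable.mul (Lp.memLp h).1) ?_
    filter_upwards [hκ i] with x hx
    rw [norm_mul, Real.norm_of_nonneg (by positivity)]
    exact mul_le_mul_of_nonneg_right (inv_anti₀ (Real.sqrt_pos.2 hκ₀) (Real.sqrt_le_sqrt hx))
      (norm_nonneg _)
  have hRw : weightL (X.isWeight i) ⟨_, hw⟩ = h := by
    refine (MemLp.toLp_eq_toLp_iff ((X.isWeight i).memLp hw) (Lp.memLp h)).2 ?_ |>.trans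
      (Lp.toLp_coeFn h (Lp.memLp h))
    filter_upwards [X.weight_pos_ae i] with x hx
    rw [← mul_assoc, mul_inv_cancel₀ (Real.sqrt_pos.2 hx).ne', one_mul]
  have h2 := sp.complete _ hw fun j => by
    refine (inner_weightL (X.isWeight i) ⟨_, hw⟩ ⟨sp.eigenfun j, (sp.memH1 j).1⟩).symm.trans ?_
    rw [hRw]
    exact h1 j
  rw [← hRw]
  exact (weightL_eq_zero_iff _ (X.weight_pos_ae i) _).2 h2

/-- The Hilbert basis of weighted eigenfunctions. -/
def basis : HilbertBasis ℕ ℝ (Lp ℝ 2 (volume.restrict (T.elem i))) :=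
  HilbertBasis.mkOfOrthogonalEqBot sp.orthonormal_e sp.span_e_orthogonal

lemma hasSum_sq (h : Lp ℝ 2 (volume.restrict (T.elem i))) :
    HasSum (fun j => inner ℝ h (sp.e j) ^ 2) (‖h‖ ^ 2) := by
  have h1 := sp.basis.hasSum_inner_mul_inner h h
  rw [real_inner_self_eq_norm_sq] at h1
  have h2 : ∀ j, inner ℝ h (sp.basis j) * inner ℝ (sp.basis j) h = inner ℝ h (sp.e j) ^ 2 :=
    fun j => by
      rw [real_inner_comm h, sq, basis, HilbertBasis.coe_mkOfOrthogonalEqBot]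
  simpa only [h2] using h1

lemma eigenval_nonneg (j : ℕ) : 0 ≤ sp.eigenval j := by
  have h := sp.eigen j _ (sp.memH1 j)
  rw [sp.orthonormal, if_pos rfl, mul_one] at h
  rw [← h]
  exact integral_nonneg fun x => real_inner_self_nonneg

/-- The coefficients with respect to the first `l` eigenfunctions. -/
def coef (l : ℕ) : L2Sub (T.elem i) →ₗ[ℝ] EuclideanSpace ℝ (Fin l) where
  toFun v := WithLp.toLp 2 fun j => inner ℝ (sp.e j) (weightL (X.isWeight i) v)
  map_add' v w := by ext j; simp [inner_add_right]
  map_smul' c v := by ext j; simp [inner_smul_right]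

lemma coef_apply (l : ℕ) (v : L2Sub (T.elem i)) (j : Fin l) :
    sp.coef l v j = sForm X.κ (T.elem i) v (sp.eigenfun j) := by
  show inner ℝ (sp.e j) (weightL (X.isWeight i) v) = _
  rw [real_inner_comm]
  exact inner_weightL _ _ _

lemma norm_coef_sq (l : ℕ) (v : L2Sub (T.elem i)) :
    ‖sp.coef l v‖ ^ 2 = ∑ j ∈ Finset.range l, inner ℝ (sp.e j) (weightL (X.isWeight i) v) ^ 2 := by
  rw [EuclideanSpace.real_norm_sq_eq, ← Fin.sum_univ_eq_sum_range]
  rfl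

lemma norm_coef_le (l : ℕ) (v : L2Sub (T.elem i)) : ‖sp.coef l v‖ ≤ ‖weightL (X.isWeight i) v‖ := by
  refine le_of_sq_le_sq ?_ (norm_nonneg _)
  rw [norm_coef_sq]
  have := sp.orthonormal_e.sum_inner_products_le (s := Finset.range l) (weightL (X.isWeight i) v)
  simpa using this

lemma inner_grad_phi (j : ℕ) (v : H1 (T.elem i)) :
    inner ℝ (gradL _ (T.isOpen_elem i) (sp.phi j)) (gradL _ (T.isOpen_elem i) v) =
      sp.eigenval j * inner ℝ (sp.e j)
        (weightL (X.isWeight i) (Submodule.inclusion (H1_le_L2Sub _) v)) := by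
  rw [inner_gradL]
  refine (sp.eigen j v v.2).trans (congrArg _ ?_)
  exact (inner_weightL (X.isWeight i) ⟨sp.eigenfun j, (sp.memH1 j).1⟩
    (Submodule.inclusion (H1_le_L2Sub _) v)).symm

/-- The combination of the first `l` eigenfunctions with given coefficients. -/
def synth (l : ℕ) : EuclideanSpace ℝ (Fin l) →ₗ[ℝ] H1 (T.elem i) where
  toFun c := ∑ j, c j • sp.phi j
  map_add' a b := by simp [add_smul, Finset.sum_add_distrib]
  map_smul' r a := by simp [Finset.smul_sum, smul_smul]

lemma inner_grad_synth (l : ℕ) (c : EuclideanSpace ℝ (Fin l)) (v : H1 (T.elem i)) :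
    inner ℝ (gradL _ (T.isOpen_elem i) (sp.synth l c)) (gradL _ (T.isOpen_elem i) v) =
      ∑ j : Fin l, sp.eigenval j * c j *
        sp.coef l (Submodule.inclusion (H1_le_L2Sub _) v) j := by
  show inner ℝ (gradL _ _ (∑ j, c j • sp.phi j)) _ = _
  rw [map_sum, sum_inner]
  refine Finset.sum_congr rfl fun j _ => ?_
  rw [map_smul, inner_smul_left, inner_grad_phi]
  simp only [conj_trivial]
  rw [← mul_assoc, mul_comm (c j)]
  rfl

lemma weightL_synth (l : ℕ) (c : EuclideanSpace ℝ (Fin l)) :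
    weightL (X.isWeight i) (Submodule.inclusion (H1_le_L2Sub _) (sp.synth l c)) =
      ∑ j : Fin l, c j • sp.e j := by
  show weightL _ (Submodule.inclusion _ (∑ j, c j • sp.phi j)) = _
  rw [map_sum, map_sum]
  refine Finset.sum_congr rfl fun j _ => ?_
  rw [map_smul, map_smul]
  rfl

lemma coef_synth (l : ℕ) (c : EuclideanSpace ℝ (Fin l)) :
    sp.coef l (Submodule.inclusion (H1_le_L2Sub _) (sp.synth l c)) = c := by
  ext j
  show inner ℝ (sp.e j) (weightL _ _) = _
  rw [weightL_synth, inner_sum]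
  simp_rw [inner_smul_right, orthonormal_iff_ite.1 sp.orthonormal_e]
  simp [Fin.val_inj]

lemma norm_weightL_synth (l : ℕ) (c : EuclideanSpace ℝ (Fin l)) :
    ‖weightL (X.isWeight i) (Submodule.inclusion (H1_le_L2Sub _) (sp.synth l c))‖ = ‖c‖ := by
  have h : ‖weightL (X.isWeight i) (Submodule.inclusion (H1_le_L2Sub _) (sp.synth l c))‖ ^ 2 =
      ‖c‖ ^ 2 := by
    conv_lhs => rw [← real_inner_self_eq_norm_sq, weightL_synth, sum_inner]
    rw [← weightL_synth]
    simp_rw [inner_smul_left]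
    rw [EuclideanSpace.real_norm_sq_eq]
    refine Finset.sum_congr rfl fun j _ => ?_
    have := congrArg (fun c : EuclideanSpace ℝ (Fin l) => c j) (sp.coef_synth l c)
    rw [sq, conj_trivial]
    exact congrArg _ this
  exact (sq_eq_sq₀ (norm_nonneg _) (norm_nonneg _)).1 h

lemma norm_grad_synth_sq_le {l : ℕ} (hl : 1 ≤ l) (c : EuclideanSpace ℝ (Fin l)) :
    ‖gradL _ (T.isOpen_elem i) (sp.synth l c)‖ ^ 2 ≤ sp.eigenval (l - 1) * ‖c‖ ^ 2 := by
  rw [← real_inner_self_eq_norm_sq, inner_grad_synth, coef_synth, EuclideanSpace.real_norm_sq_eq,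
    Finset.mul_sum]
  refine Finset.sum_le_sum fun j _ => ?_
  rw [mul_assoc, ← sq (c j)]
  exact mul_le_mul_of_nonneg_right (sp.monotone (by have := j.2; omega)) (sq_nonneg _)

/-- Bessel's inequality in the energy: expand ‖∇(v − v_N)‖² ≥ 0 for the partial sum v_N of v. The
eigenvalue equation makes both the mixed term and the energy of v_N equal to the sum on the left. -/
lemma sum_eigenval_le (N : ℕ) (v : H1 (T.elem i)) :
    ∑ j ∈ Finset.range N, sp.eigenval j * inner ℝ (sp.e j)
      (weightL (X.isWeight i) (Submodule.inclusion (H1_le_L2Sub _) v)) ^ 2 ≤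
      ‖gradL _ (T.isOpen_elem i) v‖ ^ 2 := by
  set c := sp.coef N (Submodule.inclusion (H1_le_L2Sub _) v) with hc
  have h1 : ∑ j ∈ Finset.range N, sp.eigenval j * inner ℝ (sp.e j)
      (weightL (X.isWeight i) (Submodule.inclusion (H1_le_L2Sub _) v)) ^ 2 =
      ∑ j : Fin N, sp.eigenval j * c j * c j := by
    rw [← Fin.sum_univ_eq_sum_range (fun j => sp.eigenval j * inner ℝ (sp.e j)
      (weightL (X.isWeight i) (Submodule.inclusion (H1_le_L2Sub _) v)) ^ 2)]
    refine Finset.sum_congr rfl fun j _ => ?_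
    rw [sq, ← mul_assoc]
    rfl
  have h2 := sp.inner_grad_synth N c v
  have h3 := sp.inner_grad_synth N c (sp.synth N c)
  rw [coef_synth] at h3
  rw [h1]
  have h4 := sq_nonneg ‖gradL _ (T.isOpen_elem i) v - gradL _ (T.isOpen_elem i) (sp.synth N c)‖
  rw [norm_sub_sq_real, real_inner_comm, h2, ← real_inner_self_eq_norm_sq (gradL _ _ (sp.synth N c)),
    h3] at h4
  linarith

/-- The spectral gap estimate. -/
lemma gap_estimate (l : ℕ) (v : H1 (T.elem i)) :
    sp.eigenval l * ‖weightL (X.isWeight i) (Submodule.inclusion (H1_le_L2Sub _) v)‖ ^ 2 ≤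
      ‖gradL _ (T.isOpen_elem i) v‖ ^ 2 +
        sp.eigenval l * ‖sp.coef l (Submodule.inclusion (H1_le_L2Sub _) v)‖ ^ 2 := by
  set h := weightL (X.isWeight i) (Submodule.inclusion (H1_le_L2Sub _) v) with hh
  -- By Parseval it suffices to bound finite partial sums. The coefficients below l are kept, and
  -- for the others λ_l ≤ λ_j leads to the energy.
  have hs := ((sp.hasSum_sq h).mul_left (sp.eigenval l)).tendsto_sum_nat
  refine le_of_tendsto hs ?_
  filter_upwards [Filter.eventually_ge_atTop l] with N hN
  have h1 := sp.sum_eigenval_le N v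
  rw [norm_coef_sq, ← Finset.sum_range_add_sum_Ico _ hN, Finset.mul_sum]
  rw [← Finset.sum_range_add_sum_Ico _ hN] at h1
  have h2 : ∑ j ∈ Finset.Ico l N, sp.eigenval l * inner ℝ h (sp.e j) ^ 2 ≤
      ∑ j ∈ Finset.Ico l N, sp.eigenval j * inner ℝ (sp.e j) h ^ 2 :=
    Finset.sum_le_sum fun j hj => by
      rw [real_inner_comm]
      exact mul_le_mul_of_nonneg_right (sp.monotone (Finset.mem_Ico.1 hj).1) (sq_nonneg _)
  have h3 : 0 ≤ ∑ j ∈ Finset.range l, sp.eigenval j * inner ℝ (sp.e j) h ^ 2 :=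
    Finset.sum_nonneg fun j _ => mul_nonneg (sp.eigenval_nonneg j) (sq_nonneg _)
  rw [← hh] at h1 ⊢
  simp_rw [real_inner_comm h] at h1 h2 h3 ⊢
  linarith

end LocalSpectrum

/-! ### The product rule and bubble weights on one element -/

section
variable {P : PerforatedDomain d} {T : CoarseMesh P} (X : PartitionOfUnity T)
  {i : Fin T.numCells}

/-- The weighted `L²` class of an `H¹` function on an element. -/
def massL (i : Fin T.numCells) : H1 (T.elem i) →ₗ[ℝ] Lp ℝ 2 (volume.restrict (T.elem i)) :=
  weightL (X.isWeight i) ∘ₗ Submodule.inclusion (H1_le_L2Sub _)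

/-- The product rule, as a decomposition in `L²`. -/
lemma exists_grad_decomp {B : E d → ℝ} {L : NNReal} (hB : LipschitzWith L B) (h0 : ∀ x, 0 ≤ B x)
    (h1 : ∀ x, B x ≤ 1) {n : ℕ}
    (hn : ∀ᵐ x ∂(volume.restrict (T.elem i)), ‖gradient B x‖ ^ 2 ≤ n * X.κ x)
    (v w : H1 (T.elem i))
    (hw : (w : E d → ℝ) =ᵐ[volume.restrict (T.elem i)] fun x => B x * (v : E d → ℝ) x) :
    ∃ p q, gradL _ (T.isOpen_elem i) w = p + q ∧ ‖p‖ ≤ ‖gradL _ (T.isOpen_elem i) v‖ ∧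
      0 ≤ inner ℝ (gradL _ (T.isOpen_elem i) v) p ∧ ‖q‖ ≤ Real.sqrt n * ‖massL X i v‖ := by
  have hv : IsGrad (T.elem i) v (weakGrad (T.elem i) v) := MemH1.isGrad v.2
  have hv' : IsGrad (univ ∩ T.elem i) v (weakGrad (T.elem i) v) := by rwa [univ_inter]
  have hprod := hv'.mul_lipschitz (T.isOpen_elem i) isOpen_univ hB h0 h1 (by simp)
  rw [indicator_univ] at hprod
  have hp : MemLp (fun x => B x • weakGrad (T.elem i) v x) 2 (volume.restrict (T.elem i)) :=
    hv.memLp_grad.mono (hB.continuous.aestronglyMeasurable.smul hv.memLp_grad.1)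
      (Filter.Eventually.of_forall fun x => by
        rw [norm_smul, Real.norm_of_nonneg (h0 x)]
        exact mul_le_of_le_one_left (norm_nonneg _) (h1 x))
  have hq : MemLp (fun x => (v : E d → ℝ) x • gradient B x) 2 (volume.restrict (T.elem i)) := by
    have := hprod.memLp_grad.sub hp
    refine this.ae_eq (Filter.Eventually.of_forall fun x => ?_)
    simp
  have hwgrad : IsGrad (T.elem i) w _ := hprod.congr hw.symm (ae_eq_refl _)
  -- Here p = B ∇v and q = v ∇B. The sign of ⟨∇v, p⟩ is recorded because the decay estimate needs a
  -- lower bound for ⟨∇v, ∇(Bv)⟩, not only the size of ∇(Bv).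
  refine ⟨hp.toLp, hq.toLp, ?_, ?_, ?_, ?_⟩
  · rw [← MemLp.toLp_add]
    exact gradL_eq_toLp (T.isOpen_elem i) hwgrad
  · refine Lp.norm_le_norm_of_ae_le ?_
    show ∀ᵐ x ∂_, _ ≤ ‖(hv.memLp_grad.toLp : E d → E d) x‖
    filter_upwards [hp.coeFn_toLp, hv.memLp_grad.coeFn_toLp] with x e1 e2
    rw [e1, e2, norm_smul, Real.norm_of_nonneg (h0 x)]
    exact mul_le_of_le_one_left (norm_nonneg _) (h1 x)
  · refine (integral_nonneg fun x => ?_).trans_eq (inner_toLp hv.memLp_grad hp).symm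
    rw [inner_smul_right]
    exact mul_nonneg (h0 x) real_inner_self_nonneg
  · refine Lp.norm_le_mul_norm_of_ae_le_mul ?_
    have hm := (X.isWeight i).memLp hv.memLp
    show ∀ᵐ x ∂_, _ ≤ Real.sqrt n * ‖(hm.toLp : E d → ℝ) x‖
    filter_upwards [hq.coeFn_toLp, hm.coeFn_toLp, hn] with x e1 e2 e3
    rw [e1, e2, norm_smul, norm_mul, Real.norm_of_nonneg (Real.sqrt_nonneg _), ← mul_assoc,
      ← Real.sqrt_mul (Nat.cast_nonneg n), mul_comm]
    exact mul_le_mul_of_nonneg_right (Real.le_sqrt_of_sq_le e3) (norm_nonneg _)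

lemma norm_massL_le_of_le {B : E d → ℝ} (h0 : ∀ x, 0 ≤ B x)
    (h1 : ∀ x, B x ≤ 1) (v w : H1 (T.elem i))
    (hw : (w : E d → ℝ) =ᵐ[volume.restrict (T.elem i)] fun x => B x * (v : E d → ℝ) x) :
    ‖massL X i w‖ ≤ ‖massL X i v‖ := by
  refine Lp.norm_le_norm_of_ae_le ?_
  have hm := (X.isWeight i).memLp v.2.1
  have hm' := (X.isWeight i).memLp w.2.1
  show ∀ᵐ x ∂_, ‖(hm'.toLp : E d → ℝ) x‖ ≤ ‖(hm.toLp : E d → ℝ) x‖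
  filter_upwards [hm.coeFn_toLp, hm'.coeFn_toLp, hw] with x e1 e2 e3
  rw [e1, e2, e3, norm_mul, norm_mul, norm_mul]
  refine mul_le_mul_of_nonneg_left ?_ (norm_nonneg _)
  rw [Real.norm_of_nonneg (h0 x)]
  exact mul_le_of_le_one_left (norm_nonneg _) (h1 x)

namespace PartitionOfUnity

/-- The bubble function of a cell, extended by zero to the whole space. -/
def bubbleExt (i : Fin T.numCells) : E d → ℝ := (X.exists_bubble i).choose

variable (i)

lemma exists_lipschitz_bubbleExt : ∃ L, LipschitzWith L (X.bubbleExt i) :=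
  (X.exists_bubble i).choose_spec.1

lemma bubbleExt_nonneg (x : E d) : 0 ≤ X.bubbleExt i x := (X.exists_bubble i).choose_spec.2.1 x

lemma bubbleExt_le_one (x : E d) : X.bubbleExt i x ≤ 1 := (X.exists_bubble i).choose_spec.2.2.1 x

lemma bubbleExt_eq_zero : ∀ x ∉ interior (T.cell i), X.bubbleExt i x = 0 :=
  (X.exists_bubble i).choose_spec.2.2.2.1

lemma bubbleExt_eq : ∀ x ∈ T.cell i, X.bubbleExt i x = X.bubble i x :=
  (X.exists_bubble i).choose_spec.2.2.2.2.1

lemma norm_gradient_bubbleExt_le : ∀ᵐ x ∂(volume.restrict (T.elem i)),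
    ‖gradient (X.bubbleExt i) x‖ ^ 2 ≤ (T.verts i).card * X.κ x :=
  (X.exists_bubble i).choose_spec.2.2.2.2.2

lemma bubbleExt_pos {x : E d} (hx : x ∈ interior (T.cell i)) : 0 < X.bubbleExt i x := by
  rw [X.bubbleExt_eq i x (interior_subset hx)]
  exact X.bubble_pos i x hx

lemma isWeight_bubble : IsWeight (T.elem i) fun x => X.bubbleExt i x * X.κ x := by
  obtain ⟨L, hL⟩ := X.exists_lipschitz_bubbleExt i
  obtain ⟨C, hC⟩ := (X.isWeight i).bdd
  refine ⟨hL.continuous.measurable.mul X.measurable_κ,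
    fun x => mul_nonneg (X.bubbleExt_nonneg i x) (X.κ_nonneg x), C, ?_⟩
  filter_upwards [hC] with x hx
  exact (mul_le_of_le_one_left (X.κ_nonneg x) (X.bubbleExt_le_one i x)).trans hx

lemma weight_bubble_pos : ∀ᵐ x ∂(volume.restrict (T.elem i)),
    0 < X.bubbleExt i x * X.κ x := by
  filter_upwards [X.weight_pos_ae i, ae_restrict_mem (T.isOpen_elem i).measurableSet] with x h1 h2
  exact mul_pos (X.bubbleExt_pos i h2.1) h1

lemma sForm_bubble (v w : E d → ℝ) : sForm (fun x => X.bubble i x * X.κ x) (T.elem i) v w =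
    sForm (fun x => X.bubbleExt i x * X.κ x) (T.elem i) v w :=
  setIntegral_congr_fun (T.isOpen_elem i).measurableSet fun x hx => by
    simp only [X.bubbleExt_eq i x (T.elem_subset_cell i hx)]

end PartitionOfUnity
end

namespace LocalSpectrum
variable {P : PerforatedDomain d} {T : CoarseMesh P} {X : PartitionOfUnity T}
  {i : Fin T.numCells} (sp : LocalSpectrum X i)

/-- The bubble-weighted class of a combination of eigenfunctions. -/
def bubbleSynth (l : ℕ) : EuclideanSpace ℝ (Fin l) →ₗ[ℝ] Lp ℝ 2 (volume.restrict (T.elem i)) :=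
  weightL (X.isWeight_bubble i) ∘ₗ Submodule.inclusion (H1_le_L2Sub _) ∘ₗ sp.synth l

lemma norm_massL_synth (l : ℕ) (c : EuclideanSpace ℝ (Fin l)) :
    ‖massL X i (sp.synth l c)‖ = ‖c‖ := sp.norm_weightL_synth l c

lemma ker_bubbleSynth (l : ℕ) : LinearMap.ker (sp.bubbleSynth l) = ⊥ := by
  rw [LinearMap.ker_eq_bot']
  intro c hc
  have h1 := (weightL_eq_zero_iff (X.isWeight_bubble i) (X.weight_bubble_pos i) _).1 hc
  have h2 : massL X i (sp.synth l c) = 0 :=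
    (weightL_eq_zero_iff (X.isWeight i) (X.weight_pos_ae i) _).2 h1
  rw [← norm_eq_zero, ← sp.norm_massL_synth l c, h2, norm_zero]

/-- An injective linear map on a finite-dimensional space is bounded below. Injectivity holds
because the bubble is positive inside the cell; this is why C_π is finite. -/
lemma exists_norm_le_bubbleSynth (l : ℕ) : ∃ K : ℝ, ∀ c, ‖c‖ ≤ K * ‖sp.bubbleSynth l c‖ := by
  obtain ⟨K, -, hK⟩ := (sp.bubbleSynth l).exists_antilipschitzWith (sp.ker_bubbleSynth l)
  refine ⟨K, fun c => ?_⟩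
  have := hK.le_mul_dist c 0
  rwa [map_zero, dist_zero_right, dist_zero_right] at this

lemma norm_bubbleSynth_le (l : ℕ) (c : EuclideanSpace ℝ (Fin l)) :
    ‖sp.bubbleSynth l c‖ ≤ ‖c‖ := by
  rw [← sp.norm_massL_synth l c]
  refine Lp.norm_le_norm_of_ae_le ?_
  have hm := (X.isWeight i).memLp (sp.synth l c).2.1
  have hm' := (X.isWeight_bubble i).memLp (sp.synth l c).2.1
  show ∀ᵐ x ∂_, ‖(hm'.toLp : E d → ℝ) x‖ ≤ ‖(hm.toLp : E d → ℝ) x‖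
  filter_upwards [hm.coeFn_toLp, hm'.coeFn_toLp] with x e1 e2
  rw [e1, e2, norm_mul, norm_mul, Real.norm_of_nonneg (Real.sqrt_nonneg _),
    Real.norm_of_nonneg (Real.sqrt_nonneg _)]
  exact mul_le_mul_of_nonneg_right (Real.sqrt_le_sqrt
    (mul_le_of_le_one_left (X.κ_nonneg x) (X.bubbleExt_le_one i x))) (norm_nonneg _)

end LocalSpectrum

/-! ### The constant C_π and elementwise lifting of coefficients -/

namespace Discretization
variable {P : PerforatedDomain d} (S : Discretization P)

lemma exists_synth_of_mem_Vaux {i : Fin S.mesh.numCells} {μ : E d → ℝ} (h : μ ∈ S.Vaux i) :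
    ∃ c, ((S.spec i).synth (S.l i) c : E d → ℝ) = μ := by
  have hle : S.Vaux i ≤ LinearMap.range ((H1 (S.mesh.elem i)).subtype ∘ₗ (S.spec i).synth (S.l i)) := by
    refine Submodule.span_le.2 ?_
    rintro _ ⟨j, hj, rfl⟩
    refine ⟨EuclideanSpace.single ⟨j, hj⟩ 1, ?_⟩
    show ((∑ k, (EuclideanSpace.single (⟨j, hj⟩ : Fin (S.l i)) (1 : ℝ)) k • (S.spec i).phi k :
      H1 (S.mesh.elem i)) : E d → ℝ) = _
    rw [Finset.sum_eq_single ⟨j, hj⟩]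
    · simp [LocalSpectrum.phi]
    · intro b _ hb
      simp [hb]
    · simp
  exact hle h

lemma synth_mem_Vaux (i : Fin S.mesh.numCells) (c : EuclideanSpace ℝ (Fin (S.l i))) :
    ((S.spec i).synth (S.l i) c : E d → ℝ) ∈ S.Vaux i := by
  show ((∑ k, c k • (S.spec i).phi k : H1 (S.mesh.elem i)) : E d → ℝ) ∈ _
  rw [Submodule.coe_sum]
  exact Submodule.sum_mem _ fun j _ => Submodule.smul_mem _ _
    (Submodule.subset_span ⟨j, j.2, rfl⟩)

lemma ratio_eq (i : Fin S.mesh.numCells) (c : EuclideanSpace ℝ (Fin (S.l i))) :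
    sForm S.pou.κ (S.mesh.elem i) ((S.spec i).synth (S.l i) c) ((S.spec i).synth (S.l i) c) /
      sForm (fun x => S.pou.bubble i x * S.pou.κ x) (S.mesh.elem i)
        ((S.spec i).synth (S.l i) c) ((S.spec i).synth (S.l i) c) =
      ‖c‖ ^ 2 / ‖(S.spec i).bubbleSynth (S.l i) c‖ ^ 2 := by
  rw [← (S.spec i).norm_massL_synth (S.l i) c, S.pou.sForm_bubble, ← real_inner_self_eq_norm_sq,
    ← real_inner_self_eq_norm_sq]
  let v : L2Sub (S.mesh.elem i) :=
    Submodule.inclusion (H1_le_L2Sub _) ((S.spec i).synth (S.l i) c)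
  exact congrArg₂ _ (inner_weightL (S.pou.isWeight i) v v).symm
    (inner_weightL (S.pou.isWeight_bubble i) v v).symm

/-- An unbounded supremum would have the default value 0, so the quotients must first be bounded;
the sum of the squared constants of the finitely many elements does this. -/
lemma norm_sq_le_Cpi (i : Fin S.mesh.numCells) (c : EuclideanSpace ℝ (Fin (S.l i))) :
    ‖c‖ ^ 2 ≤ S.Cpi * ‖(S.spec i).bubbleSynth (S.l i) c‖ ^ 2 := by
  choose K hK using fun i => (S.spec i).exists_norm_le_bubbleSynth (S.l i)
  have hbdd : BddAbove {r | ∃ i, ∃ μ ∈ S.Vaux i, r = sForm S.pou.κ (S.mesh.elem i) μ μ /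
      sForm (fun x => S.pou.bubble i x * S.pou.κ x) (S.mesh.elem i) μ μ} := by
    refine ⟨∑ i, K i ^ 2, ?_⟩
    rintro _ ⟨i, μ, hμ, rfl⟩
    obtain ⟨c, rfl⟩ := S.exists_synth_of_mem_Vaux hμ
    rw [S.ratio_eq]
    refine (div_le_of_le_mul₀ (sq_nonneg _) (sq_nonneg _) ?_).trans
      (Finset.single_le_sum (f := fun i => K i ^ 2) (fun i _ => sq_nonneg _) (Finset.mem_univ i))
    rw [← mul_pow]
    exact pow_le_pow_left₀ (norm_nonneg _) (hK i c) 2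
  have h1 : ‖c‖ ^ 2 / ‖(S.spec i).bubbleSynth (S.l i) c‖ ^ 2 ≤ S.Cpi :=
    le_csSup hbdd ⟨i, _, S.synth_mem_Vaux i c, (S.ratio_eq i c).symm⟩
  rcases eq_or_ne c 0 with rfl | hc
  · simp
  · have h2 : (S.spec i).bubbleSynth (S.l i) c ≠ 0 := fun h =>
      hc (LinearMap.ker_eq_bot'.1 ((S.spec i).ker_bubbleSynth (S.l i)) c h)
    rwa [div_le_iff₀ (by positivity)] at h1

lemma one_le_Cpi (i : Fin S.mesh.numCells) : 1 ≤ S.Cpi := by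
  let c : EuclideanSpace ℝ (Fin (S.l i)) := EuclideanSpace.single ⟨0, S.l_pos i⟩ 1
  have hc : ‖c‖ = 1 := by simp [c]
  have h1 := S.norm_sq_le_Cpi i c
  have h2 := (S.spec i).norm_bubbleSynth_le (S.l i) c
  rw [hc] at h1 h2
  have h3 : ‖(S.spec i).bubbleSynth (S.l i) c‖ ^ 2 ≤ 1 := pow_le_one₀ (norm_nonneg _) h2
  have h4 := sq_nonneg ‖(S.spec i).bubbleSynth (S.l i) c‖
  by_contra! h5
  rcases le_or_gt S.Cpi 0 with h6 | h6 <;> nlinarith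

/-! ### The elementwise maps -/

lemma VSub_le_H1_elem (i : Fin S.mesh.numCells) : P.VSub ≤ H1 (S.mesh.elem i) :=
  P.V0Sub_le_H1 (S.mesh.isOpen_elem i) (S.mesh.elem_subset_compl_holes i)

/-- Restriction to an element. -/
def res (i : Fin S.mesh.numCells) : P.VSub →ₗ[ℝ] H1 (S.mesh.elem i) :=
  Submodule.inclusion (S.VSub_le_H1_elem i)

/-- The gradient on an element. -/
def grad (i : Fin S.mesh.numCells) : P.VSub →ₗ[ℝ] Lp (E d) 2 (volume.restrict (S.mesh.elem i)) :=
  gradL _ (S.mesh.isOpen_elem i) ∘ₗ S.res i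

/-- The weighted `L²` class on an element. -/
def mass (i : Fin S.mesh.numCells) : P.VSub →ₗ[ℝ] Lp ℝ 2 (volume.restrict (S.mesh.elem i)) :=
  massL S.pou i ∘ₗ S.res i

/-- The coefficients of the projection onto the auxiliary space of an element. -/
def proj (i : Fin S.mesh.numCells) : P.VSub →ₗ[ℝ] EuclideanSpace ℝ (Fin (S.l i)) :=
  (S.spec i).coef (S.l i) ∘ₗ Submodule.inclusion (H1_le_L2Sub _) ∘ₗ S.res i

/-- The functions that vanish on an element. -/
def vanish (i : Fin S.mesh.numCells) : Submodule ℝ P.VSub where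
  carrier := {v | (v : E d → ℝ) =ᵐ[volume.restrict (S.mesh.elem i)] 0}
  zero_mem' := ae_eq_refl _
  add_mem' := fun {v w} hv hw => by
    show ((v + w : P.VSub) : E d → ℝ) =ᵐ[volume.restrict (S.mesh.elem i)] 0
    filter_upwards [hv, hw] with x h1 h2
    simp [h1, h2]
  smul_mem' := fun c v hv => by
    show ((c • v : P.VSub) : E d → ℝ) =ᵐ[volume.restrict (S.mesh.elem i)] 0
    filter_upwards [hv] with x h1
    simp [h1]

lemma grad_eq_zero {i : Fin S.mesh.numCells} {v : P.VSub} (h : v ∈ S.vanish i) : S.grad i v = 0 :=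
  gradL_eq_zero (S.mesh.isOpen_elem i) (S.res i v) h

lemma mass_eq_zero {i : Fin S.mesh.numCells} {v : P.VSub} (h : v ∈ S.vanish i) : S.mass i v = 0 :=
  (weightL_eq_zero_iff (S.pou.isWeight i) (S.pou.weight_pos_ae i) _).2 h

lemma norm_proj_le (i : Fin S.mesh.numCells) (v : P.VSub) : ‖S.proj i v‖ ≤ ‖S.mass i v‖ :=
  (S.spec i).norm_coef_le _ _

lemma proj_eq_zero {i : Fin S.mesh.numCells} {v : P.VSub} (h : v ∈ S.vanish i) : S.proj i v = 0 := by
  have := S.norm_proj_le i v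
  rwa [S.mass_eq_zero h, norm_zero, norm_le_zero_iff] at this

lemma gap_estimate (i : Fin S.mesh.numCells) (v : P.VSub) :
    (S.spec i).eigenval (S.l i) * ‖S.mass i v‖ ^ 2 ≤
      ‖S.grad i v‖ ^ 2 + (S.spec i).eigenval (S.l i) * ‖S.proj i v‖ ^ 2 :=
  (S.spec i).gap_estimate (S.l i) (S.res i v)

lemma mass_le_grad {i : Fin S.mesh.numCells} {v : P.VSub} (h : S.proj i v = 0) :
    ‖S.mass i v‖ ≤ (Real.sqrt ((S.spec i).eigenval (S.l i)))⁻¹ * ‖S.grad i v‖ := by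
  have h1 := S.gap_estimate i v
  have hpos := S.gap i
  rw [h, norm_zero] at h1
  rw [← div_eq_inv_mul, le_div_iff₀ (Real.sqrt_pos.2 hpos)]
  refine le_of_sq_le_sq ?_ (norm_nonneg _)
  rw [mul_pow, Real.sq_sqrt hpos.le]
  linarith

lemma proj_congr {i : Fin S.mesh.numCells} {v w : P.VSub} (h : v - w ∈ S.vanish i) :
    S.proj i v = S.proj i w := by
  rw [← sub_eq_zero, ← map_sub, S.proj_eq_zero h]

lemma grad_congr {i : Fin S.mesh.numCells} {v w : P.VSub} (h : v - w ∈ S.vanish i) :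
    S.grad i v = S.grad i w := by
  rw [← sub_eq_zero, ← map_sub, S.grad_eq_zero h]

lemma le_Gam {A : Set (Fin S.mesh.numCells)} {i : Fin S.mesh.numCells} (hi : i ∈ A) :
    (S.spec i).eigenval (S.l i - 1) ≤ S.Gam A :=
  le_csSup (toFinite _).bddAbove (mem_image_of_mem _ hi)

lemma card_sq_le_CT (i : Fin S.mesh.numCells) : ((S.mesh.verts i).card : ℝ) ^ 2 ≤ S.mesh.CT := by
  refine pow_le_pow_left₀ (Nat.cast_nonneg _) ?_ 2
  exact_mod_cast Finset.le_sup (f := fun i => (S.mesh.verts i).card) (Finset.mem_univ i)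

/-- The estimates produce the product on the left; 1 + n ≤ n² ≤ C_𝒯, valid for n ≥ 2, brings it into
the form of D. -/
lemma D_ge (hd : 0 < d) {A : Set (Fin S.mesh.numCells)} {i : Fin S.mesh.numCells} (hi : i ∈ A) :
    (1 + (S.mesh.verts i).card) * (1 + (S.spec i).eigenval (S.l i - 1)) * S.Cpi ^ 2 ≤ S.D A := by
  have h1 := S.card_sq_le_CT i
  have h2 := S.le_Gam hi
  have h3 := (S.spec i).eigenval_nonneg (S.l i - 1)
  have h4 : (2 : ℝ) ≤ (S.mesh.verts i).card := by exact_mod_cast S.mesh.one_lt_card_verts hd i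
  have h5 : 1 + ((S.mesh.verts i).card : ℝ) ≤ S.mesh.CT := by nlinarith
  have h6 : 0 ≤ S.mesh.CT := sq_nonneg _
  unfold D
  calc _ ≤ S.mesh.CT * (1 + S.Gam A) * S.Cpi ^ 2 := by gcongr
    _ = _ := by ring

lemma card_le_D (hd : 0 < d) {A : Set (Fin S.mesh.numCells)} {i : Fin S.mesh.numCells}
    (hi : i ∈ A) : 1 + ((S.mesh.verts i).card : ℝ) ≤ S.D A := by
  refine le_trans ?_ (S.D_ge hd hi)
  have h3 := (S.spec i).eigenval_nonneg (S.l i - 1)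
  have h4 := S.one_le_Cpi i
  have h5 : (0 : ℝ) ≤ (S.mesh.verts i).card := Nat.cast_nonneg _
  rw [mul_assoc]
  refine le_mul_of_one_le_right (by positivity) ?_
  nlinarith [sq_nonneg S.Cpi]

/-- Lifting of coefficients to a function supported in one element. -/
lemma exists_bubble_lift (hd : 0 < d) (i : Fin S.mesh.numCells)
    (c : EuclideanSpace ℝ (Fin (S.l i))) :
    ∃ b : P.VSub, (∀ j ≠ i, b ∈ S.vanish j) ∧ S.proj i b = c ∧
      ∀ A, i ∈ A → ‖S.grad i b‖ ≤ Real.sqrt (S.D A) * ‖c‖ := by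
  obtain ⟨L, hL⟩ := S.pou.exists_lipschitz_bubbleExt i
  set B := S.pou.bubbleExt i with hB
  have h0 := S.pou.bubbleExt_nonneg i
  have h1 := S.pou.bubbleExt_le_one i
  have hz := S.pou.bubbleExt_eq_zero i
  -- Since the bubble vanishes off the interior of the cell, bubble times μ extends by zero across
  -- the cell boundary, while nothing is needed at the perforations.
  have hV : ∀ μ : H1 (S.mesh.elem i), (fun x => B x * (μ : E d → ℝ) x) ∈ P.VSub := fun μ => by
    have hg : IsGrad (interior (S.mesh.cell i) ∩ P.holesᶜ) μ (weakGrad (S.mesh.elem i) μ) :=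
      MemH1.isGrad μ.2
    refine ⟨(hg.mul_lipschitz P.isOpen_compl_holes isOpen_interior hL h0 h1 hz).memH1, ?_⟩
    rw [ae_restrict_iff' P.isOpen_compl_holes.measurableSet]
    refine Filter.Eventually.of_forall fun x hx hxf => ?_
    have : B x = 0 := hz x fun h => hxf (S.mesh.elem_subset_fluid i ⟨h, hx⟩)
    simp [this]
  let b : EuclideanSpace ℝ (Fin (S.l i)) → P.VSub := fun c' => ⟨_, hV ((S.spec i).synth (S.l i) c')⟩
  -- The map c' ↦ π_i(B μ_{c'}), where μ_{c'} is the eigenfunction combination with coefficients c',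
  -- is the Gram operator of the form ∫ B κ̃ μ ν on the auxiliary space. It is positive definite,
  -- hence bijective.
  have hproj : ∀ c' a, inner ℝ a (S.proj i (b c')) =
      inner ℝ ((S.spec i).bubbleSynth (S.l i) a) ((S.spec i).bubbleSynth (S.l i) c') := fun c' a => by
    have e1 : inner ℝ ((S.spec i).bubbleSynth (S.l i) a) ((S.spec i).bubbleSynth (S.l i) c') =
        inner ℝ (massL S.pou i ((S.spec i).synth (S.l i) a)) (S.mass i (b c')) := by
      refine (inner_weightL (S.pou.isWeight_bubble i) _ _).trans
        (Eq.trans ?_ (inner_weightL (S.pou.isWeight i) _ _).symm)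
      refine integral_congr_ae (Filter.Eventually.of_forall fun x => ?_)
      show B x * S.pou.κ x * ((S.spec i).synth (S.l i) a : E d → ℝ) x *
        ((S.spec i).synth (S.l i) c' : E d → ℝ) x = S.pou.κ x *
        ((S.spec i).synth (S.l i) a : E d → ℝ) x * (B x * ((S.spec i).synth (S.l i) c' : E d → ℝ) x)
      ring
    rw [e1]
    have e2 : massL S.pou i ((S.spec i).synth (S.l i) a) = ∑ j : Fin (S.l i), a j • (S.spec i).e j :=
      (S.spec i).weightL_synth _ _
    rw [e2, sum_inner, PiLp.inner_apply]
    refine Finset.sum_congr rfl fun j _ => ?_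
    rw [inner_smul_left]
    simp only [RCLike.inner_apply, conj_trivial]
    rw [mul_comm]
    rfl
  let Tm : EuclideanSpace ℝ (Fin (S.l i)) →ₗ[ℝ] EuclideanSpace ℝ (Fin (S.l i)) :=
    { toFun := fun c' => S.proj i (b c')
      map_add' := fun a a' => by
        rw [← map_add]
        congr 1
        ext1
        show (fun x => B x * _) = _
        rw [map_add]
        exact funext fun x => mul_add _ _ _
      map_smul' := fun r a => by
        rw [RingHom.id_apply, ← map_smul]
        congr 1
        ext1
        show (fun x => B x * _) = _
        rw [map_smul]
        exact funext fun x => mul_left_comm _ _ _ }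
  have hinj : Function.Injective Tm := by
    rw [← LinearMap.ker_eq_bot, LinearMap.ker_eq_bot']
    intro a ha
    have h2 := hproj a a
    rw [show S.proj i (b a) = 0 from ha, inner_zero_right, eq_comm, inner_self_eq_zero] at h2
    exact LinearMap.ker_eq_bot'.1 ((S.spec i).ker_bubbleSynth (S.l i)) a h2
  obtain ⟨c', hc'⟩ := LinearMap.injective_iff_surjective.1 hinj c
  have hc'' : S.proj i (b c') = c := hc'
  refine ⟨b c', fun j hj => ?_, hc', fun A hA => ?_⟩
  · show _ =ᵐ[_] _
    filter_upwards [ae_restrict_mem (S.mesh.isOpen_elem j).measurableSet] with x hx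
    have : B x = 0 := hz x fun h => disjoint_left.1 (S.mesh.disjoint_interior j i hj) hx.1 h
    show B x * _ = 0
    rw [this, zero_mul]
  · have hcc : ‖c'‖ ≤ S.Cpi * ‖c‖ := by
      have e1 := S.norm_sq_le_Cpi i c'
      have e2 := hproj c' c'
      rw [hc'', real_inner_self_eq_norm_sq] at e2
      rw [← e2] at e1
      have e3 := real_inner_le_norm c' c
      have e4 := S.one_le_Cpi i
      rcases (norm_nonneg c').eq_or_lt with h | h
      · rw [← h]; positivity
      · refine le_of_mul_le_mul_right ?_ h
        nlinarith
    obtain ⟨p, q, e1, e2, -, e3⟩ := exists_grad_decomp S.pou hL h0 h1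
      (S.pou.norm_gradient_bubbleExt_le i) ((S.spec i).synth (S.l i) c') (S.res i (b c'))
      (ae_eq_refl _)
    have e4 := (S.spec i).norm_grad_synth_sq_le (S.l_pos i) c'
    rw [LocalSpectrum.norm_massL_synth] at e3
    set γ := (S.spec i).eigenval (S.l i - 1) with hγ
    have hγ0 : 0 ≤ γ := (S.spec i).eigenval_nonneg _
    set n : ℝ := ((S.mesh.verts i).card : ℝ) with hn
    have hn0 : 0 ≤ n := Nat.cast_nonneg _
    have e5 : ‖gradL _ (S.mesh.isOpen_elem i) ((S.spec i).synth (S.l i) c')‖ ≤ Real.sqrt γ * ‖c'‖ := by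
      refine le_of_sq_le_sq ?_ (by positivity)
      rw [mul_pow, Real.sq_sqrt hγ0]
      exact e4
    have e6 : ‖S.grad i (b c')‖ ≤ (Real.sqrt γ + Real.sqrt n) * ‖c'‖ := by
      show ‖gradL _ (S.mesh.isOpen_elem i) (S.res i (b c'))‖ ≤ _
      rw [e1]
      refine (norm_add_le _ _).trans ?_
      linarith
    -- After squaring, this is 2√(γn) ≤ 1 + γn.
    have e7 : Real.sqrt γ + Real.sqrt n ≤ Real.sqrt ((1 + n) * (1 + γ)) := by
      refine Real.le_sqrt_of_sq_le ?_
      have a1 := Real.sq_sqrt hγ0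
      have a2 := Real.sq_sqrt hn0
      nlinarith [sq_nonneg (Real.sqrt γ * Real.sqrt n - 1)]
    calc ‖S.grad i (b c')‖ ≤ Real.sqrt ((1 + n) * (1 + γ)) * (S.Cpi * ‖c‖) :=
          e6.trans (mul_le_mul e7 hcc (norm_nonneg _) (Real.sqrt_nonneg _))
      _ = Real.sqrt ((1 + n) * (1 + γ) * S.Cpi ^ 2) * ‖c‖ := by
          rw [Real.sqrt_mul (by positivity) (S.Cpi ^ 2),
            Real.sqrt_sq (zero_le_one.trans (S.one_le_Cpi i)), mul_assoc]
      _ ≤ Real.sqrt (S.D A) * ‖c‖ :=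
          mul_le_mul_of_nonneg_right (Real.sqrt_le_sqrt (S.D_ge hd hA)) (norm_nonneg _)

end Discretization

/-! ### Cutoffs that preserve the kernel of the projections -/

namespace PerforatedDomain
variable (P : PerforatedDomain d)

/-- The gradient on the whole perforated domain. -/
def gradAll : P.VSub →ₗ[ℝ] Lp (E d) 2 (volume.restrict P.fluid) :=
  gradL _ P.isOpen_fluid ∘ₗ Submodule.inclusion P.VSub_le_H1

lemma inner_gradAll (v w : P.VSub) :
    inner ℝ (P.gradAll v) (P.gradAll w) = aForm P.fluid v w :=
  inner_gradL P.isOpen_fluid _ _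

lemma aNorm_eq (v : P.VSub) : P.aNorm v = ‖P.gradAll v‖ := by
  rw [aNorm, ← inner_gradAll, real_inner_self_eq_norm_sq, Real.sqrt_sq (norm_nonneg _)]

end PerforatedDomain

namespace Discretization
variable {P : PerforatedDomain d} (S : Discretization P)

/-- Multiplication of a function by a cutoff, corrected by bubbles so that the projections onto the
auxiliary spaces of the cells where the cutoff varies remain zero. -/
lemma exists_quasi_projection (hd : 0 < d) (J : Set (Fin S.mesh.numNodes)) (v : P.VSub)
    (hv : ∀ i, (∃ j ∈ S.mesh.verts i, j ∈ J) → (∃ j ∈ S.mesh.verts i, j ∉ J) → S.proj i v = 0) :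
    ∃ w : P.VSub, (∀ i, (∀ j ∈ S.mesh.verts i, j ∉ J) → w ∈ S.vanish i) ∧
      (∀ i, (∀ j ∈ S.mesh.verts i, j ∈ J) → w - v ∈ S.vanish i) ∧
      ∀ i, (∃ j ∈ S.mesh.verts i, j ∈ J) → (∃ j ∈ S.mesh.verts i, j ∉ J) → S.proj i w = 0 ∧
        ∀ A, i ∈ A →
          ‖S.grad i w‖ ≤ (1 + 2 * Real.sqrt (S.D A) *
            (Real.sqrt ((S.spec i).eigenval (S.l i)))⁻¹) * ‖S.grad i v‖ ∧
          -(2 * Real.sqrt (S.D A) * (Real.sqrt ((S.spec i).eigenval (S.l i)))⁻¹) *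
            ‖S.grad i v‖ ^ 2 ≤ inner ℝ (S.grad i v) (S.grad i w) := by
  classical
  obtain ⟨B, ⟨L, hL⟩, h0, h1, hsum, hgr⟩ := S.pou.exists_cutoff (Finset.univ.filter (· ∈ J))
  have hχ : (fun x => B x * (v : E d → ℝ) x) ∈ P.VSub := by
    have hg : IsGrad (univ ∩ P.holesᶜ) v (weakGrad P.holesᶜ v) := by
      rw [univ_inter]; exact MemH1.isGrad v.2.1
    refine ⟨(hg.mul_lipschitz P.isOpen_compl_holes isOpen_univ hL h0 h1 (by simp)).memH1, ?_⟩
    filter_upwards [v.2.2] with x hx hxf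
    simp [hx hxf]
  let u : P.VSub := ⟨_, hχ⟩
  -- On all other cells the cutoff is constantly 0 or 1, so a bubble correction is needed only on
  -- the mixed ones.
  let mixed : Fin S.mesh.numCells → Prop := fun i =>
    (∃ j ∈ S.mesh.verts i, j ∈ J) ∧ (∃ j ∈ S.mesh.verts i, j ∉ J)
  have hb : ∀ i, ∃ b : P.VSub, (∀ j ≠ i, b ∈ S.vanish j) ∧ (¬ mixed i → b = 0) ∧
      (mixed i → S.proj i b = - S.proj i u ∧
        ∀ A, i ∈ A → ‖S.grad i b‖ ≤ Real.sqrt (S.D A) * ‖S.proj i u‖) := fun i => by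
    by_cases hm : mixed i
    · obtain ⟨b, b1, b2, b3⟩ := S.exists_bubble_lift hd i (- S.proj i u)
      exact ⟨b, b1, fun h => absurd hm h, fun _ => ⟨b2, fun A hA => by simpa using b3 A hA⟩⟩
    · exact ⟨0, fun j _ => Submodule.zero_mem _, fun _ => rfl, fun h => absurd h hm⟩
  choose b b1 b2 b3 using hb
  -- Every bubble lives in its own cell, so an element sees only its own correction.
  have hloc : ∀ i, (u + ∑ j, b j) - (u + b i) ∈ S.vanish i := fun i => by
    rw [add_sub_add_left_eq_sub, ← Finset.add_sum_erase _ _ (Finset.mem_univ i), add_sub_cancel_left]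
    exact Submodule.sum_mem _ fun j hj => b1 j i (Finset.ne_of_mem_erase hj).symm
  have hJ : ∀ i, ∀ x ∈ S.mesh.cell i,
      B x = ∑ j ∈ (S.mesh.verts i).filter (· ∈ J), S.pou.χ j x := fun i x hx => by
    rw [hsum x (PartitionOfUnity.mem_iUnion_cell hx)]
    refine (Finset.sum_subset (fun j hj => ?_) fun j hj hj' => ?_).symm
    · simp only [Finset.mem_filter, Finset.mem_univ, true_and] at hj ⊢
      exact hj.2
    · simp only [Finset.mem_filter, Finset.mem_univ, true_and] at hj hj'
      exact S.pou.support i j (fun h => hj' ⟨h, hj⟩) x hx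
  refine ⟨u + ∑ j, b j, fun i hi => ?_, fun i hi => ?_, fun i hi1 hi2 => ?_⟩
  · have hm : ¬ mixed i := fun ⟨⟨j, hj, hj'⟩, _⟩ => hi j hj hj'
    have h2 : u ∈ S.vanish i := by
      show _ =ᵐ[_] _
      filter_upwards [ae_restrict_mem (S.mesh.isOpen_elem i).measurableSet] with x hx
      show B x * _ = 0
      rw [hJ i x (S.mesh.elem_subset_cell i hx), Finset.filter_false_of_mem hi]
      simp
    have h3 := hloc i
    rw [b2 i hm, add_zero] at h3
    simpa [add_comm] using Submodule.add_mem _ h3 h2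
  · have hm : ¬ mixed i := fun ⟨_, ⟨j, hj, hj'⟩⟩ => hj' (hi j hj)
    have h2 : u - v ∈ S.vanish i := by
      show _ =ᵐ[_] _
      filter_upwards [ae_restrict_mem (S.mesh.isOpen_elem i).measurableSet] with x hx
      show B x * (v : E d → ℝ) x - (v : E d → ℝ) x = 0
      rw [hJ i x (S.mesh.elem_subset_cell i hx), Finset.filter_true_of_mem hi,
        S.pou.sum_verts_eq_one (S.mesh.elem_subset_cell i hx)]
      simp
    have h3 := hloc i
    rw [b2 i hm, add_zero] at h3
    have := Submodule.add_mem _ h3 h2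
    rwa [sub_add_sub_cancel] at this
  · obtain ⟨c1, c2⟩ := b3 i ⟨hi1, hi2⟩
    refine ⟨?_, fun A hA => ?_⟩
    · rw [S.proj_congr (hloc i), map_add, c1, add_neg_cancel]
    · have hvi := hv i hi1 hi2
      have hmass := S.mass_le_grad hvi
      obtain ⟨p, q, e1, e2, e3, e4⟩ := exists_grad_decomp S.pou hL h0 h1 (hgr i) (S.res i v)
        (S.res i u) (ae_eq_refl _)
      have hmu : ‖S.mass i u‖ ≤ ‖S.mass i v‖ :=
        norm_massL_le_of_le S.pou h0 h1 (S.res i v) (S.res i u) (ae_eq_refl _)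
      have hbn : ‖S.grad i (b i)‖ ≤ Real.sqrt (S.D A) * ‖S.mass i v‖ :=
        (c2 A hA).trans (mul_le_mul_of_nonneg_left ((S.norm_proj_le i u).trans hmu)
          (Real.sqrt_nonneg _))
      have hq : ‖q‖ ≤ Real.sqrt (S.D A) * ‖S.mass i v‖ := by
        refine e4.trans (mul_le_mul_of_nonneg_right (Real.sqrt_le_sqrt ?_) (norm_nonneg _))
        linarith [S.card_le_D hd hA]
      have hgw : S.grad i (u + ∑ j, b j) = p + (q + S.grad i (b i)) := by
        rw [S.grad_congr (hloc i), map_add, ← add_assoc]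
        exact congrArg (· + _) e1
      -- The factor 2 counts the two errors v ∇B and the bubble. Each is at most √D times the
      -- weighted norm of v, which the spectral gap turns into λ^{-1/2}‖∇v‖ because v has zero
      -- projection on this cell.
      have hrest : ‖q + S.grad i (b i)‖ ≤ 2 * Real.sqrt (S.D A) *
          (Real.sqrt ((S.spec i).eigenval (S.l i)))⁻¹ * ‖S.grad i v‖ := by
        refine (norm_add_le _ _).trans ((add_le_add hq hbn).trans ?_)
        have := mul_le_mul_of_nonneg_left hmass (Real.sqrt_nonneg (S.D A))
        linarith
      have e2' : ‖p‖ ≤ ‖S.grad i v‖ := e2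
      have e3' : 0 ≤ inner ℝ (S.grad i v) p := e3
      rw [hgw]
      constructor
      · refine (norm_add_le _ _).trans ?_
        linarith
      · rw [inner_add_right]
        have h5 := abs_real_inner_le_norm (S.grad i v) (q + S.grad i (b i))
        have h6 := neg_abs_le (inner ℝ (S.grad i v) (q + S.grad i (b i)))
        have h7 := mul_le_mul_of_nonneg_left hrest (norm_nonneg (S.grad i v))
        nlinarith

/-- The quasi-projection that removes the first layers around a cell. -/
lemma exists_layer_projection (hd : 0 < d) (i : Fin S.mesh.numCells) (m : ℕ) (v : P.VSub)
    (hv : ∀ j ∈ S.mesh.layer i (m + 1), j ∉ S.mesh.layer i m → S.proj j v = 0) :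
    ∃ w : P.VSub, (∀ j ∈ S.mesh.layer i m, w ∈ S.vanish j) ∧
      (∀ j ∉ S.mesh.layer i (m + 1), w - v ∈ S.vanish j) ∧
      ∀ j ∈ S.mesh.layer i (m + 1), j ∉ S.mesh.layer i m → S.proj j w = 0 ∧ ∀ A, j ∈ A →
          ‖S.grad j w‖ ≤ (1 + 2 * Real.sqrt (S.D A) *
            (Real.sqrt ((S.spec j).eigenval (S.l j)))⁻¹) * ‖S.grad j v‖ ∧
          -(2 * Real.sqrt (S.D A) * (Real.sqrt ((S.spec j).eigenval (S.l j)))⁻¹) *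
            ‖S.grad j v‖ ^ 2 ≤ inner ℝ (S.grad j v) (S.grad j w) := by
  -- J consists of the nodes that touch no cell of the first m layers. A cell has a node outside J
  -- exactly when it belongs to the next layer.
  have hJ : ∀ j, (∃ p ∈ S.mesh.verts j, p ∉ {p | ∀ c ∈ S.mesh.layer i m, p ∉ S.mesh.verts c}) ↔
      j ∈ S.mesh.layer i (m + 1) := fun j => by
    constructor
    · rintro ⟨p, hp, hp'⟩
      simp only [mem_ofPred_eq, not_forall, not_not] at hp'
      obtain ⟨c, hc, hpc⟩ := hp'
      exact ⟨c, hc, p, Finset.mem_inter.2 ⟨hp, hpc⟩⟩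
    · rintro ⟨c, hc, p, hp⟩
      rw [Finset.mem_inter] at hp
      exact ⟨p, hp.1, fun h => h c hc hp.2⟩
  have hJ' : ∀ j ∈ S.mesh.layer i m, ∀ p ∈ S.mesh.verts j,
      p ∉ {p | ∀ c ∈ S.mesh.layer i m, p ∉ S.mesh.verts c} := fun j hj p hp h => h j hj hp
  obtain ⟨w, w1, w2, w3⟩ := S.exists_quasi_projection hd
    {p | ∀ c ∈ S.mesh.layer i m, p ∉ S.mesh.verts c} v (fun j h1 h2 =>
      hv j ((hJ j).1 h2) fun h3 => by
        obtain ⟨p, hp, hp'⟩ := h1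
        exact hJ' j h3 p hp hp')
  refine ⟨w, fun j hj => w1 j (hJ' j hj), fun j hj => w2 j fun p hp => ?_, fun j hj hj' => ?_⟩
  · by_contra h
    exact hj ((hJ j).1 ⟨p, hp, h⟩)
  -- A cell of the new layer may have all its vertices on the old layers. Then the cutoff vanishes
  -- on it and the estimates are trivial.
  · by_cases hmix : ∃ p ∈ S.mesh.verts j, p ∈ {p | ∀ c ∈ S.mesh.layer i m, p ∉ S.mesh.verts c}
    · exact w3 j hmix ((hJ j).2 hj)
    · have hz := w1 j fun p hp h => hmix ⟨p, hp, h⟩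
      refine ⟨S.proj_eq_zero hz, fun A _ => ?_⟩
      rw [S.grad_eq_zero hz, norm_zero, inner_zero_right]
      constructor
      · positivity
      · rw [neg_mul]
        exact neg_nonpos.2 (by positivity)

/-! ### The global energy -/

lemma aForm_eq_sum (v w : P.VSub) :
    aForm P.fluid v w = ∑ i, inner ℝ (S.grad i v) (S.grad i w) := by
  have hv := MemH1.isGrad (P.VSub_le_H1 v.2)
  have hw := MemH1.isGrad (P.VSub_le_H1 w.2)
  have hint : Integrable (fun x => inner ℝ (weakGrad P.fluid v x) (weakGrad P.fluid w x))
      (volume.restrict P.fluid) := by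
    have := L2.integrable_inner (𝕜 := ℝ) hv.memLp_grad.toLp hw.memLp_grad.toLp
    refine this.congr ?_
    filter_upwards [hv.memLp_grad.coeFn_toLp, hw.memLp_grad.coeFn_toLp] with x h1 h2
    rw [h1, h2]
  refine (S.mesh.integral_fluid hint).trans (Finset.sum_congr rfl fun i _ => ?_)
  have h1 := IsGrad.unique (S.mesh.isOpen_elem i) (MemH1.isGrad (S.res i v).2)
    (hv.mono (S.mesh.isOpen_elem i).measurableSet (S.mesh.elem_subset_fluid i))
  have h2 := IsGrad.unique (S.mesh.isOpen_elem i) (MemH1.isGrad (S.res i w).2)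
    (hw.mono (S.mesh.isOpen_elem i).measurableSet (S.mesh.elem_subset_fluid i))
  refine Eq.trans ?_ (inner_gradL (S.mesh.isOpen_elem i) (S.res i v) (S.res i w)).symm
  refine integral_congr_ae ?_
  filter_upwards [h1, h2] with x e1 e2
  rw [e1, e2]

lemma inner_gradAll_eq_sum (v w : P.VSub) :
    inner ℝ (P.gradAll v) (P.gradAll w) = ∑ i, inner ℝ (S.grad i v) (S.grad i w) := by
  rw [P.inner_gradAll, S.aForm_eq_sum]

lemma norm_gradAll_sq (v : P.VSub) : ‖P.gradAll v‖ ^ 2 = ∑ i, ‖S.grad i v‖ ^ 2 := by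
  simp_rw [← real_inner_self_eq_norm_sq, S.inner_gradAll_eq_sum]

lemma Lam_le {A : Set (Fin S.mesh.numCells)} {i : Fin S.mesh.numCells} (hi : i ∈ A) :
    S.Lam A ≤ (S.spec i).eigenval (S.l i) :=
  csInf_le (toFinite _).bddBelow (mem_image_of_mem _ hi)

lemma Lam_pos {A : Set (Fin S.mesh.numCells)} (hA : A.Nonempty) : 0 < S.Lam A := by
  obtain ⟨i, -, hi⟩ := (hA.image fun i => (S.spec i).eigenval (S.l i)).csInf_mem (toFinite _)
  rw [Lam, ← hi]
  exact S.gap i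

lemma Lam_nonneg (A : Set (Fin S.mesh.numCells)) : 0 ≤ S.Lam A := by
  rcases A.eq_empty_or_nonempty with rfl | h
  · simp [Lam]
  · exact (S.Lam_pos h).le

lemma D_pos (hd : 0 < d) {A : Set (Fin S.mesh.numCells)} {i : Fin S.mesh.numCells} (hi : i ∈ A) :
    1 ≤ S.D A := by
  have := S.card_le_D hd hi
  have h5 : (0 : ℝ) ≤ (S.mesh.verts i).card := Nat.cast_nonneg _
  linarith

/-! ### Localized minimizers -/

/-- A function supported in `m` layers around the cell `i`, whose projections onto the auxiliary
spaces vanish away from `i`, and which is `a`-orthogonal to the kernel of the projections. -/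
structure IsLocalized (i : Fin S.mesh.numCells) (m : ℕ) (ψ : P.VSub) : Prop where
  vanish : ∀ j ∉ S.mesh.layer i m, ψ ∈ S.vanish j
  proj : ∀ j ≠ i, S.proj j ψ = 0
  orthogonal : ∀ w : P.VSub, (∀ j ∉ S.mesh.layer i m, w ∈ S.vanish j) → (∀ j, S.proj j w = 0) →
    inner ℝ (P.gradAll ψ) (P.gradAll w) = 0

variable {S} {i : Fin S.mesh.numCells} {k : ℕ} {ψ : P.VSub}

/-- Compare with the bubble lift b of the coefficients of ψ: the difference ψ − b is an admissible
variation, so ‖ψ‖_a² = a(ψ, b) ≤ ‖ψ‖_a ‖b‖_a. -/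
lemma IsLocalized.energy_le (hd : 0 < d) (h : S.IsLocalized i k ψ) :
    ‖P.gradAll ψ‖ ^ 2 ≤ S.D (S.mesh.layer i k) * ‖S.proj i ψ‖ ^ 2 := by
  obtain ⟨b, b1, b2, b3⟩ := S.exists_bubble_lift hd i (S.proj i ψ)
  have hi := S.mesh.self_mem_layer i k
  have b4 := b3 _ hi
  have hb : ‖P.gradAll b‖ = ‖S.grad i b‖ := by
    rw [← sq_eq_sq₀ (norm_nonneg _) (norm_nonneg _), S.norm_gradAll_sq]
    refine Finset.sum_eq_single i (fun j _ hj => ?_) (by simp)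
    rw [S.grad_eq_zero (b1 j hj)]
    simp
  have h1 := h.orthogonal (ψ - b) (fun j hj => Submodule.sub_mem _ (h.vanish j hj)
    (b1 j fun hji => hj (hji ▸ hi))) (fun j => by
      rw [map_sub]
      by_cases hj : j = i
      · subst hj; rw [b2, sub_self]
      · rw [h.proj j hj, S.proj_eq_zero (b1 j hj), sub_self])
  rw [map_sub, inner_sub_right, real_inner_self_eq_norm_sq] at h1
  have h2 := real_inner_le_norm (P.gradAll ψ) (P.gradAll b)
  have h3 : ‖P.gradAll ψ‖ ≤ Real.sqrt (S.D (S.mesh.layer i k)) * ‖S.proj i ψ‖ := by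
    rcases (norm_nonneg (P.gradAll ψ)).eq_or_lt with h0 | h0
    · rw [← h0]; positivity
    · refine le_trans (le_of_mul_le_mul_left ?_ h0) (hb ▸ b4)
      nlinarith
  calc ‖P.gradAll ψ‖ ^ 2 ≤ (Real.sqrt (S.D (S.mesh.layer i k)) * ‖S.proj i ψ‖) ^ 2 :=
        pow_le_pow_left₀ (norm_nonneg _) h3 2
    _ = _ := by
        rw [mul_pow, Real.sq_sqrt (zero_le_one.trans (S.D_pos hd hi))]

open Classical in
/-- The energy outside the first `m` layers around the cell `i`. -/
def outerEnergy (S : Discretization P) (i : Fin S.mesh.numCells) (ψ : P.VSub) (m : ℕ) : ℝ :=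
  ∑ j, if j ∈ S.mesh.layer i m then 0 else ‖S.grad j ψ‖ ^ 2

/-- Test the orthogonality of ψ with ψ cut off on the first m layers. The cells beyond layer m + 1
give their full energy and the cells in between at least −r times theirs, so with F_m for the energy
outside m layers, F_{m+1} ≤ r (F_m − F_{m+1}), which is (1 + 1/r) F_{m+1} ≤ F_m. -/
lemma IsLocalized.decay_step (hd : 0 < d) (h : S.IsLocalized i k ψ) {m n : ℕ} (hm : m + 1 ≤ n)
    (hn : n ≤ k) :
    (1 + Real.sqrt (S.Lam (S.mesh.layer i n)) / (2 * Real.sqrt (S.D (S.mesh.layer i n)))) *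
      outerEnergy S i ψ (m + 1) ≤ outerEnergy S i ψ m := by
  classical
  set A := S.mesh.layer i n with hA
  have hi := S.mesh.self_mem_layer i m
  have hmA : S.mesh.layer i (m + 1) ⊆ A := S.mesh.layer_mono i hm
  have hmk : S.mesh.layer i (m + 1) ⊆ S.mesh.layer i k := S.mesh.layer_mono i (hm.trans hn)
  have hD : 0 < Real.sqrt (S.D A) :=
    Real.sqrt_pos.2 (zero_lt_one.trans_le (S.D_pos hd (S.mesh.self_mem_layer i n)))
  have hΛ : 0 < Real.sqrt (S.Lam A) := Real.sqrt_pos.2 (S.Lam_pos ⟨i, S.mesh.self_mem_layer i n⟩)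
  obtain ⟨w, w1, w2, w3⟩ := S.exists_layer_projection hd i m ψ fun j _ hj' =>
    h.proj j fun hji => hj' (hji ▸ hi)
  have h0 := h.orthogonal w (fun j hj => by
      have := Submodule.add_mem _ (w2 j fun h1 => hj (hmk h1)) (h.vanish j hj)
      rwa [sub_add_cancel] at this) (fun j => by
      by_cases hj : j ∈ S.mesh.layer i m
      · exact S.proj_eq_zero (w1 j hj)
      · by_cases hj' : j ∈ S.mesh.layer i (m + 1)
        · exact (w3 j hj' hj).1
        · rw [S.proj_congr (w2 j hj')]
          exact h.proj j fun hji => hj (hji ▸ hi))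
  rw [S.inner_gradAll_eq_sum] at h0
  -- The quasi-projection constant for the smallest eigenvalue in A; its inverse is the quotient in
  -- the decay factor.
  set r := 2 * Real.sqrt (S.D A) * (Real.sqrt (S.Lam A))⁻¹ with hr
  have hterm : ∀ j, (1 + r) * (if j ∈ S.mesh.layer i (m + 1) then 0 else ‖S.grad j ψ‖ ^ 2) -
      r * (if j ∈ S.mesh.layer i m then 0 else ‖S.grad j ψ‖ ^ 2) ≤
      inner ℝ (S.grad j ψ) (S.grad j w) := fun j => by
    by_cases hj : j ∈ S.mesh.layer i m
    · rw [if_pos hj, if_pos (S.mesh.layer_subset_succ i m hj), S.grad_eq_zero (w1 j hj)]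
      simp
    · by_cases hj' : j ∈ S.mesh.layer i (m + 1)
      · rw [if_pos hj', if_neg hj]
        refine le_trans ?_ ((w3 j hj' hj).2 A (hmA hj')).2
        rw [mul_zero, zero_sub, neg_mul]
        refine neg_le_neg (mul_le_mul_of_nonneg_right ?_ (sq_nonneg _))
        refine mul_le_mul_of_nonneg_left ?_ (by positivity)
        exact inv_anti₀ hΛ (Real.sqrt_le_sqrt (S.Lam_le (hmA hj')))
      · rw [if_neg hj', if_neg hj, S.grad_congr (w2 j hj'), real_inner_self_eq_norm_sq]
        exact le_of_eq (by ring)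
  have hsum := Finset.sum_le_sum fun j (_ : j ∈ Finset.univ) => hterm j
  rw [h0, Finset.sum_sub_distrib, ← Finset.mul_sum, ← Finset.mul_sum] at hsum
  change (1 + r) * outerEnergy S i ψ (m + 1) - r * outerEnergy S i ψ m ≤ 0 at hsum
  have hr0 : 0 < r := by positivity
  have hrt : Real.sqrt (S.Lam A) / (2 * Real.sqrt (S.D A)) = r⁻¹ := by
    rw [hr, mul_inv, inv_inv, div_eq_mul_inv, mul_comm]
  rw [hrt]
  have h5 : (1 + r⁻¹) * outerEnergy S i ψ (m + 1) = r⁻¹ * ((1 + r) * outerEnergy S i ψ (m + 1)) := by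
    field_simp
    ring
  rw [h5]
  calc r⁻¹ * ((1 + r) * outerEnergy S i ψ (m + 1)) ≤ r⁻¹ * (r * outerEnergy S i ψ m) :=
        mul_le_mul_of_nonneg_left (by linarith) (by positivity)
    _ = _ := by rw [← mul_assoc, inv_mul_cancel₀ hr0.ne', one_mul]

/-- Every step m + 1 ≤ n may use the constants of the fixed region with n layers, so the steps
multiply to a power. -/
lemma IsLocalized.decay (hd : 0 < d) (h : S.IsLocalized i k ψ) {n : ℕ} (hn : n ≤ k) :
    outerEnergy S i ψ n ≤ (1 + Real.sqrt (S.Lam (S.mesh.layer i n)) /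
      (2 * Real.sqrt (S.D (S.mesh.layer i n)))) ^ (-(n : ℤ)) * ‖P.gradAll ψ‖ ^ 2 := by
  set q := 1 + Real.sqrt (S.Lam (S.mesh.layer i n)) / (2 * Real.sqrt (S.D (S.mesh.layer i n)))
    with hq
  have hq0 : 0 < q := by positivity
  have key : ∀ m, m ≤ n → q ^ m * outerEnergy S i ψ m ≤ outerEnergy S i ψ 0 := fun m => by
    induction m with
    | zero => intro _; simp
    | succ m ih =>
      intro hm
      refine le_trans ?_ (ih (by omega))
      rw [pow_succ, mul_assoc]
      exact mul_le_mul_of_nonneg_left (h.decay_step hd hm hn) (by positivity)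
  have h0 : outerEnergy S i ψ 0 ≤ ‖P.gradAll ψ‖ ^ 2 := by
    rw [S.norm_gradAll_sq]
    refine Finset.sum_le_sum fun j _ => ?_
    split_ifs
    · positivity
    · exact le_rfl
  rw [zpow_neg, zpow_natCast, ← div_eq_inv_mul, le_div_iff₀ (by positivity), mul_comm]
  exact (key n le_rfl).trans h0

open Classical in
/-- The energy of a localized minimizer against a function with vanishing projections. -/
lemma IsLocalized.inner_le (hd : 0 < d) (h : S.IsLocalized i (S.k i) ψ) {e : P.VSub}
    (he : ∀ j, S.proj j e = 0) :
    inner ℝ (P.gradAll ψ) (P.gradAll e) ^ 2 ≤ S.decay i * ‖S.proj i ψ‖ ^ 2 *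
      ∑ j, if j ∈ S.mesh.layer i (S.k i) then ‖S.grad j e‖ ^ 2 else 0 := by
  obtain ⟨n, hn⟩ : ∃ n, S.k i = n + 1 := ⟨S.k i - 1, by have := S.two_le_k i; omega⟩
  have hdec : S.decay i = 8 * S.D (S.mesh.layer i (n + 1)) ^ 2 *
      (1 + (S.Lam (S.mesh.layer i n)ᶜ)⁻¹) * (1 + Real.sqrt (S.Lam (S.mesh.layer i n)) /
      (2 * Real.sqrt (S.D (S.mesh.layer i n)))) ^ (-(n : ℤ)) := by
    rw [Discretization.decay, hn, Nat.add_sub_cancel]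
    congr 2
    push_cast
    ring
  rw [hn] at h ⊢
  -- With n = k_i − 1, the function e − w is supported in the k_i layers and has zero projections,
  -- so a(ψ, e) = a(ψ, w). The product of ∇ψ and ∇w lives on the last layer only, where ψ has
  -- decayed n times.
  obtain ⟨w, w1, w2, w3⟩ := S.exists_layer_projection hd i n e fun j _ _ => he j
  have h0 := h.orthogonal (e - w) (fun j hj => by
      have := Submodule.neg_mem _ (w2 j hj)
      rwa [neg_sub] at this) (fun j => by
      rw [map_sub, he j, zero_sub, neg_eq_zero]
      by_cases hj : j ∈ S.mesh.layer i n
      · exact S.proj_eq_zero (w1 j hj)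
      · by_cases hj' : j ∈ S.mesh.layer i (n + 1)
        · exact (w3 j hj' hj).1
        · rw [S.proj_congr (w2 j hj'), he j])
  rw [map_sub, inner_sub_right, sub_eq_zero] at h0
  set D := S.D (S.mesh.layer i (n + 1)) with hD
  set Λ := (S.Lam (S.mesh.layer i n)ᶜ)⁻¹ with hΛ
  have hΛ0 : 0 ≤ Λ := inv_nonneg.2 (S.Lam_nonneg _)
  have hi := S.mesh.self_mem_layer i (n + 1)
  have hD1 : 1 ≤ D := S.D_pos hd hi
  have hen := h.energy_le hd
  have hdecay := h.decay hd (Nat.le_succ n)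
  -- The square of the quasi-projection bound: (1 + 2√(DΛ))² ≤ 2 + 8DΛ ≤ 8D(1 + Λ), where Λ now
  -- denotes the inverse eigenvalue bound. The second factor D of E_i comes from the energy of ψ.
  set Q := 8 * D * (1 + Λ) with hQ
  have hQ0 : 0 ≤ Q := by positivity
  have hterm : ∀ j, |inner ℝ (S.grad j ψ) (S.grad j w)| ≤
      Real.sqrt Q * ((if j ∈ S.mesh.layer i n then 0 else ‖S.grad j ψ‖) *
        (if j ∈ S.mesh.layer i (n + 1) then ‖S.grad j e‖ else 0)) := fun j => by
    by_cases hj : j ∈ S.mesh.layer i n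
    · rw [S.grad_eq_zero (w1 j hj), if_pos hj]; simp
    · by_cases hj' : j ∈ S.mesh.layer i (n + 1)
      · rw [if_neg hj, if_pos hj']
        refine (abs_real_inner_le_norm _ _).trans ?_
        have h1 := ((w3 j hj' hj).2 _ hj').1
        rw [← hD] at h1
        have h2 : 1 + 2 * Real.sqrt D * (Real.sqrt ((S.spec j).eigenval (S.l j)))⁻¹ ≤ Real.sqrt Q := by
          have h3 : (Real.sqrt ((S.spec j).eigenval (S.l j)))⁻¹ ≤ Real.sqrt Λ := by
            rw [hΛ, Real.sqrt_inv]
            exact inv_anti₀ (Real.sqrt_pos.2 (S.Lam_pos ⟨j, hj⟩))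
              (Real.sqrt_le_sqrt (S.Lam_le hj))
          refine (add_le_add_right (mul_le_mul_of_nonneg_left h3 (by positivity)) 1).trans ?_
          refine Real.le_sqrt_of_sq_le ?_
          have a1 := Real.sq_sqrt (zero_le_one.trans hD1)
          have a2 := Real.sq_sqrt hΛ0
          have a3 : (2 * Real.sqrt D * Real.sqrt Λ) ^ 2 = 4 * (D * Λ) := by
            rw [mul_pow, mul_pow, a1, a2]; ring
          have a4 : 0 ≤ D * Λ := by positivity
          rw [hQ]
          nlinarith [sq_nonneg (2 * Real.sqrt D * Real.sqrt Λ - 1)]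
        calc ‖S.grad j ψ‖ * ‖S.grad j w‖ ≤ ‖S.grad j ψ‖ * (Real.sqrt Q * ‖S.grad j e‖) :=
              mul_le_mul_of_nonneg_left (h1.trans (mul_le_mul_of_nonneg_right h2 (norm_nonneg _)))
                (norm_nonneg _)
          _ = _ := by ring
      · rw [S.grad_eq_zero (h.vanish j hj'), inner_zero_left, abs_zero]
        positivity
  have hsum : |inner ℝ (P.gradAll ψ) (P.gradAll e)| ≤ Real.sqrt Q *
      ∑ j, ((if j ∈ S.mesh.layer i n then 0 else ‖S.grad j ψ‖) *
        (if j ∈ S.mesh.layer i (n + 1) then ‖S.grad j e‖ else 0)) := by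
    rw [h0, S.inner_gradAll_eq_sum, Finset.mul_sum]
    exact (Finset.abs_sum_le_sum_abs _ _).trans (Finset.sum_le_sum fun j _ => hterm j)
  have hcs := Finset.sum_mul_sq_le_sq_mul_sq Finset.univ
    (fun j => if j ∈ S.mesh.layer i n then 0 else ‖S.grad j ψ‖)
    (fun j => if j ∈ S.mesh.layer i (n + 1) then ‖S.grad j e‖ else 0)
  have e1 : ∑ j, (if j ∈ S.mesh.layer i n then 0 else ‖S.grad j ψ‖) ^ 2 = outerEnergy S i ψ n :=
    Finset.sum_congr rfl fun j _ => by split_ifs <;> simp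
  have e2 : ∑ j, (if j ∈ S.mesh.layer i (n + 1) then ‖S.grad j e‖ else 0) ^ 2 =
      ∑ j, if j ∈ S.mesh.layer i (n + 1) then ‖S.grad j e‖ ^ 2 else 0 :=
    Finset.sum_congr rfl fun j _ => by split_ifs <;> simp
  rw [e1, e2] at hcs
  set Y := ∑ j, if j ∈ S.mesh.layer i (n + 1) then ‖S.grad j e‖ ^ 2 else 0 with hY
  have hY0 : 0 ≤ Y := Finset.sum_nonneg fun j _ => by split_ifs <;> positivity
  set t := (1 + Real.sqrt (S.Lam (S.mesh.layer i n)) /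
      (2 * Real.sqrt (S.D (S.mesh.layer i n)))) ^ (-(n : ℤ)) with ht
  have ht0 : 0 ≤ t := by positivity
  calc inner ℝ (P.gradAll ψ) (P.gradAll e) ^ 2 = |inner ℝ (P.gradAll ψ) (P.gradAll e)| ^ 2 :=
        (sq_abs _).symm
    _ ≤ (Real.sqrt Q * _) ^ 2 := pow_le_pow_left₀ (abs_nonneg _) hsum 2
    _ = Q * _ := by rw [mul_pow, Real.sq_sqrt hQ0]
    _ ≤ Q * (outerEnergy S i ψ n * Y) := mul_le_mul_of_nonneg_left hcs hQ0
    _ ≤ Q * (t * (D * ‖S.proj i ψ‖ ^ 2) * Y) := by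
        refine mul_le_mul_of_nonneg_left (mul_le_mul_of_nonneg_right ?_ hY0) hQ0
        exact hdecay.trans (mul_le_mul_of_nonneg_left hen ht0)
    _ = _ := by rw [hdec, hQ]; ring

lemma decay_nonneg (S : Discretization P) (i : Fin S.mesh.numCells) : 0 ≤ S.decay i := by
  have h1 : 0 ≤ (S.Lam (S.mesh.layer i (S.k i - 1))ᶜ)⁻¹ := inv_nonneg.2 (S.Lam_nonneg _)
  unfold decay
  positivity

end Discretization

/-! ### `L²` norms -/

lemma l2norm_eq_norm {U : Set (E d)} {f : E d → ℝ} (hf : MemLp f 2 (volume.restrict U)) :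
    l2norm U f = ‖hf.toLp‖ := by
  have h := inner_toLp hf hf
  rw [real_inner_self_eq_norm_sq] at h
  have h2 : ∫ x in U, inner ℝ (f x) (f x) = ∫ x in U, f x ^ 2 :=
    integral_congr_ae (Filter.Eventually.of_forall fun x => by simp [sq])
  rw [l2norm, ← h2, ← h, Real.sqrt_sq (norm_nonneg _)]

lemma l2norm_nonneg (U : Set (E d)) (f : E d → ℝ) : 0 ≤ l2norm U f := Real.sqrt_nonneg _

lemma abs_integral_mul_le {U : Set (E d)} {f g : E d → ℝ} (hf : MemLp f 2 (volume.restrict U))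
    (hg : MemLp g 2 (volume.restrict U)) :
    |∫ x in U, f x * g x| ≤ l2norm U f * l2norm U g := by
  have h2 : ∫ x in U, f x * g x = inner ℝ hf.toLp hg.toLp := by
    rw [inner_toLp]
    exact integral_congr_ae (Filter.Eventually.of_forall fun x => by simp [mul_comm])
  rw [h2, l2norm_eq_norm hf, l2norm_eq_norm hg]
  exact abs_real_inner_le_norm _ _

namespace PerforatedDomain
variable (P : PerforatedDomain d)

lemma IsGalerkin.inner_eq {P : PerforatedDomain d} {W : Submodule ℝ (E d → ℝ)} {f : E d → ℝ}
    {u v : P.VSub} (h : P.IsGalerkin W f u) (hv : (v : E d → ℝ) ∈ W) :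
    inner ℝ (P.gradAll u) (P.gradAll v) = ∫ x in P.fluid, f x * (v : E d → ℝ) x := by
  rw [inner_gradAll]
  exact h.2 _ hv

/-- The Galerkin solution is the best approximation. -/
lemma IsGalerkin.norm_sub_le {P : PerforatedDomain d} {W : Submodule ℝ (E d → ℝ)} {f : E d → ℝ}
    {u u' v : P.VSub} (hu : P.IsGalerkin P.VSub f u) (hu' : P.IsGalerkin W f u')
    (hv : (v : E d → ℝ) ∈ W) :
    ‖P.gradAll (u - u')‖ ≤ ‖P.gradAll (u - v)‖ := by
  have h1 : inner ℝ (P.gradAll (u - u')) (P.gradAll (u' - v)) = 0 := by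
    rw [map_sub, inner_sub_left, hu.inner_eq (u' - v).2, hu'.inner_eq (W.sub_mem hu'.1 hv), sub_self]
  have h2 : P.gradAll (u - v) = P.gradAll (u - u') + P.gradAll (u' - v) := by
    rw [← map_add, sub_add_sub_cancel]
  have h3 := norm_add_sq_real (P.gradAll (u - u')) (P.gradAll (u' - v))
  rw [h1, ← h2] at h3
  exact le_of_sq_le_sq (by nlinarith [sq_nonneg ‖P.gradAll (u' - v)‖]) (norm_nonneg _)

end PerforatedDomain

namespace Discretization
variable {P : PerforatedDomain d} (S : Discretization P)

lemma isWeight_fluid : IsWeight P.fluid S.pou.κ := by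
  obtain ⟨C, -, hC⟩ := S.pou.exists_weight_le
  exact ⟨S.pou.measurable_κ, S.pou.κ_nonneg, C, S.mesh.ae_fluid_iff.2 fun i =>
    ae_restrict_of_forall_mem (S.mesh.isOpen_elem i).measurableSet (hC i)⟩

lemma sNorm_sq (v : P.VSub) : S.sNorm v ^ 2 = ∑ i, ‖S.mass i v‖ ^ 2 := by
  have hv := (P.VSub_le_H1 v.2).1
  have hm := S.isWeight_fluid.memLp hv
  have hint : Integrable (fun x => S.pou.κ x * (v : E d → ℝ) x * (v : E d → ℝ) x)
      (volume.restrict P.fluid) := by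
    refine (integrable_mul_of_memLp hm hm).congr (Filter.Eventually.of_forall fun x => ?_)
    have := Real.mul_self_sqrt (S.pou.κ_nonneg x)
    simp only
    linear_combination (v : E d → ℝ) x * (v : E d → ℝ) x * this
  rw [sNorm, Real.sq_sqrt]
  · refine (S.mesh.integral_fluid hint).trans (Finset.sum_congr rfl fun i _ => ?_)
    rw [← real_inner_self_eq_norm_sq]
    exact (inner_weightL (S.pou.isWeight i) (Submodule.inclusion (H1_le_L2Sub _) (S.res i v))
      (Submodule.inclusion (H1_le_L2Sub _) (S.res i v))).symm
  · refine integral_nonneg fun x => ?_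
    have := S.pou.κ_nonneg x
    simp only [Pi.zero_apply, mul_assoc]
    exact mul_nonneg this (mul_self_nonneg _)

lemma sNorm_nonneg (v : E d → ℝ) : 0 ≤ S.sNorm v := Real.sqrt_nonneg _

lemma memLp_scaled {f : E d → ℝ} (hf : MemLp f 2 (volume.restrict P.fluid)) :
    MemLp (S.scaled f) 2 (volume.restrict P.fluid) := by
  obtain ⟨κ₀, h0, h⟩ := S.pou.exists_le_weight
  refine hf.of_le_mul (c := κ₀ ^ (-(1 / 2) : ℝ))
    ((S.pou.measurable_κ.pow_const _).aestronglyMeasurable.mul hf.1) ?_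
  filter_upwards [S.mesh.ae_fluid_iff.2 h] with x hx
  rw [scaled, norm_mul, Real.norm_of_nonneg (Real.rpow_nonneg (S.pou.κ_nonneg x) _)]
  exact mul_le_mul_of_nonneg_right
    (Real.rpow_le_rpow_of_nonpos h0 hx (by norm_num)) (norm_nonneg _)

/-- Cauchy–Schwarz after writing f v as κ̃^{-1/2} f times κ̃^{1/2} v. -/
lemma load_le {f : E d → ℝ} (hf : MemLp f 2 (volume.restrict P.fluid)) (v : P.VSub) :
    |∫ x in P.fluid, f x * (v : E d → ℝ) x| ≤ l2norm P.fluid (S.scaled f) * S.sNorm v := by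
  have hv := (P.VSub_le_H1 v.2).1
  have hm := S.isWeight_fluid.memLp hv
  obtain ⟨κ₀, h0, h⟩ := S.pou.exists_le_weight
  have h1 : ∫ x in P.fluid, f x * (v : E d → ℝ) x =
      ∫ x in P.fluid, S.scaled f x * (Real.sqrt (S.pou.κ x) * (v : E d → ℝ) x) := by
    refine integral_congr_ae ?_
    filter_upwards [S.mesh.ae_fluid_iff.2 h] with x hx
    have hκ := h0.trans_le hx
    have : S.pou.κ x ^ (-(1 / 2) : ℝ) * Real.sqrt (S.pou.κ x) = 1 := by
      rw [Real.sqrt_eq_rpow, ← Real.rpow_add hκ]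
      norm_num
    rw [scaled]
    linear_combination -(f x * (v : E d → ℝ) x) * this
  have h2 : S.sNorm v = l2norm P.fluid fun x => Real.sqrt (S.pou.κ x) * (v : E d → ℝ) x := by
    rw [sNorm, l2norm, sForm]
    congr 1
    refine integral_congr_ae (Filter.Eventually.of_forall fun x => ?_)
    have := Real.mul_self_sqrt (S.pou.κ_nonneg x)
    simp only
    linear_combination -(v : E d → ℝ) x * (v : E d → ℝ) x * this
  rw [h1, h2]
  exact abs_integral_mul_le (S.memLp_scaled hf) hm

lemma sNorm_le_grad {w : P.VSub} (h : ∀ i, S.proj i w = 0) :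
    S.sNorm w ≤ (Real.sqrt (S.Lam univ))⁻¹ * ‖P.gradAll w‖ := by
  refine le_of_sq_le_sq ?_ (by positivity)
  rw [sNorm_sq, mul_pow, S.norm_gradAll_sq, Finset.mul_sum]
  refine Finset.sum_le_sum fun i _ => ?_
  rw [← mul_pow]
  refine pow_le_pow_left₀ (norm_nonneg _) ((S.mass_le_grad (h i)).trans ?_) 2
  refine mul_le_mul_of_nonneg_right ?_ (norm_nonneg _)
  exact inv_anti₀ (Real.sqrt_pos.2 (S.Lam_pos ⟨i, mem_univ _⟩))
    (Real.sqrt_le_sqrt (S.Lam_le (mem_univ i)))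

/-! ### The basis functions -/

lemma proj_apply (i : Fin S.mesh.numCells) (v : P.VSub) (j : Fin (S.l i)) :
    S.proj i v j = sForm S.pou.κ (S.mesh.elem i) v ((S.spec i).eigenfun j) :=
  (S.spec i).coef_apply _ _ _

variable {S}

lemma IsOrthogonal.proj_self {i : Fin S.mesh.numCells} {j : Fin (S.l i)} {ψ : P.VSub}
    (h : S.IsOrthogonal i j ψ) : S.proj i ψ = EuclideanSpace.single j 1 := by
  ext j'
  rw [proj_apply, h]
  simp [Fin.ext_iff]

lemma IsOrthogonal.proj_of_ne {i i' : Fin S.mesh.numCells} {j : Fin (S.l i)} {ψ : P.VSub}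
    (h : S.IsOrthogonal i j ψ) (hi : i' ≠ i) : S.proj i' ψ = 0 := by
  ext j'
  rw [proj_apply, h]
  simp [hi]

lemma IsOrthogonal.add {i : Fin S.mesh.numCells} {j : Fin (S.l i)} {ψ w : P.VSub}
    (h : S.IsOrthogonal i j ψ) (hw : ∀ i, S.proj i w = 0) :
    S.IsOrthogonal i j ((ψ + w : P.VSub) : E d → ℝ) := fun i' j' => by
  rw [← proj_apply, map_add, hw, add_zero, proj_apply, h]

/-- The Euler–Lagrange equation. The energy increment along ψ + t w is a nonnegative quadratic
polynomial in t without constant term, so its discriminant forces the linear coefficient to vanish.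
-/
lemma IsEnergyMin.inner_eq_zero {A : Set (E d)} {i : Fin S.mesh.numCells} {j : Fin (S.l i)}
    {ψ w : P.VSub} (h : S.IsEnergyMin (P.V0 A) i j ψ) (hw : (w : E d → ℝ) ∈ P.V0 A)
    (hp : ∀ i, S.proj i w = 0) : inner ℝ (P.gradAll ψ) (P.gradAll w) = 0 := by
  have h1 : ∀ t : ℝ, 0 ≤ ‖P.gradAll w‖ ^ 2 * (t * t) +
      (2 * inner ℝ (P.gradAll ψ) (P.gradAll w)) * t + 0 := fun t => by
    have h2 := h.2 (ψ + t • w : P.VSub) ((P.V0Sub A).add_mem h.1.1 ((P.V0Sub A).smul_mem t hw))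
      (h.1.2.add fun i => by rw [map_smul, hp, smul_zero])
    rw [← P.inner_gradAll, ← P.inner_gradAll, real_inner_self_eq_norm_sq,
      real_inner_self_eq_norm_sq, map_add, map_smul, norm_add_sq_real, norm_smul, inner_smul_right,
      mul_pow, Real.norm_eq_abs, sq_abs] at h2
    linarith
  have h3 := discrim_le_zero h1
  rw [discrim] at h3
  nlinarith

variable (S) in
/-- The linear combination of basis functions with given coefficients. -/
def combine (ψ : ∀ i, Fin (S.l i) → P.VSub) (c : ∀ i, EuclideanSpace ℝ (Fin (S.l i)))
    (i : Fin S.mesh.numCells) : P.VSub := ∑ j, c i j • ψ i j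

section
variable {ψ : ∀ i, Fin (S.l i) → P.VSub} (c : ∀ i, EuclideanSpace ℝ (Fin (S.l i)))

lemma proj_combine_self (h : ∀ i j, S.IsOrthogonal i j (ψ i j)) (i : Fin S.mesh.numCells) :
    S.proj i (S.combine ψ c i) = c i := by
  rw [combine, map_sum]
  simp_rw [map_smul, (h i _).proj_self]
  ext j
  simp [Finset.sum_apply, Pi.single_apply]

lemma proj_combine_of_ne (h : ∀ i j, S.IsOrthogonal i j (ψ i j)) {i i' : Fin S.mesh.numCells}
    (hi : i' ≠ i) : S.proj i' (S.combine ψ c i) = 0 := by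
  rw [combine, map_sum]
  refine Finset.sum_eq_zero fun j _ => ?_
  rw [map_smul, (h i j).proj_of_ne hi, smul_zero]

lemma proj_sum_combine (h : ∀ i j, S.IsOrthogonal i j (ψ i j)) (i : Fin S.mesh.numCells) :
    S.proj i (∑ i', S.combine ψ c i') = c i := by
  rw [map_sum, Finset.sum_eq_single i (fun i' _ hi' => proj_combine_of_ne c h hi'.symm) (by simp),
    proj_combine_self c h]

lemma sum_combine_mem_spanOf :
    ((∑ i, S.combine ψ c i : P.VSub) : E d → ℝ) ∈ S.spanOf fun i j => ψ i j := by
  rw [Submodule.coe_sum]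
  refine Submodule.sum_mem _ fun i _ => ?_
  rw [combine, Submodule.coe_sum]
  exact Submodule.sum_mem _ fun j _ => Submodule.smul_mem _ _ (Submodule.subset_span ⟨i, j, rfl⟩)

/-- The decay estimate is applied to the whole combination of a cell and not to single basis
functions; thus the numbers l_i do not enter the constants. -/
lemma isLocalized_combine (h : S.IsMsBasis fun i j => ψ i j) (i : Fin S.mesh.numCells) :
    S.IsLocalized i (S.k i) (S.combine ψ c i) where
  vanish j hj := Submodule.sum_mem _ fun j' _ => Submodule.smul_mem _ _
    ((S.mesh.mem_V0_region_iff.1 (h i j').1.1).2 j hj)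
  proj j hj := proj_combine_of_ne c (fun i j => (h i j).1.2) hj
  orthogonal w h1 h2 := by
    rw [combine, map_sum, sum_inner]
    refine Finset.sum_eq_zero fun j _ => ?_
    rw [map_smul, inner_smul_left,
      (h i j).inner_eq_zero (S.mesh.mem_V0_region_iff.2 ⟨w.2, h1⟩) h2, mul_zero]

lemma inner_eq_zero_of_mem_spanOf (h : S.IsGloBasis fun i j => ψ i j) {v w : P.VSub}
    (hv : (v : E d → ℝ) ∈ S.spanOf fun i j => ψ i j) (hw : ∀ i, S.proj i w = 0) :
    inner ℝ (P.gradAll v) (P.gradAll w) = 0 := by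
  have key : S.spanOf (fun i j => ψ i j) ≤
      (LinearMap.ker (((innerₗ _).flip (P.gradAll w)) ∘ₗ P.gradAll)).map P.VSub.subtype := by
    refine Submodule.span_le.2 ?_
    rintro _ ⟨i, j, rfl⟩
    exact ⟨ψ i j, (h i j).inner_eq_zero w.2 hw, rfl⟩
  obtain ⟨v', h1, h2⟩ := key hv
  rwa [← Subtype.ext h2]

-- Cauchy–Schwarz over the cells i, where the energies of e on the regions K_{i,k_i} add up to at
-- most N times the whole energy, N being the overlap number.
open Classical in
lemma abs_inner_combine_le (hd : 0 < d) (h : S.IsMsBasis fun i j => ψ i j) {e : P.VSub}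
    (he : ∀ i, S.proj i e = 0) {N : ℝ}
    (hN : ∀ j, ((Finset.univ.filter fun i => j ∈ S.mesh.layer i (S.k i)).card : ℝ) ≤ N) :
    |inner ℝ (P.gradAll (∑ i, S.combine ψ c i)) (P.gradAll e)| ≤
      Real.sqrt S.maxDecay * Real.sqrt N * Real.sqrt (∑ i, ‖c i‖ ^ 2) * ‖P.gradAll e‖ := by
  set Y : Fin S.mesh.numCells → ℝ := fun i =>
    ∑ j, if j ∈ S.mesh.layer i (S.k i) then ‖S.grad j e‖ ^ 2 else 0 with hY
  have hY0 : ∀ i, 0 ≤ Y i := fun i => Finset.sum_nonneg fun j _ => by split_ifs <;> positivity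
  have hYsum : ∑ i, Y i ≤ N * ‖P.gradAll e‖ ^ 2 := by
    rw [hY, Finset.sum_comm, S.norm_gradAll_sq, Finset.mul_sum]
    refine Finset.sum_le_sum fun j _ => ?_
    rw [← Finset.sum_filter, Finset.sum_const, nsmul_eq_mul]
    exact mul_le_mul_of_nonneg_right (hN j) (sq_nonneg _)
  have hterm : ∀ i, |inner ℝ (P.gradAll (S.combine ψ c i)) (P.gradAll e)| ≤
      Real.sqrt S.maxDecay * (‖c i‖ * Real.sqrt (Y i)) := fun i => by
    have h1 := (isLocalized_combine c h i).inner_le hd he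
    rw [proj_combine_self c fun i j => (h i j).1.2] at h1
    have h2 : S.decay i ≤ S.maxDecay := le_ciSup (f := S.decay) (finite_range _).bddAbove i
    have h3 := (S.decay_nonneg i).trans h2
    refine abs_le_of_sq_le_sq (h1.trans ?_) (by positivity)
    rw [mul_pow, mul_pow, Real.sq_sqrt h3, Real.sq_sqrt (hY0 i), mul_assoc]
    exact mul_le_mul_of_nonneg_right h2 (mul_nonneg (sq_nonneg _) (hY0 i))
  have hcs := Real.sum_mul_le_sqrt_mul_sqrt Finset.univ (fun i => ‖c i‖) fun i => Real.sqrt (Y i)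
  simp_rw [Real.sq_sqrt (hY0 _)] at hcs
  rw [map_sum, sum_inner]
  calc |∑ i, inner ℝ (P.gradAll (S.combine ψ c i)) (P.gradAll e)|
      ≤ ∑ i, Real.sqrt S.maxDecay * (‖c i‖ * Real.sqrt (Y i)) :=
        (Finset.abs_sum_le_sum_abs _ _).trans (Finset.sum_le_sum fun i _ => hterm i)
    _ = Real.sqrt S.maxDecay * ∑ i, ‖c i‖ * Real.sqrt (Y i) := (Finset.mul_sum ..).symm
    _ ≤ Real.sqrt S.maxDecay * (Real.sqrt (∑ i, ‖c i‖ ^ 2) *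
          (Real.sqrt N * ‖P.gradAll e‖)) := by
        refine mul_le_mul_of_nonneg_left (hcs.trans (mul_le_mul_of_nonneg_left ?_
          (Real.sqrt_nonneg _))) (Real.sqrt_nonneg _)
        refine (Real.sqrt_le_sqrt hYsum).trans_eq ?_
        rw [Real.sqrt_mul' _ (sq_nonneg _), Real.sqrt_sq (norm_nonneg _)]
    _ = _ := by ring

end

/-! ### Error estimates -/

lemma sqrt_sum_proj_le (v : P.VSub) : Real.sqrt (∑ i, ‖S.proj i v‖ ^ 2) ≤ S.sNorm v := by
  refine Real.sqrt_le_iff.2 ⟨S.sNorm_nonneg v, ?_⟩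
  rw [sNorm_sq]
  exact Finset.sum_le_sum fun i _ => pow_le_pow_left₀ (norm_nonneg _) (S.norm_proj_le i v) 2

lemma le_of_sq_le_mul {a b : ℝ} (ha : 0 ≤ a) (hb : 0 ≤ b) (h : a ^ 2 ≤ b * a) : a ≤ b := by
  rcases ha.eq_or_lt with h0 | h0
  · rwa [← h0]
  · exact le_of_mul_le_mul_right (by rwa [← sq]) h0

section
variable {ψ : ∀ i, Fin (S.l i) → P.VSub} {f : E d → ℝ}

lemma load_le_grad (hf : MemLp f 2 (volume.restrict P.fluid)) {w : P.VSub}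
    (hw : ∀ i, S.proj i w = 0) : ∫ x in P.fluid, f x * (w : E d → ℝ) x ≤
      (Real.sqrt (S.Lam univ))⁻¹ * l2norm P.fluid (S.scaled f) * ‖P.gradAll w‖ := by
  refine (le_abs_self _).trans ((S.load_le hf w).trans ?_)
  have := mul_le_mul_of_nonneg_left (S.sNorm_le_grad hw)
    (l2norm_nonneg P.fluid (S.scaled f))
  linarith

open Classical in
/-- The error of the multiscale solution in terms of the solution. -/
lemma error_le (hd : 0 < d) (h : S.IsMsBasis fun i j => ψ i j) {N : ℝ}
    (hN : ∀ j, ((Finset.univ.filter fun i => j ∈ S.mesh.layer i (S.k i)).card : ℝ) ≤ N)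
    (hf : MemLp f 2 (volume.restrict P.fluid)) {u ums : P.VSub} (hu : P.IsGalerkin P.VSub f u)
    (hums : P.IsGalerkin (S.spanOf fun i j => ψ i j) f ums) :
    P.aNorm (u - ums : P.VSub) ≤ (Real.sqrt (S.Lam univ))⁻¹ * l2norm P.fluid (S.scaled f) +
      Real.sqrt S.maxDecay * Real.sqrt N * S.sNorm u := by
  rw [P.aNorm_eq]
  set v := ∑ i, S.combine ψ (fun i => S.proj i u) i with hv
  refine (hu.norm_sub_le hums (sum_combine_mem_spanOf fun i => S.proj i u)).trans ?_
  have he : ∀ i, S.proj i (u - v) = 0 := fun i => by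
    rw [map_sub, hv, proj_sum_combine _ fun i j => (h i j).1.2, sub_self]
  have h1 := abs_inner_combine_le (fun i => S.proj i u) hd h he hN
  have h2 := load_le_grad hf he
  -- Since v copies the coefficients of u, the error e = u − v lies in the kernel of the
  -- projections. Its energy is the load of e, controlled by the gap, minus a(v, e), controlled by
  -- the decay.
  have h3 : ‖P.gradAll (u - v)‖ ^ 2 = (∫ x in P.fluid, f x * ((u - v : P.VSub) : E d → ℝ) x) -
      inner ℝ (P.gradAll v) (P.gradAll (u - v)) := by
    rw [← hu.inner_eq (u - v).2, ← inner_sub_left, ← map_sub, real_inner_self_eq_norm_sq]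
  have h4 := mul_le_mul_of_nonneg_left (sqrt_sum_proj_le (S := S) u)
    (by positivity : 0 ≤ Real.sqrt S.maxDecay * Real.sqrt N)
  have h5 : 0 ≤ l2norm P.fluid (S.scaled f) := l2norm_nonneg _ _
  have h6 := S.sNorm_nonneg u
  refine le_of_sq_le_mul (norm_nonneg _) (by positivity) ?_
  have h7 := mul_le_mul_of_nonneg_right h4 (norm_nonneg (P.gradAll (u - v)))
  have h8 := neg_abs_le (inner ℝ (P.gradAll v) (P.gradAll (u - v)))
  rw [h3, add_mul]
  linarith

open Classical in
/-- The error of the multiscale solution in terms of the global solution. -/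
lemma error_le_glo (hd : 0 < d) (h : S.IsMsBasis fun i j => ψ i j)
    {φ : ∀ i, Fin (S.l i) → P.VSub} (hφ : S.IsGloBasis fun i j => φ i j) {N : ℝ}
    (hN : ∀ j, ((Finset.univ.filter fun i => j ∈ S.mesh.layer i (S.k i)).card : ℝ) ≤ N)
    (hf : MemLp f 2 (volume.restrict P.fluid)) {u ums uglo : P.VSub}
    (hu : P.IsGalerkin P.VSub f u)
    (hums : P.IsGalerkin (S.spanOf fun i j => ψ i j) f ums)
    (huglo : P.IsGalerkin (S.spanOf fun i j => φ i j) f uglo) :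
    P.aNorm (u - ums : P.VSub) ≤ (Real.sqrt (S.Lam univ))⁻¹ * l2norm P.fluid (S.scaled f) +
      Real.sqrt S.maxDecay * Real.sqrt N * S.sNorm uglo := by
  rw [P.aNorm_eq]
  have hF := l2norm_nonneg P.fluid (S.scaled f)
  have hg := S.sNorm_nonneg uglo
  set v := ∑ i, S.combine ψ (fun i => S.proj i uglo) i with hv
  refine (hu.norm_sub_le hums (sum_combine_mem_spanOf fun i => S.proj i uglo)).trans ?_
  have e0 : u - v = (u - uglo) + (uglo - v) := (sub_add_sub_cancel _ _ _).symm
  rw [e0, map_add]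
  refine (norm_add_le _ _).trans (add_le_add ?_ ?_)
  · set z := ∑ i, S.combine φ (fun i => S.proj i (u - uglo)) i with hz
    have hzs : (z : E d → ℝ) ∈ S.spanOf fun i j => φ i j := sum_combine_mem_spanOf _
    have hw : ∀ i, S.proj i (u - uglo - z) = 0 := fun i => by
      rw [map_sub, hz, proj_sum_combine _ fun i j => (hφ i j).1.2, sub_self]
    have h1 : inner ℝ (P.gradAll (u - uglo)) (P.gradAll z) = 0 := by
      rw [map_sub, inner_sub_left, hu.inner_eq z.2, huglo.inner_eq hzs, sub_self]
    have h2 := inner_eq_zero_of_mem_spanOf hφ hzs hw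
    have h3 := inner_eq_zero_of_mem_spanOf hφ huglo.1 hw
    -- z is orthogonal to u − u_glo by Galerkin orthogonality and to u − u_glo − z as an element of
    -- V_glo, hence to itself.
    have hz0 : P.gradAll z = 0 := by
      rw [map_sub, inner_sub_right, real_inner_comm, h1, real_inner_self_eq_norm_sq] at h2
      have : ‖P.gradAll z‖ = 0 := by nlinarith
      exact norm_eq_zero.1 this
    have h4 : ‖P.gradAll (u - uglo - z)‖ ^ 2 =
        ∫ x in P.fluid, f x * ((u - uglo - z : P.VSub) : E d → ℝ) x := by
      have h5 : ∀ y, inner ℝ (P.gradAll (u - uglo - z)) y = inner ℝ (P.gradAll u) y -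
          inner ℝ (P.gradAll uglo) y - inner ℝ (P.gradAll z) y := fun y => by
        rw [map_sub, map_sub, inner_sub_left, inner_sub_left]
      rw [← hu.inner_eq (u - uglo - z).2, ← real_inner_self_eq_norm_sq, h5, h2, h3, sub_zero,
        sub_zero]
    have h5 : P.gradAll (u - uglo) = P.gradAll (u - uglo - z) := by
      rw [map_sub _ _ z, hz0, sub_zero]
    rw [h5]
    exact le_of_sq_le_mul (norm_nonneg _) (by positivity) (h4 ▸ load_le_grad hf hw)
  · have he : ∀ i, S.proj i (uglo - v) = 0 := fun i => by
      rw [map_sub, hv, proj_sum_combine _ fun i j => (h i j).1.2, sub_self]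
    have h1 := abs_inner_combine_le (fun i => S.proj i uglo) hd h he hN
    have h2 := inner_eq_zero_of_mem_spanOf hφ huglo.1 he
    -- Being in V_glo, u_glo is orthogonal to its error e, which lies in the kernel; only the
    -- localized functions remain.
    have h3 : ‖P.gradAll (uglo - v)‖ ^ 2 = - inner ℝ (P.gradAll v) (P.gradAll (uglo - v)) := by
      have h5 : ∀ y, inner ℝ (P.gradAll (uglo - v)) y = inner ℝ (P.gradAll uglo) y -
          inner ℝ (P.gradAll v) y := fun y => by rw [map_sub, inner_sub_left]
      rw [← real_inner_self_eq_norm_sq, h5, h2, zero_sub]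
    have h4 := mul_le_mul_of_nonneg_left (sqrt_sum_proj_le (S := S) uglo)
      (by positivity : 0 ≤ Real.sqrt S.maxDecay * Real.sqrt N)
    have h7 := mul_le_mul_of_nonneg_right h4 (norm_nonneg (P.gradAll (uglo - v)))
    have h8 := neg_abs_le (inner ℝ (P.gradAll v) (P.gradAll (uglo - v)))
    refine le_of_sq_le_mul (norm_nonneg _) (by positivity) ?_
    rw [h3]
    linarith

end

lemma spanOf_le {ψ : S.BasisFamily} (h : ∀ i j, ψ i j ∈ P.V) :
    S.spanOf ψ ≤ P.VSub := Submodule.span_le.2 (by rintro _ ⟨i, j, rfl⟩; exact h i j)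

/-- The error estimate for general partitions of unity. -/
theorem aNorm_sub_le (hd : 0 < d) {ρ : ℝ} (hρ : 0 < ρ) (hT : S.mesh.IsQuasiUniform ρ)
    {ψms ψglo : S.BasisFamily} (hms : S.IsMsBasis ψms) (hglo : S.IsGloBasis ψglo)
    {f u ums uglo : E d → ℝ} (hf : MemLp f 2 (volume.restrict P.fluid))
    (hu : P.IsGalerkin P.V f u) (hums : P.IsGalerkin (S.spanOf ψms) f ums)
    (huglo : P.IsGalerkin (S.spanOf ψglo) f uglo) :
    P.aNorm (u - ums) ≤ (Real.sqrt (S.Lam univ))⁻¹ * l2norm P.fluid (S.scaled f) +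
      Real.sqrt S.maxDecay * Real.sqrt (((S.maxK + 1) / ρ) ^ d) * S.sNorm uglo := by
  classical
  have h1 : ∀ i j, ψms i j ∈ P.V := fun i j => (S.mesh.mem_V0_region_iff.1 (hms i j).1.1).1
  have h2 : ∀ i j, ψglo i j ∈ P.V := fun i j => (hglo i j).1.1
  exact error_le_glo (S := S) (ψ := fun i j => ⟨ψms i j, h1 i j⟩) (φ := fun i j => ⟨ψglo i j, h2 i j⟩)
    (u := ⟨u, hu.1⟩) (ums := ⟨ums, spanOf_le h1 hums.1⟩) (uglo := ⟨uglo, spanOf_le h2 huglo.1⟩)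
    hd hms hglo (fun j => S.mesh.card_layer_le hd hρ hT S.k
      (fun i => Finset.le_sup (f := S.k) (Finset.mem_univ i)) j _ (by simp)) hf hu hums huglo

end Discretization

/-! ### Meshes of axis-parallel boxes -/

/-- Telescoping, one factor at a time; this gives Lipschitz constants of the multilinear basis
functions. -/
lemma abs_prod_sub_prod_le {ι : Type*} (s : Finset ι) {a b : ι → ℝ}
    (ha : ∀ t ∈ s, |a t| ≤ 1) (hb : ∀ t ∈ s, |b t| ≤ 1) :
    |∏ t ∈ s, a t - ∏ t ∈ s, b t| ≤ ∑ t ∈ s, |a t - b t| := by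
  classical
  induction s using Finset.induction_on with
  | empty => simp
  | insert t s ht ih =>
    rw [Finset.prod_insert ht, Finset.prod_insert ht, Finset.sum_insert ht]
    have h1 := ih (fun t h => ha t (Finset.mem_insert_of_mem h))
      fun t h => hb t (Finset.mem_insert_of_mem h)
    have h2 : |∏ t ∈ s, a t| ≤ 1 := by
      rw [Finset.abs_prod]
      exact Finset.prod_le_one (fun _ _ => abs_nonneg _)
        fun t h => ha t (Finset.mem_insert_of_mem h)
    have h3 := hb t (Finset.mem_insert_self t s)
    have h4 : a t * ∏ t ∈ s, a t - b t * ∏ t ∈ s, b t =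
        (a t - b t) * ∏ t ∈ s, a t + b t * (∏ t ∈ s, a t - ∏ t ∈ s, b t) := by ring
    rw [h4]
    refine (abs_add_le _ _).trans ?_
    rw [abs_mul, abs_mul]
    exact add_le_add (mul_le_of_le_one_right (abs_nonneg _) h2)
      ((mul_le_of_le_one_left (abs_nonneg _) h3).trans h1)

namespace PartitionOfUnity
variable {P : PerforatedDomain d} {T : CoarseMesh P} {X : PartitionOfUnity T}

/-- A vertex is determined by the set of directions in which it lies on the lower side. -/
lemma IsBilinear.card_verts_le (hX : X.IsBilinear) (i : Fin T.numCells) :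
    (T.verts i).card ≤ 2 ^ d := by
  classical
  obtain ⟨lo, hi, -, -, h⟩ := hX i
  have h1 : (T.verts i).card ≤ (Finset.univ : Finset (Fin d → Bool)).card := by
    refine Finset.card_le_card_of_injOn (fun j t => decide (T.node j t = lo t))
      (fun _ _ => Finset.mem_coe.2 (Finset.mem_univ _)) fun j hj j' hj' he => ?_
    refine T.node_injective (PiLp.ext fun t => ?_)
    have h2 := (h j hj).1 t
    have h3 := (h j' hj').1 t
    have h4 := congrFun he t
    simp only [decide_eq_decide] at h4
    by_cases h5 : T.node j t = lo t
    · rw [h5, h4.1 h5]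
    · rw [h2.resolve_left h5, h3.resolve_left fun h6 => h5 (h4.2 h6)]
  simpa using h1

variable {i : Fin T.numCells} {lo hi : Fin d → ℝ}

lemma side_le_meshSize (hlt : ∀ t, lo t < hi t)
    (hc : T.cell i = {x | ∀ t, lo t ≤ x t ∧ x t ≤ hi t}) (t : Fin d) :
    hi t - lo t ≤ T.meshSize := by
  classical
  have h1 : (WithLp.toLp 2 lo : E d) ∈ T.cell i := by
    rw [hc]; exact fun s => ⟨le_rfl, (hlt s).le⟩
  have h2 : (WithLp.toLp 2 (Function.update lo t (hi t)) : E d) ∈ T.cell i := by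
    rw [hc]
    intro s
    by_cases hs : s = t
    · subst hs; simpa using (hlt s).le
    · simpa [Function.update_of_ne hs] using (hlt s).le
  refine le_trans ?_ (T.dist_le_meshSize h2 h1)
  rw [dist_eq_norm]
  refine le_trans ?_ (PiLp.norm_apply_le _ t)
  simp [le_abs_self]

lemma le_side {ρ : ℝ} (hρ : 0 < ρ) (hT : T.IsQuasiUniform ρ) (hd : 0 < d)
    (hc : T.cell i = {x | ∀ t, lo t ≤ x t ∧ x t ≤ hi t}) (t : Fin d) :
    2 * (ρ * T.meshSize) ≤ hi t - lo t := by
  obtain ⟨c, hball⟩ := hT i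
  have hH := T.meshSize_pos hd i
  have key : ∀ r, |r| = ρ * T.meshSize → lo t ≤ c t + r ∧ c t + r ≤ hi t := fun r hr => by
    have : c + EuclideanSpace.single t r ∈ T.cell i := by
      refine hball ?_
      rw [Metric.mem_closedBall, dist_eq_norm, add_sub_cancel_left]
      simp [hr]
    rw [hc] at this
    simpa using this t
  have h1 := (key (ρ * T.meshSize) (abs_of_pos (by positivity))).2
  have h2 := (key (-(ρ * T.meshSize)) (by rw [abs_neg]; exact abs_of_pos (by positivity))).1
  linarith

/-- The inscribed ball makes every side at least 2ρH long, so each of the d linear factors has slope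
at most 1/(2ρH); at most 2^d basis functions are nonzero on the cell. -/
lemma IsBilinear.weight_le (hX : X.IsBilinear) (hd : 0 < d) {ρ : ℝ} (hρ : 0 < ρ)
    (hT : T.IsQuasiUniform ρ) (i : Fin T.numCells) : ∀ x ∈ T.elem i,
      X.κ x ≤ 2 ^ d * (d / (2 * (ρ * T.meshSize))) ^ 2 := by
  intro x hx
  obtain ⟨lo, hi, hlt, hc, h⟩ := hX i
  have hH := T.meshSize_pos hd i
  set L : NNReal := ⟨d / (2 * (ρ * T.meshSize)), by positivity⟩ with hL
  have hLip : ∀ j ∈ T.verts i, LipschitzOnWith L (X.χ j) (T.cell i) := fun j hj => by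
    refine LipschitzOnWith.of_dist_le_mul fun y hy z hz => ?_
    rw [(h j hj).2 y hy, (h j hj).2 z hz, Real.dist_eq]
    rw [hc] at hy hz
    have hunit : ∀ y ∈ {x : E d | ∀ t, lo t ≤ x t ∧ x t ≤ hi t}, ∀ t ∈ Finset.univ,
        |if T.node j t = lo t then (hi t - y t) / (hi t - lo t)
          else (y t - lo t) / (hi t - lo t)| ≤ 1 := fun y hy t _ => by
      have h1 := hy t
      have h2 := sub_pos.2 (hlt t)
      split_ifs
      · rw [abs_of_nonneg (div_nonneg (by linarith) h2.le), div_le_one h2]; linarith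
      · rw [abs_of_nonneg (div_nonneg (by linarith) h2.le), div_le_one h2]; linarith
    refine (abs_prod_sub_prod_le _ (hunit y hy) (hunit z hz)).trans ?_
    have hterm : ∀ t, |(if T.node j t = lo t then (hi t - y t) / (hi t - lo t)
          else (y t - lo t) / (hi t - lo t)) - (if T.node j t = lo t then
          (hi t - z t) / (hi t - lo t) else (z t - lo t) / (hi t - lo t))| ≤
        dist y z / (2 * (ρ * T.meshSize)) := fun t => by
      have h2 := sub_pos.2 (hlt t)
      have h3 : |y t - z t| ≤ dist y z := by
        rw [dist_eq_norm]
        exact PiLp.norm_apply_le (y - z) t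
      have h4 : |y t - z t| / (hi t - lo t) ≤ dist y z / (2 * (ρ * T.meshSize)) :=
        div_le_div₀ dist_nonneg h3 (by positivity) (le_side hρ hT hd hc t)
      refine le_trans (le_of_eq ?_) h4
      split_ifs
      · rw [← sub_div, abs_div, abs_of_pos h2, abs_sub_comm (y t)]; ring_nf
      · rw [← sub_div, abs_div, abs_of_pos h2]; ring_nf
    refine (Finset.sum_le_sum fun t _ => hterm t).trans (le_of_eq ?_)
    rw [Finset.sum_const, Finset.card_univ, Fintype.card_fin, nsmul_eq_mul]
    show _ = d / (2 * (ρ * T.meshSize)) * dist y z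
    ring
  have hfd : ∀ j ∈ T.verts i, ‖fderiv ℝ (X.χ j) x‖ ≤ d / (2 * (ρ * T.meshSize)) := fun j hj =>
    norm_fderiv_le_of_lipschitzOn ℝ (eventually_mem_cell hx) (hLip j hj)
  have hzero : ∀ j ∉ T.verts i, fderiv ℝ (X.χ j) x = 0 := fun j hj => by
    have : X.χ j =ᶠ[nhds x] fun _ => 0 := by
      filter_upwards [eventually_mem_cell hx] with z hz using X.support i j hj z hz
    rw [this.fderiv_eq]
    simp
  unfold κ weight
  rw [← Finset.sum_subset (Finset.subset_univ (T.verts i)) fun j _ hj => by rw [hzero j hj]; simp]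
  refine (Finset.sum_le_sum fun j hj => pow_le_pow_left₀ (norm_nonneg _) (hfd j hj) 2).trans ?_
  rw [Finset.sum_const, nsmul_eq_mul]
  refine mul_le_mul_of_nonneg_right ?_ (sq_nonneg _)
  exact_mod_cast hX.card_verts_le i

/-- The basis functions of the upper face in one coordinate direction add up to an affine function
with slope at least 1/H, so their gradients cannot all be small. -/
lemma IsBilinear.le_weight (hX : X.IsBilinear) (hd : 0 < d) (i : Fin T.numCells) :
    ∀ᵐ x ∂(volume.restrict (T.elem i)), 1 ≤ 2 ^ d * T.meshSize ^ 2 * X.κ x := by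
  classical
  obtain ⟨lo, hi, hlt, hc, h⟩ := hX i
  have hH := T.meshSize_pos hd i
  set t : Fin d := ⟨0, hd⟩
  have ht := sub_pos.2 (hlt t)
  set F := (T.verts i).filter fun j => T.node j t ≠ lo t with hF
  have hfac : ∀ j ∈ F, ∀ x ∈ T.cell i, ∀ x' ∈ T.cell i, x' t = hi t → (∀ s ≠ t, x' s = x s) →
      X.χ j x = (x t - lo t) / (hi t - lo t) * X.χ j x' := by
    intro j hj x hx x' hx' h1 h2
    rw [hF, Finset.mem_filter] at hj
    rw [(h j hj.1).2 x hx, (h j hj.1).2 x' hx', ← Finset.mul_prod_erase _ _ (Finset.mem_univ t),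
      ← Finset.mul_prod_erase _ (fun t => if T.node j t = lo t then
        (hi t - x' t) / (hi t - lo t) else (x' t - lo t) / (hi t - lo t)) (Finset.mem_univ t),
      if_neg hj.2, if_neg hj.2, h1, div_self ht.ne', one_mul]
    congr 1
    refine Finset.prod_congr rfl fun s hs => ?_
    rw [h2 s (Finset.ne_of_mem_erase hs)]
  have hsum : ∀ x ∈ T.cell i, ∑ j ∈ F, X.χ j x = (x t - lo t) / (hi t - lo t) := by
    intro x hx
    -- Move x to the upper face. There the χ_j of all other vertices vanish, so the sum over F
    -- equals 1 by the partition of unity alone, without knowing that all corners are nodes.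
    set x' : E d := WithLp.toLp 2 (Function.update x t (hi t)) with hx'
    have e1 : x' t = hi t := by simp [hx']
    have e2 : ∀ s ≠ t, x' s = x s := fun s hs => by simp [hx', Function.update_of_ne hs]
    have hmem : x' ∈ T.cell i := by
      rw [hc] at hx ⊢
      intro s
      by_cases hs : s = t
      · rw [hs, e1]; exact ⟨(hlt t).le, le_rfl⟩
      · rw [e2 s hs]; exact hx s
    have hone : ∑ j ∈ F, X.χ j x' = 1 := by
      rw [← X.sum_verts_eq_one hmem, hF, Finset.sum_filter_of_ne]
      intro j hj hne hlo
      refine hne ?_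
      rw [(h j hj).2 x' hmem]
      refine Finset.prod_eq_zero (Finset.mem_univ t) ?_
      rw [if_pos hlo, e1, sub_self, zero_div]
    rw [Finset.sum_congr rfl fun j hj => hfac j hj x hx x' hmem e1 e2, ← Finset.mul_sum, hone,
      mul_one]
  filter_upwards [X.ae_differentiableAt i, ae_restrict_mem (T.isOpen_elem i).measurableSet]
    with x hx hxi
  have hsumd : HasFDerivAt (fun z => ∑ j ∈ F, X.χ j z) (∑ j ∈ F, fderiv ℝ (X.χ j) x) x :=
    HasFDerivAt.fun_sum fun j _ => (hx j).hasFDerivAt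
  have haff : HasFDerivAt (fun z : E d => (z t - lo t) / (hi t - lo t))
      ((hi t - lo t)⁻¹ • (EuclideanSpace.proj t : E d →L[ℝ] ℝ)) x := by
    have h1 : HasFDerivAt (fun z : E d => z t) (EuclideanSpace.proj t : E d →L[ℝ] ℝ) x :=
      (EuclideanSpace.proj t : E d →L[ℝ] ℝ).hasFDerivAt
    simpa only [div_eq_inv_mul] using (h1.sub_const (lo t)).const_mul (hi t - lo t)⁻¹
  have hev : (fun z => ∑ j ∈ F, X.χ j z) =ᶠ[nhds x] fun z => (z t - lo t) / (hi t - lo t) := by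
    filter_upwards [eventually_mem_cell hxi] with z hz using hsum z hz
  have heq := hsumd.unique (haff.congr_of_eventuallyEq hev)
  have h1 : 1 / (hi t - lo t) = ∑ j ∈ F, fderiv ℝ (X.χ j) x (EuclideanSpace.single t 1) := by
    have := congrArg (fun l : E d →L[ℝ] ℝ => l (EuclideanSpace.single t 1)) heq
    simp only [_root_.sum_apply, _root_.smul_apply] at this
    rw [this]
    simp
  have h2 : 1 / T.meshSize ≤ ∑ j ∈ F, ‖fderiv ℝ (X.χ j) x‖ := by
    refine (one_div_le_one_div_of_le ht (side_le_meshSize hlt hc t)).trans ?_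
    rw [h1]
    refine Finset.sum_le_sum fun j _ => (le_abs_self _).trans ?_
    have := (fderiv ℝ (X.χ j) x).le_opNorm (EuclideanSpace.single t 1)
    simpa using this
  have h3 : (1 / T.meshSize) ^ 2 ≤ 2 ^ d * X.κ x := by
    refine (pow_le_pow_left₀ (by positivity) h2 2).trans ((sq_sum_le_card_mul_sum_sq).trans ?_)
    refine mul_le_mul ?_ (Finset.sum_le_sum_of_subset_of_nonneg (Finset.subset_univ _)
      fun _ _ _ => sq_nonneg _) (Finset.sum_nonneg fun _ _ => sq_nonneg _) (by positivity)
    exact_mod_cast (Finset.card_filter_le _ _).trans (hX.card_verts_le i)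
  rw [div_pow, one_pow, div_le_iff₀ (by positivity)] at h3
  linarith

end PartitionOfUnity

lemma CoarseMesh.CT_le {P : PerforatedDomain d} {T : CoarseMesh P} {X : PartitionOfUnity T}
    (hX : X.IsBilinear) : T.CT ≤ 4 ^ d := by
  have h : (Finset.univ.sup fun i => (T.verts i).card) ≤ 2 ^ d :=
    Finset.sup_le fun i _ => hX.card_verts_le i
  have h2 : ((Finset.univ.sup fun i => (T.verts i).card : ℕ) : ℝ) ≤ 2 ^ d := by exact_mod_cast h
  refine (pow_le_pow_left₀ (Nat.cast_nonneg _) h2 2).trans (le_of_eq ?_)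
  rw [← pow_mul, mul_comm, pow_mul]
  norm_num

namespace Discretization
variable {P : PerforatedDomain d} (S : Discretization P)

lemma l2norm_scaled_le (hX : S.pou.IsBilinear) (hd : 0 < d) {f : E d → ℝ}
    (hf : MemLp f 2 (volume.restrict P.fluid)) (hH : 0 ≤ S.mesh.meshSize) :
    l2norm P.fluid (S.scaled f) ≤ Real.sqrt (2 ^ d) * S.mesh.meshSize * l2norm P.fluid f := by
  refine Real.sqrt_le_iff.2 ⟨mul_nonneg (by positivity) (l2norm_nonneg _ _), ?_⟩
  rw [mul_pow, mul_pow, Real.sq_sqrt (by positivity), l2norm,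
    Real.sq_sqrt (integral_nonneg fun x => sq_nonneg _), ← integral_const_mul]
  refine integral_mono_ae (S.memLp_scaled hf).integrable_sq (hf.integrable_sq.const_mul _) ?_
  filter_upwards [S.mesh.ae_fluid_iff.2 fun i => hX.le_weight hd i] with x hx
  have h0 := S.pou.κ_nonneg x
  have h1 : 0 < S.pou.κ x := by
    rcases h0.eq_or_lt with h | h
    · rw [← h] at hx; norm_num at hx
    · exact h
  have h2 : (S.pou.κ x ^ (-(1 / 2) : ℝ)) ^ 2 = (S.pou.κ x)⁻¹ := by
    rw [← Real.rpow_natCast, ← Real.rpow_mul h0, ← Real.rpow_neg_one]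
    norm_num
  rw [scaled, mul_pow, h2]
  refine mul_le_mul_of_nonneg_right ?_ (sq_nonneg _)
  rw [inv_le_iff_one_le_mul₀ h1]
  exact hx

lemma sNorm_le_of_bilinear (hX : S.pou.IsBilinear) (hd : 0 < d) {ρ : ℝ} (hρ : 0 < ρ)
    (hT : S.mesh.IsQuasiUniform ρ) (hH : 0 ≤ S.mesh.meshSize) (v : P.VSub) :
    S.sNorm v ≤ Real.sqrt (2 ^ d) * (d / (2 * (ρ * S.mesh.meshSize))) * l2norm P.fluid v := by
  have hv := (P.VSub_le_H1 v.2).1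
  refine Real.sqrt_le_iff.2 ⟨mul_nonneg (by positivity) (l2norm_nonneg _ _), ?_⟩
  rw [mul_pow, mul_pow, Real.sq_sqrt (by positivity), l2norm,
    Real.sq_sqrt (integral_nonneg fun x => sq_nonneg _), ← integral_const_mul]
  refine integral_mono_of_nonneg (Filter.Eventually.of_forall fun x => ?_)
    (hv.integrable_sq.const_mul _) ?_
  · simp only [Pi.zero_apply, mul_assoc]
    exact mul_nonneg (S.pou.κ_nonneg x) (mul_self_nonneg _)
  · filter_upwards [S.mesh.ae_fluid_iff.2 fun i => ae_restrict_of_forall_mem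
      (S.mesh.isOpen_elem i).measurableSet (hX.weight_le hd hρ hT i)] with x hx
    rw [mul_assoc, ← sq]
    exact mul_le_mul_of_nonneg_right hx (sq_nonneg _)

end Discretization

/-! ### The Friedrichs inequality -/

section
open Filter Topology

/-- If `‖M x‖` is controlled by `‖G x‖` and finitely many functionals, and if no sequence with
`G x_n → 0` has a nonzero limit of `M x_n`, then `‖M x‖` is controlled by `‖G x‖`. -/
lemma exists_norm_le_of_finiteDimensional {X H H' F : Type*} [AddCommGroup X] [Module ℝ X]
    [NormedAddCommGroup H] [NormedSpace ℝ H] [CompleteSpace H] [NormedAddCommGroup H']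
    [NormedSpace ℝ H'] [NormedAddCommGroup F] [NormedSpace ℝ F] [ProperSpace F]
    (M : X →ₗ[ℝ] H) (G : X →ₗ[ℝ] H') (Q : X →ₗ[ℝ] F) {C : ℝ} (hQ : ∀ x, ‖Q x‖ ≤ C * ‖M x‖)
    (hM : ∀ x, ‖M x‖ ≤ C * (‖G x‖ + ‖Q x‖))
    (hcl : ∀ (x : ℕ → X) (m : H), Tendsto (fun n => M (x n)) atTop (𝓝 m) →
      Tendsto (fun n => G (x n)) atTop (𝓝 0) → m = 0) :
    ∃ K, 0 < K ∧ ∀ x, ‖M x‖ ≤ K * ‖G x‖ := by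
  by_contra! hcon
  -- A normalized sequence that violates the estimate. A subsequence of Q x_n converges in the
  -- proper space, so by `hM` the M x_n are Cauchy; their limit has norm 1 and must vanish.
  have hex : ∀ n : ℕ, ∃ x, ‖M x‖ = 1 ∧ ‖G x‖ ≤ 1 / ((n : ℝ) + 1) := fun n => by
    obtain ⟨x, hx⟩ := hcon (n + 1) (by positivity)
    have hpos : 0 < ‖M x‖ := lt_of_le_of_lt (by positivity) hx
    refine ⟨‖M x‖⁻¹ • x, ?_, ?_⟩
    · rw [map_smul, norm_smul, norm_inv, norm_norm, inv_mul_cancel₀ hpos.ne']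
    · rw [map_smul, norm_smul, norm_inv, norm_norm, inv_mul_eq_div, div_le_div_iff₀ hpos
        (by positivity)]
      linarith
  choose x hx1 hx2 using hex
  have hG : Tendsto (fun n => ‖G (x n)‖) atTop (𝓝 0) :=
    squeeze_zero (fun _ => norm_nonneg _) hx2 tendsto_one_div_add_atTop_nhds_zero_nat
  obtain ⟨y, -, φ, hφ, hy⟩ := tendsto_subseq_of_bounded (s := Metric.closedBall (0 : F) C)
    Metric.isBounded_closedBall (x := fun n => Q (x n)) fun n => by
      rw [mem_closedBall_zero_iff]
      simpa [hx1 n] using hQ (x n)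
  have hGφ := hG.comp hφ.tendsto_atTop
  have hcauchy : CauchySeq fun n => M (x (φ n)) := by
    have h1 := cauchySeq_iff_tendsto_dist_atTop_0.1 hy.cauchySeq
    rw [cauchySeq_iff_tendsto_dist_atTop_0]
    have h2 : Tendsto (fun p : ℕ × ℕ => ‖G (x (φ p.1))‖) atTop (𝓝 0) := by
      rw [← prod_atTop_atTop_eq]; exact hGφ.comp tendsto_fst
    have h3 : Tendsto (fun p : ℕ × ℕ => ‖G (x (φ p.2))‖) atTop (𝓝 0) := by
      rw [← prod_atTop_atTop_eq]; exact hGφ.comp tendsto_snd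
    have h4 := ((h2.add h3).add h1).const_mul |C|
    rw [add_zero, add_zero, mul_zero] at h4
    refine squeeze_zero (fun _ => dist_nonneg) (fun p => ?_) h4
    rw [dist_eq_norm, ← map_sub]
    refine (hM _).trans ?_
    refine (mul_le_mul_of_nonneg_right (le_abs_self C) (by positivity)).trans ?_
    refine mul_le_mul_of_nonneg_left (add_le_add ?_ ?_) (abs_nonneg C)
    · rw [map_sub]; exact norm_sub_le _ _
    · rw [map_sub, ← dist_eq_norm]; exact le_rfl
  obtain ⟨m, hm⟩ := cauchySeq_tendsto_of_complete hcauchy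
  have h0 := hcl (fun n => x (φ n)) m hm (tendsto_zero_iff_norm_tendsto_zero.2 hGφ)
  have h1 := hm.norm
  simp only [hx1, h0, norm_zero] at h1
  exact one_ne_zero (tendsto_nhds_unique tendsto_const_nhds h1)

/-- The class in `L²`. -/
def toL2 (U : Set (E d)) : L2Sub U →ₗ[ℝ] Lp ℝ 2 (volume.restrict U) where
  toFun v := MemLp.toLp (v : E d → ℝ) v.2
  map_add' _ _ := rfl
  map_smul' _ _ := rfl

lemma norm_toL2 {U : Set (E d)} (v : L2Sub U) : ‖toL2 U v‖ = l2norm U v :=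
  (l2norm_eq_norm v.2).symm

lemma eq_of_ae_const {W : Set (E d)} (hW : IsOpen W) (hne : W.Nonempty) {v : E d → ℝ} {a b : ℝ}
    (ha : v =ᵐ[volume.restrict W] fun _ => a) (hb : v =ᵐ[volume.restrict W] fun _ => b) : a = b := by
  have h1 : volume.restrict W ≠ 0 := by
    rw [Ne, Measure.restrict_eq_zero]
    exact (hW.measure_pos volume hne).ne'
  have : NeBot (ae (volume.restrict W)) := ae_neBot.2 h1
  obtain ⟨x, hx, hx'⟩ := (ha.and hb).exists
  exact hx.symm.trans hx'

namespace PerforatedDomain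
variable (P : PerforatedDomain d)

/-- v is constant on the connected domain and on a ball around a boundary point off the
perforations. As Ω has no slits, the ball contains an open piece outside the closure of Ω, where v =
0, and it also meets Ω, so both constants are 0. -/
lemma ae_eq_zero_of_isGrad_zero (hc : IsConnected P.fluid)
    (hbd : (frontier P.Ω \ P.holes).Nonempty) {v : E d → ℝ} (hv : IsGrad P.holesᶜ v 0)
    (h0 : ∀ᵐ x ∂(volume.restrict P.holesᶜ), x ∉ P.fluid → v x = 0) :
    v =ᵐ[volume.restrict P.holesᶜ] 0 := by
  obtain ⟨c, hcf⟩ := (hv.mono P.isOpen_fluid.measurableSet P.fluid_subset_compl_holes).ae_const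
    P.isOpen_fluid hc.isPreconnected
  obtain ⟨x₀, hx₀, hx₀h⟩ := hbd
  obtain ⟨r, hr, hball⟩ := Metric.isOpen_iff.1 P.isOpen_compl_holes x₀ hx₀h
  obtain ⟨c', hcb⟩ := (hv.mono measurableSet_ball hball).ae_const Metric.isOpen_ball
    (convex_ball x₀ r).isPreconnected
  have hW1 : (Metric.ball x₀ r \ closure P.Ω).Nonempty := by
    rw [sdiff_nonempty]
    intro hsub
    have h1 : x₀ ∈ interior (closure P.Ω) :=
      mem_interior.2 ⟨_, hsub, Metric.isOpen_ball, Metric.mem_ball_self hr⟩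
    rw [P.regular] at h1
    rw [P.isOpen.frontier_eq] at hx₀
    exact hx₀.2 h1
  have hW2 : (Metric.ball x₀ r ∩ P.Ω).Nonempty :=
    mem_closure_iff.1 (frontier_subset_closure hx₀) _ Metric.isOpen_ball (Metric.mem_ball_self hr)
  have e1 : c' = 0 := by
    refine eq_of_ae_const (Metric.isOpen_ball.sdiff isClosed_closure) hW1
      (ae_restrict_of_ae_restrict_of_subset sdiff_subset hcb) ?_
    have h2 := ae_restrict_of_ae_restrict_of_subset (sdiff_subset.trans hball :
      Metric.ball x₀ r \ closure P.Ω ⊆ P.holesᶜ) h0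
    filter_upwards [h2, ae_restrict_mem
      (Metric.isOpen_ball.sdiff isClosed_closure).measurableSet] with x hx hxm
    exact hx fun h => hxm.2 (subset_closure h.1)
  have e2 : c = c' := by
    refine eq_of_ae_const (Metric.isOpen_ball.inter P.isOpen) hW2
      (ae_restrict_of_ae_restrict_of_subset (fun x hx => ⟨hx.2, hball hx.1⟩ :
        Metric.ball x₀ r ∩ P.Ω ⊆ P.fluid) hcf)
      (ae_restrict_of_ae_restrict_of_subset inter_subset_left hcb)
  rw [e2, e1, Filter.EventuallyEq, ae_restrict_iff' P.isOpen_fluid.measurableSet] at hcf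
  rw [Filter.EventuallyEq, ae_restrict_iff' P.isOpen_compl_holes.measurableSet]
  rw [ae_restrict_iff' P.isOpen_compl_holes.measurableSet] at h0
  filter_upwards [hcf, h0] with x h1 h2 hx
  by_cases hxf : x ∈ P.fluid
  · exact h1 hxf
  · exact h2 hx hxf

lemma VSub_le_H1_compl_holes : P.VSub ≤ H1 P.holesᶜ := P.V0Sub_le_H1 P.isOpen_compl_holes subset_rfl

/-- The gradient of the extension by zero, off the perforations. -/
def gradExt : P.VSub →ₗ[ℝ] Lp (E d) 2 (volume.restrict P.holesᶜ) :=
  gradL _ P.isOpen_compl_holes ∘ₗ Submodule.inclusion P.VSub_le_H1_compl_holes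

/-- The extension by zero as a class in `L²`, off the perforations. -/
def massExt : P.VSub →ₗ[ℝ] Lp ℝ 2 (volume.restrict P.holesᶜ) :=
  toL2 _ ∘ₗ Submodule.inclusion (P.VSub_le_H1_compl_holes.trans (H1_le_L2Sub _))

lemma norm_massExt (v : P.VSub) : ‖P.massExt v‖ = l2norm P.fluid v := by
  refine (norm_toL2 _).trans (congrArg Real.sqrt ?_)
  refine setIntegral_eq_of_subset_of_ae_sdiff_eq_zero
    P.isOpen_compl_holes.measurableSet.nullMeasurableSet P.fluid_subset_compl_holes ?_
  have h := v.2.2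
  rw [ae_restrict_iff' P.isOpen_compl_holes.measurableSet] at h
  filter_upwards [h] with x hx hxm
  show (v : E d → ℝ) x ^ 2 = 0
  rw [hx hxm.1 hxm.2]
  norm_num

/-- The weak gradient is a closed operator: pass to the limit in the integration by parts formula,
read as inner products in L². -/
lemma massExt_limit {x : ℕ → P.VSub} {m : Lp ℝ 2 (volume.restrict P.holesᶜ)}
    (hm : Tendsto (fun n => P.massExt (x n)) atTop (𝓝 m))
    (hG : Tendsto (fun n => P.gradExt (x n)) atTop (𝓝 0)) : IsGrad P.holesᶜ m 0 := by
  refine ⟨Lp.memLp m, MemLp.zero, fun η h1 h2 h3 y => ?_⟩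
  have hη := memLp_test_fderiv (U := P.holesᶜ) h1 h2 y
  have hηy : MemLp (fun x => η x • y) 2 (volume.restrict P.holesᶜ) :=
    (ContinuousLinearMap.toSpanSingleton ℝ y).comp_memLp' (memLp_test h1 h2)
  have e1 : ∀ n, inner ℝ (P.massExt (x n)) hη.toLp = - inner ℝ (P.gradExt (x n)) hηy.toLp :=
    fun n => by
      have hg := MemH1.isGrad (P.VSub_le_H1_compl_holes (x n).2)
      have e2 : inner ℝ (P.massExt (x n)) hη.toLp =
          ∫ z in P.holesᶜ, (x n : E d → ℝ) z * fderiv ℝ η z y := by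
        refine (inner_toLp hg.memLp hη).trans ?_
        exact integral_congr_ae (Eventually.of_forall fun z => by simp [mul_comm])
      have e3 : inner ℝ (P.gradExt (x n)) hηy.toLp =
          ∫ z in P.holesᶜ, inner ℝ (weakGrad P.holesᶜ (x n) z) y * η z := by
        refine (inner_toLp hg.memLp_grad hηy).trans ?_
        exact integral_congr_ae (Eventually.of_forall fun z => by
          simp [inner_smul_right, mul_comm])
      rw [e2, e3]
      exact hg.weak η h1 h2 h3 y
  have t1 : Tendsto (fun n => inner ℝ (P.massExt (x n)) hη.toLp) atTop (𝓝 (inner ℝ m hη.toLp)) :=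
    hm.inner tendsto_const_nhds
  have t2 : Tendsto (fun n => - inner ℝ (P.gradExt (x n)) hηy.toLp) atTop (𝓝 (-0)) := by
    have := (Tendsto.inner (𝕜 := ℝ) hG (tendsto_const_nhds (x := hηy.toLp))).neg
    rwa [inner_zero_left] at this
  simp_rw [e1] at t1
  have e4 := tendsto_nhds_unique t1 t2
  have e5 : inner ℝ m hη.toLp = ∫ z in P.holesᶜ, m z * fderiv ℝ η z y := by
    conv_lhs => rw [← Lp.toLp_coeFn m (Lp.memLp m)]
    rw [inner_toLp]
    exact integral_congr_ae (Eventually.of_forall fun z => by simp [mul_comm])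
  rw [← e5, e4]
  simp

lemma massExt_limit_vanish {x : ℕ → P.VSub} {m : Lp ℝ 2 (volume.restrict P.holesᶜ)}
    (hm : Tendsto (fun n => P.massExt (x n)) atTop (𝓝 m)) :
    ∀ᵐ z ∂(volume.restrict P.holesᶜ), z ∉ P.fluid → m z = 0 := by
  obtain ⟨ns, -, hns⟩ := (tendstoInMeasure_of_tendsto_Lp hm).exists_seq_tendsto_ae
  have h1 : ∀ᵐ z ∂(volume.restrict P.holesᶜ), ∀ n, z ∉ P.fluid → P.massExt (x n) z = 0 := by
    refine ae_all_iff.2 fun n => ?_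
    have h2 : P.massExt (x n) =ᵐ[volume.restrict P.holesᶜ] (x n : E d → ℝ) :=
      MemLp.coeFn_toLp (P.VSub_le_H1_compl_holes (x n).2).1
    filter_upwards [h2, (x n).2.2] with z h3 h4 hz
    rw [h3, h4 hz]
  filter_upwards [hns, h1] with z h2 h3 hz
  simp only [h3 _ hz] at h2
  exact tendsto_nhds_unique h2 tendsto_const_nhds

end PerforatedDomain

/-- No regularity of ∂Ω is assumed, but the existence of a mesh forces it: off the perforations, ∂Ω
is covered by the boundaries of finitely many convex cells. -/
lemma CoarseMesh.ae_notMem_frontier_domain {P : PerforatedDomain d} (T : CoarseMesh P) :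
    ∀ᵐ x : E d, x ∉ P.holes → x ∉ frontier P.Ω := by
  filter_upwards [T.ae_notMem_frontier] with x hx hxh hxf
  have hclosed : IsClosed (⋃ i, T.cell i) := isClosed_iUnion_of_finite T.isClosed_cell
  have h1 : x ∈ closure P.fluid := by
    have h2 := P.isOpen_compl_holes.inter_closure (t := P.Ω)
      ⟨hxh, frontier_subset_closure hxf⟩
    exact closure_mono (fun y hy => ⟨hy.2, hy.1⟩ : P.holesᶜ ∩ P.Ω ⊆ P.fluid) h2
  obtain ⟨i, hi⟩ := mem_iUnion.1 (closure_minimal T.cover hclosed h1)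
  refine hx i ⟨subset_closure hi, fun h2 => ?_⟩
  rw [P.isOpen.frontier_eq] at hxf
  exact hxf.2 (T.interior_cell_subset i h2)

namespace Discretization
variable {P : PerforatedDomain d} (S : Discretization P)

/-- The extension by zero has no gradient on the open set outside the closure of Ω, and the
remaining part of ∂Ω is null. -/
lemma norm_gradExt (S : Discretization P) (v : P.VSub) : ‖P.gradExt v‖ = ‖P.gradAll v‖ := by
  have hg := MemH1.isGrad (P.VSub_le_H1_compl_holes v.2)
  rw [← sq_eq_sq₀ (norm_nonneg _) (norm_nonneg _)]
  refine (norm_gradL_sq P.isOpen_compl_holes hg).trans (Eq.trans ?_ (norm_gradL_sq P.isOpen_fluid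
    (hg.mono P.isOpen_fluid.measurableSet P.fluid_subset_compl_holes)).symm)
  refine setIntegral_eq_of_subset_of_ae_sdiff_eq_zero
    P.isOpen_compl_holes.measurableSet.nullMeasurableSet P.fluid_subset_compl_holes ?_
  have hopen : IsOpen (P.holesᶜ \ closure P.Ω) := P.isOpen_compl_holes.sdiff isClosed_closure
  have hz : weakGrad P.holesᶜ (v : E d → ℝ) =ᵐ[volume.restrict (P.holesᶜ \ closure P.Ω)] 0 := by
    refine IsGrad.unique hopen (hg.mono hopen.measurableSet sdiff_subset)
      ((IsGrad.zero _).congr ?_ (ae_eq_refl _))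
    filter_upwards [ae_restrict_of_ae_restrict_of_subset sdiff_subset v.2.2,
      ae_restrict_mem hopen.measurableSet] with x hx hxm
    exact (hx fun h => hxm.2 (subset_closure h.1)).symm
  rw [Filter.EventuallyEq, ae_restrict_iff' hopen.measurableSet] at hz
  filter_upwards [hz, S.mesh.ae_notMem_frontier_domain] with x h1 h2 hx
  have h3 : x ∉ closure P.Ω := fun h => by
    have h4 := h2 hx.1
    rw [P.isOpen.frontier_eq] at h4
    exact hx.2 ⟨by_contra fun h5 => h4 ⟨h, h5⟩, hx.1⟩
  rw [h1 ⟨hx.1, h3⟩]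
  simp

lemma exists_sNorm_le : ∃ C, 0 ≤ C ∧ ∀ v : P.VSub, S.sNorm v ≤ C * l2norm P.fluid v := by
  obtain ⟨C, hC0, hC⟩ := S.pou.exists_weight_le
  refine ⟨Real.sqrt C, Real.sqrt_nonneg _, fun v => ?_⟩
  have hv := (P.VSub_le_H1 v.2).1
  refine Real.sqrt_le_iff.2 ⟨mul_nonneg (Real.sqrt_nonneg _) (l2norm_nonneg _ _), ?_⟩
  rw [mul_pow, Real.sq_sqrt hC0.le, l2norm, Real.sq_sqrt (integral_nonneg fun x => sq_nonneg _),
    ← integral_const_mul]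
  refine integral_mono_of_nonneg (Eventually.of_forall fun x => ?_)
    (hv.integrable_sq.const_mul _) ?_
  · simp only [Pi.zero_apply, mul_assoc]
    exact mul_nonneg (S.pou.κ_nonneg x) (mul_self_nonneg _)
  · filter_upwards [S.mesh.ae_fluid_iff.2 fun i => ae_restrict_of_forall_mem
      (S.mesh.isOpen_elem i).measurableSet (hC i)] with x hx
    rw [mul_assoc, ← sq]
    exact mul_le_mul_of_nonneg_right hx (sq_nonneg _)

lemma exists_le_sNorm : ∃ C, 0 ≤ C ∧ ∀ v : P.VSub, l2norm P.fluid v ≤ C * S.sNorm v := by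
  obtain ⟨κ₀, h0, h⟩ := S.pou.exists_le_weight
  refine ⟨Real.sqrt κ₀⁻¹, Real.sqrt_nonneg _, fun v => ?_⟩
  have hv := (P.VSub_le_H1 v.2).1
  have hm := S.isWeight_fluid.memLp hv
  refine Real.sqrt_le_iff.2 ⟨mul_nonneg (Real.sqrt_nonneg _) (S.sNorm_nonneg _), ?_⟩
  rw [mul_pow, Real.sq_sqrt (inv_nonneg.2 h0.le), sNorm, Real.sq_sqrt, sForm, ← integral_const_mul]
  · refine integral_mono_ae hv.integrable_sq ?_ ?_
    · refine Integrable.const_mul (hm.integrable_sq.congr (Eventually.of_forall fun x => ?_)) _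
      simp only [mul_pow, Real.sq_sqrt (S.pou.κ_nonneg x)]
      ring
    · filter_upwards [S.mesh.ae_fluid_iff.2 h] with x hx
      rw [inv_mul_eq_div, le_div_iff₀ h0, mul_assoc, ← sq, mul_comm]
      exact mul_le_mul_of_nonneg_right hx (sq_nonneg _)
  · refine integral_nonneg fun x => ?_
    simp only [Pi.zero_apply, mul_assoc]
    exact mul_nonneg (S.pou.κ_nonneg x) (mul_self_nonneg _)

/-- The spectral gaps bound the mass by the energy and finitely many coefficients, which supplies
the compactness; a limit with zero gradient vanishes by the boundary condition. The weight is
bounded above and below, so weighted and plain L² norms may be exchanged. -/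
lemma exists_friedrichs (S : Discretization P) (hc : IsConnected P.fluid) (hbd : (frontier P.Ω \ P.holes).Nonempty) :
    ∃ K, 0 < K ∧ ∀ v : P.VSub, l2norm P.fluid v ≤ K * ‖P.gradAll v‖ := by
  obtain ⟨C₁, hC₁, h1⟩ := S.exists_sNorm_le
  obtain ⟨C₂, hC₂, h2⟩ := S.exists_le_sNorm
  set n := (S.mesh.numCells : ℝ) with hn
  have hn0 : 0 ≤ n := Nat.cast_nonneg _
  set R : ℝ := n * (1 + (S.Lam univ)⁻¹) with hR
  have hL : 0 ≤ (S.Lam univ)⁻¹ := inv_nonneg.2 (S.Lam_nonneg _)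
  have hR0 : 0 ≤ R := by positivity
  have key := exists_norm_le_of_finiteDimensional P.massExt P.gradExt (LinearMap.pi S.proj)
    (C := C₁ + C₂ * Real.sqrt R) (fun v => ?_) (fun v => ?_) fun x m hm hG => ?_
  · simpa only [P.norm_massExt, S.norm_gradExt] using key
  · rw [P.norm_massExt]
    have h3 : ‖LinearMap.pi S.proj v‖ ≤ S.sNorm v := by
      refine (pi_norm_le_iff_of_nonneg (S.sNorm_nonneg _)).2 fun i => ?_
      refine (S.norm_proj_le i v).trans (le_of_sq_le_sq ?_ (S.sNorm_nonneg _))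
      rw [S.sNorm_sq]
      exact Finset.single_le_sum (f := fun i => ‖S.mass i v‖ ^ 2) (fun _ _ => sq_nonneg _)
        (Finset.mem_univ i)
    refine h3.trans ((h1 v).trans (mul_le_mul_of_nonneg_right ?_ (l2norm_nonneg _ _)))
    have : 0 ≤ C₂ * Real.sqrt R := by positivity
    linarith
  · rw [P.norm_massExt, S.norm_gradExt]
    set a := ‖P.gradAll v‖
    set b := ‖LinearMap.pi S.proj v‖
    have ha : 0 ≤ a := norm_nonneg _
    have hb : 0 ≤ b := norm_nonneg _
    have h3 : S.sNorm v ≤ Real.sqrt R * (a + b) := by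
      refine le_of_sq_le_sq ?_ (by positivity)
      rw [S.sNorm_sq, mul_pow, Real.sq_sqrt hR0]
      have h4 : ∀ i ∈ (Finset.univ : Finset (Fin S.mesh.numCells)), ‖S.mass i v‖ ^ 2 ≤
          (1 + (S.Lam univ)⁻¹) * (a + b) ^ 2 := fun i _ => by
        have h5 := S.gap_estimate i v
        have h6 := S.gap i
        have h7 : ‖S.grad i v‖ ^ 2 ≤ a ^ 2 := by
          rw [S.norm_gradAll_sq]
          exact Finset.single_le_sum (f := fun i => ‖S.grad i v‖ ^ 2) (fun _ _ => sq_nonneg _)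
            (Finset.mem_univ i)
        have h8 : ‖S.proj i v‖ ^ 2 ≤ b ^ 2 :=
          pow_le_pow_left₀ (norm_nonneg _) (norm_le_pi_norm (LinearMap.pi S.proj v) i) 2
        have h9 : ((S.spec i).eigenval (S.l i))⁻¹ ≤ (S.Lam univ)⁻¹ :=
          inv_anti₀ (S.Lam_pos ⟨i, mem_univ _⟩) (S.Lam_le (mem_univ i))
        have h10 : ‖S.mass i v‖ ^ 2 ≤
            ((S.spec i).eigenval (S.l i))⁻¹ * ‖S.grad i v‖ ^ 2 + ‖S.proj i v‖ ^ 2 := by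
          refine le_of_mul_le_mul_left ?_ h6
          rw [mul_add, ← mul_assoc, mul_inv_cancel₀ h6.ne', one_mul]
          exact h5
        have h11 := mul_le_mul h9 h7 (sq_nonneg _) hL
        nlinarith [mul_nonneg ha hb, mul_nonneg hL (mul_nonneg ha hb), mul_nonneg hL (sq_nonneg b)]
      refine (Finset.sum_le_card_nsmul _ _ _ h4).trans (le_of_eq ?_)
      rw [Finset.card_univ, Fintype.card_fin, nsmul_eq_mul, hR]
      ring
    have h4 := mul_le_mul_of_nonneg_left h3 hC₂
    have h5 : 0 ≤ C₁ * (a + b) := by positivity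
    have h6 := h2 v
    nlinarith
  · have h3 := P.ae_eq_zero_of_isGrad_zero hc hbd (P.massExt_limit hm hG)
      (P.massExt_limit_vanish hm)
    exact Lp.ext (h3.trans (Lp.coeFn_zero _ _ _).symm)

end Discretization
end

/-! ### The rate of convergence on meshes of boxes -/

lemma CoarseMesh.exists_numCells_mul_le (P : PerforatedDomain d) {ρ : ℝ} (hρ : 0 < ρ) :
    ∃ C, 0 < C ∧ ∀ T : CoarseMesh P, T.IsQuasiUniform ρ → 0 < T.meshSize →
      (T.numCells : ℝ) * T.meshSize ^ d ≤ C := by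
  have hb : 0 < volume.real (Metric.ball (0 : E d) 1) :=
    ENNReal.toReal_pos (Metric.measure_ball_pos _ _ one_pos).ne' measure_ball_lt_top.ne
  have hW : volume (closure P.Ω) ≠ ⊤ := P.isBounded.closure.measure_lt_top.ne
  refine ⟨volume.real (closure P.Ω) / (ρ ^ d * volume.real (Metric.ball (0 : E d) 1)) + 1,
    by positivity, fun T hT hH => ?_⟩
  have h1 := T.card_mul_le_volume hT Finset.univ (closure P.Ω) (fun i _ => T.cell_subset i) 0
  rw [Measure.addHaar_ball_of_pos _ _ (by positivity), finrank_euclideanSpace, Fintype.card_fin,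
    Finset.card_univ, Fintype.card_fin] at h1
  have h2 := ENNReal.toReal_mono hW h1
  rw [ENNReal.toReal_mul, ENNReal.toReal_mul, ENNReal.toReal_natCast,
    ENNReal.toReal_ofReal (by positivity)] at h2
  refine le_trans ?_ (le_add_of_nonneg_right zero_le_one)
  rw [le_div_iff₀ (by positivity)]
  refine le_trans (le_of_eq ?_) h2
  rw [Measure.real, mul_pow]
  ring

namespace Discretization
variable {P : PerforatedDomain d} (S : Discretization P)

lemma Lam_anti {A A' : Set (Fin S.mesh.numCells)} (hA : A.Nonempty) (h : A ⊆ A') :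
    S.Lam A' ≤ S.Lam A :=
  csInf_le_csInf (toFinite _).bddBelow (hA.image _) (image_mono h)

lemma Gam_mono {A A' : Set (Fin S.mesh.numCells)} (hA : A.Nonempty) (h : A ⊆ A') :
    S.Gam A ≤ S.Gam A' :=
  csSup_le_csSup (toFinite _).bddAbove (hA.image _) (image_mono h)

lemma D_le {M : ℝ} (hM : 0 < M) (hX : S.pou.IsBilinear) (hC : S.Cpi ≤ M) (hΓ : S.Gam univ ≤ M)
    {A : Set (Fin S.mesh.numCells)} {i : Fin S.mesh.numCells} (hi : i ∈ A) :
    S.D A ≤ M ^ 2 * 4 ^ d * (1 + M) := by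
  have h1 := S.one_le_Cpi i
  have h2 : S.mesh.CT ≤ 4 ^ d := CoarseMesh.CT_le hX
  have h3 := (S.Gam_mono ⟨i, hi⟩ (subset_univ A)).trans hΓ
  have h4 : 0 ≤ S.Gam A := ((S.spec i).eigenval_nonneg _).trans (S.le_Gam hi)
  have h5 : 0 ≤ S.mesh.CT := sq_nonneg _
  unfold D
  gcongr

/-- The bounds by M reduce D to one constant. The hypothesis on k_i then beats the power H^{4+d},
also for H > 1, where the logarithm is negative. -/
lemma decay_le (hd : 0 < d) {M γ θ : ℝ} (hM : 0 < M) (hγ : 0 < γ) (hθ0 : 0 < θ) (hθ1 : θ ≤ 1)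
    (hθ : θ * (2 * Real.sqrt (M ^ 2 * 4 ^ d * (1 + M))) ≤ Real.sqrt γ)
    (hX : S.pou.IsBilinear) (hC : S.Cpi ≤ M) (hΓ : S.Gam univ ≤ M) (hΛ : S.Lam univ ≤ M)
    (i : Fin S.mesh.numCells)
    (hk : 2 * (4 + d) / θ * Real.log (S.mesh.meshSize⁻¹) /
      Real.log (1 + Real.sqrt (S.Lam (S.mesh.layer i (S.k i - 1))) /
        Real.sqrt (max γ (S.Gam (S.mesh.layer i (S.k i - 1))))) ≤ (S.k i : ℝ)) :
    S.decay i ≤ 8 * (M ^ 2 * 4 ^ d * (1 + M)) ^ 2 * (M + 1) * (S.Lam univ)⁻¹ *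
      S.mesh.meshSize ^ (4 + d) := by
  set A := S.mesh.layer i (S.k i - 1) with hA
  have hiA : i ∈ A := S.mesh.self_mem_layer i _
  have hH := S.mesh.meshSize_pos hd i
  have hΛ0 : 0 < S.Lam univ := S.Lam_pos ⟨i, mem_univ i⟩
  set D₀ := M ^ 2 * 4 ^ d * (1 + M) with hD₀
  have hD₀pos : 0 < D₀ := by positivity
  have hD1 : 0 < S.D A := zero_lt_one.trans_le (S.D_pos hd hiA)
  have hΛA : 0 < Real.sqrt (S.Lam A) := Real.sqrt_pos.2 (S.Lam_pos ⟨i, hiA⟩)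
  set x := Real.sqrt (S.Lam A) / Real.sqrt (max γ (S.Gam A)) with hx
  have hx0 : 0 < x := div_pos hΛA (Real.sqrt_pos.2 (lt_max_of_lt_left hγ))
  set q := 1 + Real.sqrt (S.Lam A) / (2 * Real.sqrt (S.D A)) with hq
  have hq1 : 1 + θ * x ≤ q := by
    refine add_le_add_right ?_ 1
    have h1 : x ≤ Real.sqrt (S.Lam A) / Real.sqrt γ :=
      div_le_div_of_nonneg_left hΛA.le (Real.sqrt_pos.2 hγ) (Real.sqrt_le_sqrt (le_max_left _ _))
    have h2 : Real.sqrt (S.D A) ≤ Real.sqrt D₀ := Real.sqrt_le_sqrt (S.D_le hM hX hC hΓ hiA)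
    have h3 := Real.sqrt_pos.2 hD1
    refine (mul_le_mul_of_nonneg_left h1 hθ0.le).trans ?_
    rw [← mul_div_assoc, div_le_div_iff₀ (Real.sqrt_pos.2 hγ) (by positivity)]
    have h4 : θ * (2 * Real.sqrt (S.D A)) ≤ Real.sqrt γ :=
      (mul_le_mul_of_nonneg_left (by linarith) hθ0.le).trans hθ
    nlinarith
  -- Bernoulli's inequality (1 + x)^θ ≤ 1 + θx for θ ≤ 1 moves the constant θ out of the logarithm.
  have hlog : θ * Real.log (1 + x) ≤ Real.log q := by
    rw [← Real.log_rpow (by positivity)]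
    refine Real.log_le_log (by positivity) (le_trans ?_ hq1)
    exact rpow_one_add_le_one_add_mul_self (by linarith) hθ0.le hθ1
  have hL0 : 0 < Real.log (1 + x) := Real.log_pos (by linarith)
  rw [div_le_iff₀ hL0, Real.log_inv] at hk
  have hk2 : (2 : ℝ) ≤ S.k i := by exact_mod_cast S.two_le_k i
  have hq0 : 0 < q := by linarith [mul_pos hθ0 hx0]
  -- As k_i ≥ 2, k_i ≤ 2(k_i − 1); this is the factor 2 in the constant c.
  have hqk : q ^ (1 - (S.k i : ℤ)) ≤ S.mesh.meshSize ^ (4 + d) := by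
    rw [← Real.log_le_log_iff (by positivity) (by positivity), Real.log_zpow, Real.log_pow]
    push_cast
    have h1 : 2 * (4 + (d : ℝ)) * -Real.log S.mesh.meshSize ≤
        θ * (S.k i * Real.log (1 + x)) := by
      have := mul_le_mul_of_nonneg_left hk hθ0.le
      have e : θ * (2 * (4 + (d : ℝ)) / θ * -Real.log S.mesh.meshSize) =
          2 * (4 + (d : ℝ)) * -Real.log S.mesh.meshSize := by
        field_simp
      rwa [e] at this
    have h2 : (S.k i : ℝ) * (θ * Real.log (1 + x)) ≤ (2 * (S.k i - 1)) * Real.log q :=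
      mul_le_mul (by linarith) hlog (by positivity) (by linarith)
    nlinarith
  -- The summand 1 is absorbed through Λ ≤ M. If the region is the whole domain, the complement is
  -- empty and the inverse is 0 by the default value of `sInf`.
  have hinv : 1 + (S.Lam Aᶜ)⁻¹ ≤ (M + 1) * (S.Lam univ)⁻¹ := by
    have h1 : (S.Lam Aᶜ)⁻¹ ≤ (S.Lam univ)⁻¹ := by
      rcases Aᶜ.eq_empty_or_nonempty with h | h
      · rw [h, Lam, image_empty, Real.sInf_empty, inv_zero]
        exact inv_nonneg.2 hΛ0.le
      · exact inv_anti₀ hΛ0 (S.Lam_anti h (subset_univ _))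
    have h2 : 1 ≤ M * (S.Lam univ)⁻¹ := by
      rw [← div_eq_mul_inv, le_div_iff₀ hΛ0, one_mul]
      exact hΛ
    linarith
  have hDk := S.D_le hM hX hC hΓ (S.mesh.self_mem_layer i (S.k i))
  have hDk0 := zero_le_one.trans (S.D_pos hd (S.mesh.self_mem_layer i (S.k i)))
  have hLc : 0 ≤ (S.Lam Aᶜ)⁻¹ := inv_nonneg.2 (S.Lam_nonneg _)
  calc S.decay i = 8 * S.D (S.mesh.layer i (S.k i)) ^ 2 * (1 + (S.Lam Aᶜ)⁻¹) *
        q ^ (1 - (S.k i : ℤ)) := rfl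
    _ ≤ 8 * D₀ ^ 2 * ((M + 1) * (S.Lam univ)⁻¹) * S.mesh.meshSize ^ (4 + d) := by
        gcongr
    _ = _ := by ring

/-- Stability of the solution in the weighted norm. -/
lemma sNorm_solution_le (hX : S.pou.IsBilinear) (hd : 0 < d) {ρ : ℝ} (hρ : 0 < ρ)
    (hT : S.mesh.IsQuasiUniform ρ) (hH : 0 < S.mesh.meshSize) {K : ℝ} (hK0 : 0 < K)
    (hK : ∀ v : P.VSub, l2norm P.fluid v ≤ K * ‖P.gradAll v‖) {f : E d → ℝ}
    (hf : MemLp f 2 (volume.restrict P.fluid)) {u : P.VSub} (hu : P.IsGalerkin P.VSub f u) :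
    S.sNorm u ≤ Real.sqrt (2 ^ d) * (d / (2 * ρ)) * K ^ 2 * S.mesh.meshSize⁻¹ *
      l2norm P.fluid f := by
  have hF := l2norm_nonneg P.fluid f
  have h1 : ‖P.gradAll u‖ ≤ K * l2norm P.fluid f := by
    refine le_of_sq_le_mul (norm_nonneg _) (by positivity) ?_
    rw [← real_inner_self_eq_norm_sq, hu.inner_eq u.2]
    refine (le_abs_self _).trans ((abs_integral_mul_le hf (P.VSub_le_H1 u.2).1).trans ?_)
    have := mul_le_mul_of_nonneg_left (hK u) hF
    linarith
  have h2 : l2norm P.fluid u ≤ K * (K * l2norm P.fluid f) :=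
    (hK u).trans (mul_le_mul_of_nonneg_left h1 hK0.le)
  refine (S.sNorm_le_of_bilinear hX hd hρ hT hH.le u).trans
    ((mul_le_mul_of_nonneg_left h2 (by positivity)).trans (le_of_eq ?_))
  field_simp

/-- The rate of convergence on meshes of boxes. -/
theorem aNorm_sub_le_meshSize (hd : 0 < d) {ρ M γ θ K N : ℝ} (hρ : 0 < ρ) (hM : 0 < M)
    (hγ : 0 < γ) (hθ0 : 0 < θ) (hθ1 : θ ≤ 1)
    (hθ : θ * (2 * Real.sqrt (M ^ 2 * 4 ^ d * (1 + M))) ≤ Real.sqrt γ) (hK0 : 0 < K)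
    (hK : ∀ v : P.VSub, l2norm P.fluid v ≤ K * ‖P.gradAll v‖)
    (hN : (S.mesh.numCells : ℝ) * S.mesh.meshSize ^ d ≤ N) (hne : P.fluid.Nonempty)
    (hT : S.mesh.IsQuasiUniform ρ) (hX : S.pou.IsBilinear) (hC : S.Cpi ≤ M)
    (hΓ : S.Gam univ ≤ M) (hΛ : S.Lam univ ≤ M)
    (hk : ∀ i, 2 * (4 + d) / θ * Real.log (S.mesh.meshSize⁻¹) /
      Real.log (1 + Real.sqrt (S.Lam (S.mesh.layer i (S.k i - 1))) /
        Real.sqrt (max γ (S.Gam (S.mesh.layer i (S.k i - 1))))) ≤ (S.k i : ℝ))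
    {ψms : S.BasisFamily} (hms : S.IsMsBasis ψms) {f u ums : E d → ℝ}
    (hf : MemLp f 2 (volume.restrict P.fluid)) (hu : P.IsGalerkin P.V f u)
    (hums : P.IsGalerkin (S.spanOf ψms) f ums) :
    P.aNorm (u - ums) ≤ (Real.sqrt (2 ^ d) +
      Real.sqrt (8 * (M ^ 2 * 4 ^ d * (1 + M)) ^ 2 * (M + 1)) * Real.sqrt N *
        (Real.sqrt (2 ^ d) * (d / (2 * ρ)) * K ^ 2)) *
      S.mesh.meshSize * (Real.sqrt (S.Lam univ))⁻¹ * l2norm P.fluid f := by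
  classical
  obtain ⟨x, hx⟩ := hne
  obtain ⟨i₀, -⟩ := mem_iUnion.1 (S.mesh.cover hx)
  have : Nonempty (Fin S.mesh.numCells) := ⟨i₀⟩
  have hH := S.mesh.meshSize_pos hd i₀
  have h1 : ∀ i j, ψms i j ∈ P.V := fun i j => (S.mesh.mem_V0_region_iff.1 (hms i j).1.1).1
  -- The k_i are bounded only from below, so the overlap is estimated by the number of cells instead
  -- of a power of k + 1.
  have herr := error_le (S := S) (ψ := fun i j => ⟨ψms i j, h1 i j⟩) (u := ⟨u, hu.1⟩)
    (ums := ⟨ums, spanOf_le h1 hums.1⟩) (N := S.mesh.numCells) hd hms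
    (fun j => by
      have := Finset.card_filter_le Finset.univ fun i => j ∈ S.mesh.layer i (S.k i)
      rw [Finset.card_univ, Fintype.card_fin] at this
      exact_mod_cast this) hf hu hums
  refine herr.trans ?_
  set H := S.mesh.meshSize
  set F := l2norm P.fluid f
  have hF : 0 ≤ F := l2norm_nonneg _ _
  have hs : S.sNorm u ≤ _ := S.sNorm_solution_le hX hd hρ hT hH hK0 hK hf (u := ⟨u, hu.1⟩) hu
  have hscaled := S.l2norm_scaled_le hX hd hf hH.le
  set Λ := S.Lam univ
  have hΛ0 : 0 < Real.sqrt Λ := Real.sqrt_pos.2 (S.Lam_pos ⟨i₀, mem_univ _⟩)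
  set CE := 8 * (M ^ 2 * 4 ^ d * (1 + M)) ^ 2 * (M + 1)
  set Cs := Real.sqrt (2 ^ d) * (d / (2 * ρ)) * K ^ 2
  -- The exponent 4 + d splits after taking the root: H^{d/2} compensates the root of the number of
  -- cells, and H² the factor H^{-1} in the weighted norm of u.
  have hE : Real.sqrt S.maxDecay ≤ Real.sqrt CE * (Real.sqrt Λ)⁻¹ * (H ^ 2 * Real.sqrt (H ^ d)) := by
    have h2 : S.maxDecay ≤ CE * Λ⁻¹ * H ^ (4 + d) := ciSup_le fun i =>
      S.decay_le hd hM hγ hθ0 hθ1 hθ hX hC hΓ hΛ i (hk i)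
    refine (Real.sqrt_le_sqrt h2).trans (le_of_eq ?_)
    have hCE : 0 ≤ CE := by positivity
    have hΛ' : 0 ≤ Λ⁻¹ := inv_nonneg.2 (S.Lam_nonneg _)
    rw [Real.sqrt_mul (mul_nonneg hCE hΛ'), Real.sqrt_mul hCE, Real.sqrt_inv, pow_add,
      Real.sqrt_mul (pow_nonneg hH.le 4), show H ^ 4 = (H ^ 2) ^ 2 by ring,
      Real.sqrt_sq (by positivity)]
  have hN' : Real.sqrt (H ^ d) * Real.sqrt S.mesh.numCells ≤ Real.sqrt N := by
    rw [← Real.sqrt_mul (by positivity), mul_comm]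
    exact Real.sqrt_le_sqrt hN
  have hCs : 0 ≤ Cs := by positivity
  have hp : Real.sqrt S.maxDecay * Real.sqrt S.mesh.numCells * S.sNorm u ≤
      Real.sqrt CE * Real.sqrt N * Cs * H * (Real.sqrt Λ)⁻¹ * F := by
    calc Real.sqrt S.maxDecay * Real.sqrt S.mesh.numCells * S.sNorm u
        ≤ Real.sqrt CE * (Real.sqrt Λ)⁻¹ * (H ^ 2 * Real.sqrt (H ^ d)) *
          Real.sqrt S.mesh.numCells * (Cs * H⁻¹ * F) :=
          mul_le_mul (mul_le_mul_of_nonneg_right hE (Real.sqrt_nonneg _)) hs (S.sNorm_nonneg _)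
            (by positivity)
      _ = (Real.sqrt CE * (Real.sqrt Λ)⁻¹ * H * Cs * F) *
          (Real.sqrt (H ^ d) * Real.sqrt S.mesh.numCells) := by
          field_simp
      _ ≤ (Real.sqrt CE * (Real.sqrt Λ)⁻¹ * H * Cs * F) * Real.sqrt N :=
          mul_le_mul_of_nonneg_left hN' (by positivity)
      _ = _ := by ring
  have ht := mul_le_mul_of_nonneg_left hscaled (inv_nonneg.2 hΛ0.le)
  refine (add_le_add ht hp).trans (le_of_eq ?_)
  ring

end Discretization

end CEM

end

/-! ### The main theorem: choice of the constants -/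

theorem mainTheorem1 (d : ℕ) (hd : d = 2 ∨ d = 3) (ρ : ℝ) (hρ : 0 < ρ) :
    (∃ C : ℝ, 0 < C ∧
      ∀ (P : CEM.PerforatedDomain d) (S : CEM.Discretization P), S.mesh.IsQuasiUniform ρ →
      ∀ ψms ψglo : S.BasisFamily, S.IsMsBasis ψms → S.IsGloBasis ψglo →
      ∀ f u ums uglo : CEM.E d → ℝ,
        MeasureTheory.MemLp f 2 (MeasureTheory.volume.restrict P.fluid) →
        P.IsGalerkin P.V f u →
        P.IsGalerkin (S.spanOf ψms) f ums →
        P.IsGalerkin (S.spanOf ψglo) f uglo →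
        P.aNorm (u - ums) ≤
          C * (Real.sqrt (S.Lam Set.univ))⁻¹ * CEM.l2norm P.fluid (S.scaled f) +
          C * ((S.maxK : ℝ) + 1) ^ ((d : ℝ) / 2) * Real.sqrt S.maxDecay * S.sNorm uglo) ∧
    (∀ M γ : ℝ, 0 < M → 0 < γ → ∃ c : ℝ, 0 < c ∧
      ∀ P : CEM.PerforatedDomain d, IsConnected P.fluid → (frontier P.Ω \ P.holes).Nonempty →
      ∃ C : ℝ, 0 < C ∧
      ∀ S : CEM.Discretization P, S.mesh.IsQuasiUniform ρ → S.pou.IsBilinear →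
        S.Cpi ≤ M → S.Gam Set.univ ≤ M → S.Lam Set.univ ≤ M →
        (∀ i, c * Real.log (S.mesh.meshSize⁻¹) /
            Real.log (1 + Real.sqrt (S.Lam (S.mesh.layer i (S.k i - 1))) /
              Real.sqrt (max γ (S.Gam (S.mesh.layer i (S.k i - 1))))) ≤ (S.k i : ℝ)) →
      ∀ ψms : S.BasisFamily, S.IsMsBasis ψms →
      ∀ f u ums : CEM.E d → ℝ,
        MeasureTheory.MemLp f 2 (MeasureTheory.volume.restrict P.fluid) →
        P.IsGalerkin P.V f u →
        P.IsGalerkin (S.spanOf ψms) f ums →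
        P.aNorm (u - ums) ≤
          C * S.mesh.meshSize * (Real.sqrt (S.Lam Set.univ))⁻¹ * CEM.l2norm P.fluid f) := by
  have hd0 : 0 < d := by omega
  refine ⟨?_, fun M γ hM hγ => ?_⟩
  -- The summand 1 covers the first term, and ρ^{-d/2} comes from the overlap number.
  · refine ⟨1 + Real.sqrt (1 / ρ ^ d), by positivity, ?_⟩
    intro P S hT ψms ψglo hms hglo f u ums uglo hf hu hums huglo
    refine (CEM.Discretization.aNorm_sub_le hd0 hρ hT hms hglo hf hu hums huglo).trans ?_
    have h1 : Real.sqrt ((((S.maxK : ℝ) + 1) / ρ) ^ d) =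
        Real.sqrt (1 / ρ ^ d) * ((S.maxK : ℝ) + 1) ^ ((d : ℝ) / 2) := by
      rw [div_pow, div_eq_mul_one_div, mul_comm, Real.sqrt_mul (by positivity),
        Real.sqrt_eq_rpow (((S.maxK : ℝ) + 1) ^ d), ← Real.rpow_natCast ((S.maxK : ℝ) + 1) d,
        ← Real.rpow_mul (by positivity), mul_one_div]
    rw [h1]
    have h2 := CEM.l2norm_nonneg P.fluid (S.scaled f)
    have h3 := S.sNorm_nonneg uglo
    have h4 := Real.sqrt_nonneg (1 / ρ ^ d)
    refine add_le_add ?_ ?_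
    · have : 0 ≤ (Real.sqrt (S.Lam Set.univ))⁻¹ * CEM.l2norm P.fluid (S.scaled f) := by positivity
      nlinarith
    · have : 0 ≤ ((S.maxK : ℝ) + 1) ^ ((d : ℝ) / 2) * Real.sqrt S.maxDecay * S.sNorm uglo := by
        positivity
      nlinarith
  -- θ ≤ 1 is required by Bernoulli's inequality; the other bound compares 2√D with √γ. Only d, M
  -- and γ enter.
  · set θ := min 1 (Real.sqrt γ / (2 * Real.sqrt (M ^ 2 * 4 ^ d * (1 + M)))) with hθ
    have hs : 0 < 2 * Real.sqrt (M ^ 2 * 4 ^ d * (1 + M)) := by positivity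
    have hθ0 : 0 < θ := lt_min one_pos (div_pos (Real.sqrt_pos.2 hγ) hs)
    have hθ2 : θ * (2 * Real.sqrt (M ^ 2 * 4 ^ d * (1 + M))) ≤ Real.sqrt γ :=
      (le_div_iff₀ hs).1 (min_le_right _ _)
    refine ⟨2 * (4 + d) / θ, by positivity, fun P hc hbd => ?_⟩
    -- The Friedrichs constant is taken from one arbitrary discretization, so it depends on the
    -- domain alone; if there is none, the claim is vacuous.
    by_cases hS : Nonempty (CEM.Discretization P)
    · obtain ⟨S₀⟩ := hS
      obtain ⟨K, hK0, hK⟩ := S₀.exists_friedrichs hc hbd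
      obtain ⟨N, -, hN⟩ := CEM.CoarseMesh.exists_numCells_mul_le P hρ
      refine ⟨Real.sqrt (2 ^ d) +
        Real.sqrt (8 * (M ^ 2 * 4 ^ d * (1 + M)) ^ 2 * (M + 1)) * Real.sqrt N *
          (Real.sqrt (2 ^ d) * (d / (2 * ρ)) * K ^ 2), by positivity,
        fun S hT hX hC hΓ hΛ hk ψms hms f u ums hf hu hums => ?_⟩
      obtain ⟨x, hx⟩ := hc.nonempty
      obtain ⟨i₀, -⟩ := Set.mem_iUnion.1 (S.mesh.cover hx)
      exact S.aNorm_sub_le_meshSize hd0 hρ hM hγ hθ0 (min_le_left _ _) hθ2 hK0 hK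
          (hN S.mesh hT (S.mesh.meshSize_pos hd0 i₀)) hc.nonempty hT hX hC hΓ hΛ hk hms hf hu hums
    · exact ⟨1, one_pos, fun S => absurd ⟨S⟩ hS⟩
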